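/- **Model.** $N$ flows of update packets share a queue with infinite buffer and $M$ servers, in continuous time $t\in[0,\infty)$. The $i$-th packet of flow $n$ is generated at time $S_{n,i}$ and arrives at the queue at time $A_{n,i}$, where $0\le S_{n,1}\le S_{n,2}\le\cdots$, $S_{n,i}\le A_{n,i}$, and only finitely many packets arrive in bounded time; out-of-order arrivals are allowed. Each server transmits at most one packet at a time, and different servers do not transmit packets of the same flow simultaneously. A transmission may end with an error; the packet then returns to the queue, and the scheduler learns of the error when it occurs. Preempted packets also return to the queue. Let $D_{n,i}$ be the delivery time of packet $i$ of flow $n$. With a given initial age vector $\Delta(0^-)\in[0,\infty)^N$, the same for all policies, the age of flow $n$ at time $t$ is $$\Delta_n(t)=t-\max\bigl(\{-\Delta_n(0^-)\}\cup\{S_{n,i}: D_{n,i}\le t\}\bigr).$$ Let $\Pi$ be the set of all causal (possibly preemptive, possibly randomized) scheduling policies, that is, policies whose decisions depend only on the history and the current state of the system. A *P-MAF-LGFS* policy (preemptive, maximum age first, last generated first served) is a policy in $\Pi$ which, at time $0$ and whenever a packet arrives or a transmission ends, assigns the servers as follows. It assigns servers to the most recently generated arrived packets of the flows in decreasing order of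 the ages of the flows (ties broken arbitrarily), preempting other packets if necessary, until the most recently generated packet of every flow is under service or delivered, or all servers are used. The remaining servers, if any, are assigned arbitrarily to remaining packets, such that no server is idle while there is a waiting packet of a flow that is not under service. Let $\mathcal P_{\mathrm{sym}}$ be the set of symmetric, componentwise non-decreasing functions $[0,\infty)^N\to\mathbb R$. For real-valued processes $X,Y$ on $[0,\infty)$, write $X\le_{\mathrm{st}}Y$ if for all $n$, all $0\le t_1<\dots<t_n$ and all (measurable) upper sets $U\subseteq\mathbb R^n$, $\Pr((X(t_1),\dots,X(t_n))\in U)\le\Pr((Y(t_1),\dots,Y(t_n))\in U)$. **Corollary.** Assume that (i) the transmission errors are i.i.d. with error probability $q\in[0,1)$; (ii) the generation and arrival times are synchronized across the flows, i.e. $S_{n,i}=S_i$ and $A_{n,i}=A_i$ for all $n,i$, where $\mathcal I=\{S_i,A_i\}_{i\ge1}$ is random with an arbitrary law; (iii) the transmission times are i.i.d. exponential with rate $\mu>0$; and $\mathcal I$, the transmission times and the transmission errors are mutually independent and not influenced by the scheduling policy. Let $P$ be a P-MAF-LGFS policy and let $p_t\in\mathcal P_{\mathrm{sym}}$ for every $t\ge0$.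 Then for all $\pi\in\Pi$, $$\{p_t(\Delta_{P}(t)),\,t\in[0,\infty)\}\le_{\mathrm{st}}\{p_t(\Delta_\pi(t)),\,t\in[0,\infty)\},$$ and for every non-decreasing functional $\phi$ of real functions on $[0,\infty)$, $$\mathbb E\bigl[\phi(\{p_t(\Delta_{P}(t)),\,t\ge0\})\bigr]=\min_{\pi\in\Pi}\mathbb E\bigl[\phi(\{p_t(\Delta_\pi(t)),\,t\ge0\})\bigr],$$ provided that the expectations exist. -/

import Mathlib

open MeasureTheory ProbabilityTheory Filter Topology
open scoped NNReal ENNReal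

namespace StatusUpdate

/-! ## Primitive data of the system -/

/-- The packet generation times `I.1 n i` and the packet arrival times `I.2 n i` of the `i`-th
packet of flow `n` (packets of a flow are numbered from `0`). -/
abbrev Arrivals (N : ℕ) : Type := (Fin N → ℕ → ℝ) × (Fin N → ℕ → ℝ)

/-- Generation times are nonnegative and nondecreasing in the packet number, a packet does not
arrive before it is generated, and only finitely many packets arrive in bounded time. Arrivals out
of the order of generation are allowed. -/
structure ValidArrivals {N : ℕ} (I : Arrivals N) : Prop where
  gen_nonneg : ∀ n i, 0 ≤ I.1 n i
  gen_mono : ∀ n, Monotone (I.1 n)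
  gen_le_arr : ∀ n i, I.1 n i ≤ I.2 n i
  finite_arr : ∀ n (t : ℝ), {i | I.2 n i ≤ t}.Finite

/-- The generation and arrival times are the same for all flows. -/
def Synchronized {N : ℕ} (I : Arrivals N) : Prop :=
  ∃ S A : ℕ → ℝ, ∀ n i, I.1 n i = S i ∧ I.2 n i = A i

/-- A sample point: the generation and arrival times, the transmission times, the transmission
errors, and a seed which the scheduler may use for randomization. The transmission which server `m`
starts at the `k`-th decision epoch needs the time `X (k, m)`; if server `m` ends a transmission
right after the `k`-th decision epoch, then `E (k, m) = true` means that it ends with an error. -/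
abbrev Sample (N M : ℕ) : Type :=
  Arrivals N × (ℕ × Fin M → ℝ) × (ℕ × Fin M → Bool) × ℝ

namespace Sample

variable {N M : ℕ}

/-- generation and arrival times -/
def arrivals (ω : Sample N M) : Arrivals N := ω.1

/-- transmission times -/
def txTime (ω : Sample N M) : ℕ × Fin M → ℝ := ω.2.1

/-- transmission errors -/
def txError (ω : Sample N M) : ℕ × Fin M → Bool := ω.2.2.1

/-- seed for randomized scheduling -/
def seed (ω : Sample N M) : ℝ := ω.2.2.2

end Sample

/-- The law of the primitive data: the generation and arrival times have law `ν`, the transmission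
times are i.i.d. exponential with rate `μ`, the transmission errors are i.i.d. with probability `q`,
the seed has law `ρ`, and these four are mutually independent. -/
noncomputable def sampleLaw (N M : ℕ) (μ : ℝ) (q : unitInterval)
    (ν : Measure (Arrivals N)) (ρ : Measure ℝ) : Measure (Sample N M) :=
  ν.prod
    ((Measure.infinitePi fun _ : ℕ × Fin M => expMeasure μ).prod
      ((Measure.infinitePi fun _ : ℕ × Fin M => bernoulliMeasure true false q).prod ρ))

/-! ## Observations and causal policies -/

/-- What a server does: `some (n, i)` means that it transmits packet `i` of flow `n`, and `none`
that it is idle. -/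
abbrev Slot (N : ℕ) : Type := Option (Fin N × ℕ)

instance instMeasurableSpaceSlot (N : ℕ) : MeasurableSpace (Slot N) := ⊤

/-- What the scheduler sees at a decision epoch. -/
@[ext]
structure Obs (N M : ℕ) where
  /-- the current time -/
  time : EReal
  /-- generation times of the packets which have arrived (`⊤` for the other packets) -/
  gen : Fin N → ℕ → EReal
  /-- arrival times of the packets which have arrived (`⊤` for the other packets) -/
  arr : Fin N → ℕ → EReal
  /-- delivery times of the packets which have been delivered (`⊤` for the other packets) -/
  del : Fin N → ℕ → EReal
  /-- the transmissions which are in progress -/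
  inService : Fin M → Slot N
  /-- the transmissions which have just ended with an error -/
  failed : Fin M → Slot N

namespace Obs

variable {N M : ℕ}

/-- The components of an observation. -/
def toProd (o : Obs N M) :
    EReal × (Fin N → ℕ → EReal) × (Fin N → ℕ → EReal) × (Fin N → ℕ → EReal) ×
      (Fin M → Slot N) × (Fin M → Slot N) :=
  (o.time, o.gen, o.arr, o.del, o.inService, o.failed)

noncomputable instance instMeasurableSpaceObs : MeasurableSpace (Obs N M) :=
  MeasurableSpace.comap toProd inferInstance

/-- Packet `i` of flow `n` has arrived at the queue. -/
def Arrived (o : Obs N M) (n : Fin N) (i : ℕ) : Prop := o.arr n i ≠ ⊤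

/-- Packet `i` of flow `n` has been delivered. -/
def Delivered (o : Obs N M) (n : Fin N) (i : ℕ) : Prop := o.del n i ≠ ⊤

/-- The age of flow `n`, where `a₀` is the vector of the ages at time `0⁻`. -/
noncomputable def age (a₀ : Fin N → ℝ≥0) (o : Obs N M) (n : Fin N) : EReal :=
  o.time - max (((-(a₀ n : ℝ) : ℝ)) : EReal) (⨆ i, ⨆ _ : o.Delivered n i, o.gen n i)

/-- Packet `i` is a most recently generated packet of flow `n` among those which have arrived
(several packets can have the same generation time). -/
def Freshest (o : Obs N M) (n : Fin N) (i : ℕ) : Prop :=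
  o.Arrived n i ∧ ∀ j, o.Arrived n j → o.gen n j ≤ o.gen n i

/-- The most recently generated packet of flow `n` exists and has not been delivered. -/
def Pending (o : Obs N M) (n : Fin N) : Prop :=
  (∃ i, o.Freshest n i) ∧ ∀ i, o.Freshest n i → ¬ o.Delivered n i

/-- An admissible assignment of packets to servers: only packets which have arrived and have not
been delivered are transmitted, and different servers do not transmit packets of the same flow. -/
def Feasible (o : Obs N M) (a : Fin M → Slot N) : Prop :=
  (∀ m n i, a m = some (n, i) → o.Arrived n i ∧ ¬ o.Delivered n i) ∧
  (∀ m m' n i i', a m = some (n, i) → a m' = some (n, i') → m = m')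

/-- No server is idle while a packet waits which it is allowed to transmit, that is, an undelivered
packet of a flow that is not under service. -/
def WorkConserving (o : Obs N M) (a : Fin M → Slot N) : Prop :=
  ∀ m, a m = none → ∀ n i, o.Arrived n i → ¬ o.Delivered n i → ∃ m' i', a m' = some (n, i')

/-- Maximum age first, last generated first served: if the most recently generated packet of flow
`n` is neither delivered nor under service, then all servers transmit most recently generated
packets, of flows whose ages are at least that of flow `n`. -/
def MaxAgeFirst (a₀ : Fin N → ℝ≥0) (o : Obs N M) (a : Fin M → Slot N) : Prop :=
  ∀ n, o.Pending n →
    (∃ m i, a m = some (n, i) ∧ o.Freshest n i) ∨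
    (∀ m, ∃ n' i', a m = some (n', i') ∧ o.Freshest n' i' ∧ o.age a₀ n ≤ o.age a₀ n')

end Obs

/-- A causal (possibly preemptive, possibly randomized) scheduling policy. At the `k`-th decision
epoch it chooses, from the observations made at the epochs `0, …, k` and the seed, the packets that
the servers transmit, and the time `wait` after which it reconsiders this choice if no packet
arrives and no transmission ends before (`⊤` if it does not). -/
structure Policy (N M : ℕ) where
  /-- assignment of packets to servers -/
  assign : (k : ℕ) → (Fin (k + 1) → Obs N M) → ℝ → Fin M → Slot N
  /-- time until the assignment is reconsidered -/
  wait : (k : ℕ) → (Fin (k + 1) → Obs N M) → ℝ → EReal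
  measurable_assign : ∀ k,
    Measurable fun x : (Fin (k + 1) → Obs N M) × ℝ => assign k x.1 x.2
  measurable_wait : ∀ k,
    Measurable fun x : (Fin (k + 1) → Obs N M) × ℝ => wait k x.1 x.2
  wait_pos : ∀ k (h : Fin (k + 1) → Obs N M) u, 0 < wait k h u
  feasible : ∀ k (h : Fin (k + 1) → Obs N M) u, (h (Fin.last k)).Feasible (assign k h u)

/-- Preemptive, Maximum Age First, Last Generated First Served policies, with ties broken
arbitrarily. Packets are assigned to servers whenever a packet arrives or a transmission ends. -/
structure Policy.IsPMAFLGFS {N M : ℕ} (a₀ : Fin N → ℝ≥0) (π : Policy N M) : Prop where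
  wait_eq_top : ∀ k (h : Fin (k + 1) → Obs N M) u, π.wait k h u = ⊤
  maxAgeFirst : ∀ k (h : Fin (k + 1) → Obs N M) u, (h (Fin.last k)).MaxAgeFirst a₀ (π.assign k h u)
  workConserving : ∀ k (h : Fin (k + 1) → Obs N M) u, (h (Fin.last k)).WorkConserving (π.assign k h u)

/-! ## Evolution of the system -/

/-- The state at the `k`-th decision epoch. -/
structure State (N M k : ℕ) where
  /-- the observations up to now -/
  hist : Fin (k + 1) → Obs N M
  /-- the times at which the transmissions in progress will end (not seen by the scheduler) -/
  finish : Fin M → EReal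

open Classical in
/-- The observation at time `T`. -/
noncomputable def observe {N M : ℕ} (I : Arrivals N) (T : EReal) (del : Fin N → ℕ → EReal)
    (inService failed : Fin M → Slot N) : Obs N M where
  time := T
  gen n i := if (I.2 n i : EReal) ≤ T then (I.1 n i : EReal) else ⊤
  arr n i := if (I.2 n i : EReal) ≤ T then (I.2 n i : EReal) else ⊤
  del := del
  inService := inService
  failed := failed

open Classical in
/-- The first arrival after time `T`. -/
noncomputable def nextArrival {N : ℕ} (I : Arrivals N) (T : EReal) : EReal :=
  ⨅ n, ⨅ i, if T < (I.2 n i : EReal) then (I.2 n i : EReal) else ⊤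

namespace Policy

variable {N M : ℕ}

/-- The system starts at time `0`, with all servers idle and nothing delivered. -/
noncomputable def init (ω : Sample N M) : State N M 0 where
  hist _ := observe ω.arrivals 0 (fun _ _ => ⊤) (fun _ => none) (fun _ => none)
  finish _ := ⊤

open Classical in
/-- Evolution from the `k`-th to the next decision epoch. A server which keeps its packet continues
the transmission; a server which gets another packet starts a new transmission. The next decision
epoch is the first time at which a packet arrives, a transmission ends, or the policy wishes to
reconsider. A packet whose transmission ends is delivered if there is no error and goes back to the
queue otherwise. -/
noncomputable def step (π : Policy N M) (ω : Sample N M) (k : ℕ) (s : State N M k) :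
    State N M (k + 1) :=
  let o := s.hist (Fin.last k)
  let a := π.assign k s.hist ω.seed
  let fin : Fin M → EReal := fun m =>
    if a m = none then ⊤
    else if a m = o.inService m then s.finish m
    else o.time + (ω.txTime (k, m) : EReal)
  let T := min (o.time + π.wait k s.hist ω.seed) (min (nextArrival ω.arrivals o.time) (⨅ m, fin m))
  let o' := observe ω.arrivals T
    (fun n i =>
      if ∃ m, a m = some (n, i) ∧ fin m = T ∧ ω.txError (k, m) = false then T else o.del n i)
    (fun m => if fin m = T then none else a m)
    (fun m => if fin m = T ∧ ω.txError (k, m) = true then a m else none)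
  { hist := Fin.snoc (α := fun _ => Obs N M) s.hist o'
    finish := fin }

/-- The state at the `k`-th decision epoch under policy `π`. -/
noncomputable def run (π : Policy N M) (ω : Sample N M) : (k : ℕ) → State N M k
  | 0 => init ω
  | k + 1 => π.step ω k (π.run ω k)

/-- The delivery time of packet `i` of flow `n` (`⊤` if it is never delivered). -/
noncomputable def delivery (π : Policy N M) (ω : Sample N M) (n : Fin N) (i : ℕ) : EReal :=
  ⨅ k, ((π.run ω k).hist (Fin.last k)).del n i

/-- The generation time of the freshest packet of flow `n` which has been delivered by time `t`;
the packets delivered before time `0` enter through the ages `a₀` at time `0⁻`. -/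
noncomputable def newest (a₀ : Fin N → ℝ≥0) (π : Policy N M) (ω : Sample N M) (n : Fin N)
    (t : ℝ≥0) : ℝ :=
  sSup (insert (-(a₀ n : ℝ))
    {s | ∃ i, π.delivery ω n i ≤ ((t : ℝ) : EReal) ∧ s = ω.arrivals.1 n i})

/-- The age of flow `n` at time `t`. -/
noncomputable def age (a₀ : Fin N → ℝ≥0) (π : Policy N M) (ω : Sample N M) (t : ℝ≥0)
    (n : Fin N) : ℝ≥0 :=
  Real.toNNReal ((t : ℝ) - π.newest a₀ ω n t)

/-- The age penalty process. -/
noncomputable def penalty (a₀ : Fin N → ℝ≥0) (p : ℝ≥0 → (Fin N → ℝ≥0) → ℝ) (π : Policy N M)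
    (ω : Sample N M) (t : ℝ≥0) : ℝ :=
  p t (π.age a₀ ω t)

end Policy

/-! ## Penalty functions, stochastic ordering, expectations -/

/-- Symmetric and nondecreasing functions `[0, ∞)^N → ℝ`. -/
structure SymPenalty {N : ℕ} (p : (Fin N → ℝ≥0) → ℝ) : Prop where
  symm : ∀ (σ : Equiv.Perm (Fin N)) x, p (x ∘ σ) = p x
  mono : Monotone p

/-- Stochastic ordering of real-valued processes indexed by `[0, ∞)`. -/
def StochLE {Ω : Type*} [MeasurableSpace Ω] (P : Measure Ω) (X Y : Ω → ℝ≥0 → ℝ) : Prop :=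
  ∀ (n : ℕ) (t : Fin n → ℝ≥0), StrictMono t →
    ∀ U : Set (Fin n → ℝ), IsUpperSet U → MeasurableSet U →
      P {ω | (fun j => X ω (t j)) ∈ U} ≤ P {ω | (fun j => Y ω (t j)) ∈ U}

/-- The expectation of `f` exists, possibly as an infinite value. -/
def ExpectationExists {Ω : Type*} [MeasurableSpace Ω] (P : Measure Ω) (f : Ω → ℝ) : Prop :=
  AEMeasurable f P ∧
    (∫⁻ ω, ENNReal.ofReal (f ω) ∂P ≠ ⊤ ∨ ∫⁻ ω, ENNReal.ofReal (-f ω) ∂P ≠ ⊤)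

/-- The expectation, as an extended real number, of a random variable whose expectation exists. -/
noncomputable def expectation {Ω : Type*} [MeasurableSpace Ω] (P : Measure Ω) (f : Ω → ℝ) :
    EReal :=
  ((∫⁻ ω, ENNReal.ofReal (f ω) ∂P : ℝ≥0∞) : EReal) -
    ((∫⁻ ω, ENNReal.ofReal (-f ω) ∂P : ℝ≥0∞) : EReal)

end StatusUpdate

open StatusUpdate

/-! Memorylessness allows the transmission times to be replaced by a clock that no policy
influences. Let ticks come at rate `M * μ`, each marked with a uniformly chosen server and an error
bit; a tick ends the transmission of its server if that server is busy, and is void otherwise. Under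
every policy the observations have the same law in this tick-driven system as in the original one.
In both, given the history, the next period is a race of independent exponential clocks with outcome
law `periodLaw`, and what drives the future (the residual transmission times, respectively the
remaining ticks) is fresh and independent of the history. This is `lintegral_truncHist` and
`lintegral_tickRun`; `map_delivery` draws the conclusion for the delivery times.

In the tick-driven system the tick times are common to all policies, so policies can be compared
tick by tick. Let `v` and `w` be the vectors of generation times of the freshest delivered packets
under `π` and under `P`. The invariant is that `w` is at least `v` up to a permutation `σ` of the
flows (`Dominated`). It survives a tick if the servers of the two systems are paired suitably
(`exists_matching`). If `π` delivers for flow `f`, then `P` should deliver for `σ f`, or `σ f` is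
already up to date, or all servers of `P` carry freshest packets of flows `g` with `w g ≤ w (σ f)`.
In the last case synchronization makes the packet of `g` at least as fresh as anything `π` can
deliver, and exchanging `g` and `σ f` in the permutation restores the invariant. The pairing is
determined by the past and the time of the tick, and a uniform server remains uniform after a
permutation, so the relabelled stream that drives `P` has the law of the original one
(`map_coupled`).

Finally the coupling is carried back to two copies of the sample space by conditioning
(`exists_coupling_of_map_eq`). Sample points are needed there, and not only laws of processes,
because `φ` is an arbitrary monotone functional of the path, whose measurability is known only after
composition with the sample path. Symmetric monotone penalties respect domination
(`penalty_le_of_dominated`), so the coupled penalties are ordered at all times simultaneously, which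
gives both conclusions. -/

namespace StatusUpdate

/-! ## Families of independent identically distributed random variables -/

section IID

variable {ι κ α : Type*}

/-- Prepend an element to a sequence. -/
def cons (a : α) (s : ℕ → α) : ℕ → α
  | 0 => a
  | n + 1 => s n

@[simp] lemma cons_zero (a : α) (s : ℕ → α) : cons a s 0 = a := rfl
@[simp] lemma cons_succ (a : α) (s : ℕ → α) (n : ℕ) : cons a s (n + 1) = s n := rfl

variable [MeasurableSpace α]

/-- The law of a family, indexed by `ι`, of independent random variables with law `m`. -/
noncomputable abbrev iid (ι : Type*) (m : Measure α) : Measure (ι → α) :=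
  Measure.infinitePi fun _ : ι => m

variable (m : Measure α) [IsProbabilityMeasure m]

lemma iid_map_of_pi {γ : Type*} [MeasurableSpace γ] {P : Measure γ} {g : γ → ι → α}
    (hg : Measurable g)
    (h : ∀ (s : Finset ι) (t : ι → Set α), (∀ i, MeasurableSet (t i)) →
      P {x | ∀ i ∈ s, g x i ∈ t i} = ∏ i ∈ s, m (t i)) :
    P.map g = iid ι m := by
  refine Measure.eq_infinitePi _ fun s t ht => ?_
  rw [Measure.map_apply hg (.pi s.countable_toSet fun _ _ => ht _), ← h s t ht]
  rfl

lemma iid_box (s : Finset ι) (t : ι → Set α) (ht : ∀ i, MeasurableSet (t i)) :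
    iid ι m {x | ∀ i ∈ s, x i ∈ t i} = ∏ i ∈ s, m (t i) :=
  Measure.infinitePi_pi (fun _ : ι => m) fun i _ => ht i

lemma measurable_piecewise_prod (S : Set ι) [DecidablePred (· ∈ S)] :
    Measurable fun p : (ι → α) × (ι → α) => S.piecewise p.1 p.2 := by
  refine measurable_pi_lambda _ fun i => ?_
  by_cases h : i ∈ S
  · simp only [Set.piecewise, h, if_true]; fun_prop
  · simp only [Set.piecewise, h, if_false]; fun_prop

lemma iid_prod_map_piecewise (S : Set ι) [DecidablePred (· ∈ S)] :
    ((iid ι m).prod (iid ι m)).map (fun p => S.piecewise p.1 p.2) = iid ι m := by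
  refine iid_map_of_pi m (measurable_piecewise_prod S) fun s t ht => ?_
  have : {p : (ι → α) × (ι → α) | ∀ i ∈ s, S.piecewise p.1 p.2 i ∈ t i} =
      {x | ∀ i ∈ s.filter (· ∈ S), x i ∈ t i} ×ˢ {x | ∀ i ∈ s.filter (· ∉ S), x i ∈ t i} := by
    ext p
    simp only [Set.mem_ofPred_eq, Set.mem_prod, Finset.mem_filter]
    constructor
    · intro h
      refine ⟨fun i hi => ?_, fun i hi => ?_⟩
      · simpa [Set.piecewise, hi.2] using h i hi.1
      · simpa [Set.piecewise, hi.2] using h i hi.1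
    · rintro ⟨h1, h2⟩ i hi
      by_cases hS : i ∈ S
      · simpa [Set.piecewise, hS] using h1 i ⟨hi, hS⟩
      · simpa [Set.piecewise, hS] using h2 i ⟨hi, hS⟩
  rw [this, Measure.prod_prod, iid_box m _ t ht, iid_box m _ t ht,
    Finset.prod_filter_mul_prod_filter_not]

/-- Some members of an i.i.d. family may be replaced by independent copies. -/
lemma lintegral_iid_piecewise (S : Set ι) [DecidablePred (· ∈ S)] {f : (ι → α) → ℝ≥0∞}
    (hf : Measurable f) :
    ∫⁻ x, ∫⁻ y, f (S.piecewise x y) ∂iid ι m ∂iid ι m = ∫⁻ x, f x ∂iid ι m := by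
  conv_rhs => rw [← iid_prod_map_piecewise m S]
  rw [lintegral_map hf (measurable_piecewise_prod S), lintegral_prod]
  exact (hf.comp (measurable_piecewise_prod S)).aemeasurable

lemma iid_map_injective {e : κ → ι} (he : Function.Injective e) :
    (iid ι m).map (fun x k => x (e k)) = iid κ m := by
  classical
  refine iid_map_of_pi m (by fun_prop) fun s t ht => ?_
  -- The sides `t k` are transported along `e`; the indices outside the range of `e` get the trivial
  -- side.
  have := iid_box m (s.map ⟨e, he⟩) (fun i => if h : ∃ k, e k = i then t h.choose else Set.univ)
    (fun i => by split_ifs; exacts [ht _, .univ])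
  have key : ∀ k, (if h : ∃ k', e k' = e k then t h.choose else Set.univ) = t k := fun k => by
    rw [dif_pos ⟨k, rfl⟩]
    exact congrArg t (he (Exists.choose_spec (⟨k, rfl⟩ : ∃ k', e k' = e k)))
  rw [Finset.prod_map] at this
  simp only [Function.Embedding.coeFn_mk, key, Finset.mem_map, forall_exists_index, and_imp,
    forall_apply_eq_imp_iff₂] at this
  exact this

lemma lintegral_iid_eval (i : ι) {f : α → ℝ≥0∞} (hf : Measurable f) :
    ∫⁻ x, f (x i) ∂iid ι m = ∫⁻ a, f a ∂m := by
  have h := lintegral_map (μ := iid ι m) hf (measurable_pi_apply i)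
  rw [← h]
  exact congrArg (fun P => ∫⁻ a, f a ∂P) (Measure.infinitePi_map_eval (fun _ : ι => m) i)

lemma lintegral_iid_update [DecidableEq ι] (i : ι) {f : (ι → α) → ℝ≥0∞} (hf : Measurable f) :
    ∫⁻ x, ∫⁻ a, f (Function.update x i a) ∂m ∂iid ι m = ∫⁻ x, f x ∂iid ι m := by
  classical
  rw [← lintegral_iid_piecewise m ({i}ᶜ : Set ι) hf]
  refine lintegral_congr fun x => ?_
  rw [← lintegral_iid_eval m i (f := fun a => f (Function.update x i a))
    (hf.comp (measurable_update x))]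
  refine lintegral_congr fun y => ?_
  congr 1
  ext j
  by_cases h : j = i
  · subst h; simp [Set.piecewise]
  · simp [Set.piecewise, h]

lemma measurable_cons : Measurable fun p : α × (ℕ → α) => cons p.1 p.2 := by
  refine measurable_pi_lambda _ fun n => ?_
  cases n with
  | zero => exact measurable_fst
  | succ n => exact (measurable_pi_apply n).comp measurable_snd

@[fun_prop]
lemma Measurable.cons {γ : Type*} [MeasurableSpace γ] {f : γ → α} {g : γ → ℕ → α}
    (hf : Measurable f) (hg : Measurable g) : Measurable fun x => cons (f x) (g x) :=
  measurable_cons.comp (hf.prodMk hg)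

lemma iid_cons : (m.prod (iid ℕ m)).map (fun p => cons p.1 p.2) = iid ℕ m := by
  refine iid_map_of_pi m measurable_cons fun s t ht => ?_
  have : {p : α × (ℕ → α) | ∀ i ∈ s, cons p.1 p.2 i ∈ t i} =
      (if 0 ∈ s then t 0 else Set.univ) ×ˢ
        {x | ∀ i ∈ (s.erase 0).image Nat.pred, x i ∈ t (i + 1)} := by
    ext ⟨a, x⟩
    simp only [Set.mem_ofPred_eq, Set.mem_prod]
    constructor
    · intro h
      refine ⟨?_, fun i hi => ?_⟩
      · split_ifs with h0
        · exact h 0 h0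
        · trivial
      · obtain ⟨j, hj, rfl⟩ := Finset.mem_image.1 hi
        obtain ⟨hj0, hj⟩ := Finset.mem_erase.1 hj
        obtain ⟨j, rfl⟩ := Nat.exists_eq_succ_of_ne_zero hj0
        exact h _ hj
    · rintro ⟨h0, h⟩ i hi
      cases i with
      | zero => simpa [hi] using h0
      | succ i =>
        exact h i (Finset.mem_image.2 ⟨i + 1, Finset.mem_erase.2 ⟨by simp, hi⟩, rfl⟩)
  rw [this, Measure.prod_prod, iid_box m _ (fun i => t (i + 1)) (fun i => ht _),
    Finset.prod_image]
  · have h2 : ∏ i ∈ s.erase 0, m (t (i.pred + 1)) = ∏ i ∈ s.erase 0, m (t i) := by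
      refine Finset.prod_congr rfl fun i hi => ?_
      rw [← Nat.succ_eq_add_one, Nat.succ_pred_eq_of_ne_zero (Finset.mem_erase.1 hi).1]
    rw [h2]
    split_ifs with h0
    · rw [Finset.mul_prod_erase s (fun i => m (t i)) h0]
    · rw [measure_univ, one_mul, Finset.erase_eq_of_notMem h0]
  · intro i hi j hj hij
    have hi := (Finset.mem_erase.1 hi).1
    have hj := (Finset.mem_erase.1 hj).1
    simp only [Nat.pred_eq_sub_one] at hij
    omega

lemma lintegral_iid_cons {f : (ℕ → α) → ℝ≥0∞} (hf : Measurable f) :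
    ∫⁻ x, f x ∂iid ℕ m = ∫⁻ a, ∫⁻ s, f (cons a s) ∂iid ℕ m ∂m := by
  conv_lhs => rw [← iid_cons m]
  rw [lintegral_map hf measurable_cons, lintegral_prod]
  exact (hf.comp measurable_cons).aemeasurable

/-- A transformation of an i.i.d. sequence which acts on each term by a measure preserving map
that is determined by the previous terms preserves the law of the sequence. -/
lemma iid_map_adapted {Ψ : (ℕ → α) → ℕ → α} (hΨ : Measurable Ψ) (ψ : ℕ → (ℕ → α) → α → α)
    (hψ : ∀ n, Measurable fun p : (ℕ → α) × α => ψ n p.1 p.2)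
    (hΨψ : ∀ s n, Ψ s n = ψ n s (s n))
    (hpast : ∀ n s s', (∀ i < n, s i = s' i) → ψ n s = ψ n s')
    (hpres : ∀ n s (t : Set α), MeasurableSet t → m {a | ψ n s a ∈ t} = m t) :
    (iid ℕ m).map Ψ = iid ℕ m := by
  classical
  have key : ∀ (t : ℕ → Set α), (∀ i, MeasurableSet (t i)) → ∀ n,
      iid ℕ m {s | ∀ i < n, Ψ s i ∈ t i} = ∏ i ∈ Finset.range n, m (t i) := by
    intro t ht n
    induction n with
    | zero => simp
    | succ n ih =>
      have hmeas : ∀ n, MeasurableSet {s | ∀ i < n, Ψ s i ∈ t i} := fun n => by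
        have : {s | ∀ i < n, Ψ s i ∈ t i} = ⋂ i, ⋂ _ : i < n, {s | Ψ s i ∈ t i} := by
          ext; simp
        rw [this]
        exact .iInter fun i => .iInter fun _ => (measurable_pi_apply i).comp hΨ (ht i)
      have hp : ∀ s a, ∀ i ≤ n, ψ i (Function.update s n a) = ψ i s := fun s a i hi =>
        hpast i _ _ fun j hj => Function.update_of_ne (by omega) _ _
      -- The `n`-th term is resampled. This changes none of the maps `ψ i` with `i ≤ n`, so the
      -- indicator factors into the event of the earlier terms and an event for the new term alone,
      -- whose probability is given by `hpres`.
      rw [Finset.prod_range_succ, ← ih, ← lintegral_indicator_one (hmeas _),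
        ← lintegral_iid_update m n (measurable_one.indicator (hmeas _)),
        ← lintegral_indicator_one (hmeas _), ← lintegral_mul_const _
          (measurable_one.indicator (hmeas _))]
      refine lintegral_congr fun s => ?_
      have : ∀ a, ({s | ∀ i < n + 1, Ψ s i ∈ t i}.indicator 1 (Function.update s n a) : ℝ≥0∞) =
          {s | ∀ i < n, Ψ s i ∈ t i}.indicator 1 s * {a | ψ n s a ∈ t n}.indicator 1 a := by
        intro a
        have h1 : (∀ i < n + 1, Ψ (Function.update s n a) i ∈ t i) ↔
            (∀ i < n, Ψ s i ∈ t i) ∧ ψ n s a ∈ t n := by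
          simp only [Nat.lt_succ_iff_lt_or_eq, or_imp, forall_and, forall_eq]
          refine and_congr (forall₂_congr fun i hi => ?_) ?_
          · rw [hΨψ, hΨψ, hp s a i hi.le, Function.update_of_ne hi.ne]
          · rw [hΨψ, hp s a n le_rfl, Function.update_self]
        simp only [Set.indicator_apply, Set.mem_ofPred_eq, h1]
        by_cases h2 : ∀ i < n, Ψ s i ∈ t i <;> by_cases h3 : ψ n s a ∈ t n <;> simp [h2, h3]
      simp_rw [this]
      have hm : MeasurableSet {a | ψ n s a ∈ t n} :=
        ((hψ n).comp (measurable_const.prodMk measurable_id)) (ht n)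
      rw [lintegral_const_mul _ (measurable_one.indicator hm), lintegral_indicator_one hm,
        hpres n s _ (ht n)]
  refine iid_map_of_pi m hΨ fun s t ht => ?_
  obtain ⟨n, hn⟩ := s.exists_nat_subset_range
  -- An arbitrary finite index set is enlarged to an initial segment, with trivial sides at the
  -- added indices.
  have h := key (fun i => if i ∈ s then t i else Set.univ)
    (fun i => by split_ifs; exacts [ht _, .univ]) n
  have h2 : ∀ x, (∀ i < n, Ψ x i ∈ (if i ∈ s then t i else Set.univ)) ↔
      ∀ i ∈ s, Ψ x i ∈ t i := fun x => by
    refine ⟨fun h i hi => by simpa [hi] using h i (Finset.mem_range.1 (hn hi)), fun h i _ => ?_⟩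
    split_ifs with his
    exacts [h i his, trivial]
  simp_rw [h2] at h
  rw [h, ← Finset.prod_subset hn]
  · exact Finset.prod_congr rfl fun i hi => by rw [if_pos hi]
  · intro i _ hi; rw [if_neg hi, measure_univ]

end IID

/-! ## Exponential distributions -/

section Exponential

variable {r : ℝ}

lemma lintegral_expMeasure_add (t : ℝ) {f : ℝ → ℝ≥0∞} (hf : Measurable f) :
    ∫⁻ g, f (t + g) ∂expMeasure r =
      ∫⁻ v in Set.Ioi t, ENNReal.ofReal (r * Real.exp (-(r * (v - t)))) * f v := by
  have h1 : expMeasure r = volume.withDensity (exponentialPDF r) := rfl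
  have hm : Measurable (exponentialPDF r) := (measurable_exponentialPDFReal r).ennreal_ofReal
  rw [h1, lintegral_withDensity_eq_lintegral_mul _ hm (by fun_prop)]
  simp only [Pi.mul_apply]
  rw [← lintegral_indicator measurableSet_Ioi,
    ← lintegral_add_left_eq_self (μ := volume) (f := fun v => (Set.Ioi t).indicator _ v) t]
  -- The density at `0` equals `r`, whereas the open half-line on the right omits this point.
  have h0 : ∀ᵐ g : ℝ ∂volume, g ≠ 0 := by
    simp [ae_iff, measure_singleton]
  refine lintegral_congr_ae (h0.mono fun g hg => ?_)
  simp only [Set.indicator, Set.mem_Ioi, lt_add_iff_pos_right, add_sub_cancel_left]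
  rcases lt_or_gt_of_ne hg with h | h
  · rw [exponentialPDF_of_neg h, if_neg (not_lt.2 h.le), zero_mul]
  · rw [exponentialPDF_of_nonneg h.le, if_pos h]

/-- On `(z, ∞)` the density factors as `exp (-r z)` times the density at `v - z`. -/
lemma lintegral_expMeasure_memoryless {z : ℝ} (hz : 0 ≤ z) {f : ℝ → ℝ≥0∞}
    (hf : Measurable f) :
    ∫⁻ g in Set.Ioi z, f (g - z) ∂expMeasure r =
      ENNReal.ofReal (Real.exp (-(r * z))) * ∫⁻ g, f g ∂expMeasure r := by
  have h1 := lintegral_expMeasure_add (r := r) 0 (f := (Set.Ioi z).indicator fun g => f (g - z))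
    ((hf.comp (measurable_id.sub_const z)).indicator measurableSet_Ioi)
  have h2 := lintegral_expMeasure_add (r := r) z (f := fun v => f (v - z)) (by fun_prop)
  simp only [zero_add, add_sub_cancel_left] at h1 h2
  rw [← lintegral_indicator measurableSet_Ioi, h1, h2, ← lintegral_const_mul _ (by fun_prop),
    ← lintegral_indicator measurableSet_Ioi, ← lintegral_indicator measurableSet_Ioi]
  refine lintegral_congr fun v => ?_
  by_cases hv : z < v
  · have h0 : 0 < v := hz.trans_lt hv
    simp only [Set.indicator, Set.mem_Ioi, hv, h0, if_true]
    rw [← mul_assoc, ← ENNReal.ofReal_mul (Real.exp_pos _).le, mul_left_comm, ← Real.exp_add]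
    congr 4; ring
  · simp [Set.indicator, hv]

lemma expMeasure_Ioi (hr : 0 < r) {z : ℝ} (hz : 0 ≤ z) :
    expMeasure r (Set.Ioi z) = ENNReal.ofReal (Real.exp (-(r * z))) := by
  have := isProbabilityMeasure_expMeasure hr
  have h := lintegral_expMeasure_memoryless (r := r) hz (f := fun _ => 1) measurable_const
  simpa using h

instance : NullSingletonClass (expMeasure r) :=
  inferInstanceAs (NullSingletonClass (volume.withDensity (exponentialPDF r)))

lemma expMeasure_pos (hr : 0 < r) : ∀ᵐ g ∂expMeasure r, 0 < g := by
  have := isProbabilityMeasure_expMeasure hr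
  have h := expMeasure_Ioi hr le_rfl
  simp only [mul_zero, neg_zero, Real.exp_zero, ENNReal.ofReal_one] at h
  exact (prob_compl_eq_zero_iff measurableSet_Ioi).2 h

/-- Memorylessness of independent exponential random variables: if those with index in `C` are
known to exceed `z`, then the excesses are again exponential. -/
lemma lintegral_iid_exp_memoryless (hr : 0 < r) {ι : Type*} [Fintype ι] [DecidableEq ι]
    (C : Finset ι) {z : ℝ}
    (hz : 0 ≤ z) {f : (ι → ℝ) → ℝ≥0∞} (hf : Measurable f) :
    ∫⁻ y, {y : ι → ℝ | ∀ j ∈ C, z < y j}.indicator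
        (fun y => f (fun j => if j ∈ C then y j - z else y j)) y ∂iid ι (expMeasure r) =
      ENNReal.ofReal (Real.exp (-(C.card * r * z))) * ∫⁻ y, f y ∂iid ι (expMeasure r) := by
  have := isProbabilityMeasure_expMeasure hr
  set c : ℝ≥0∞ := ENNReal.ofReal (Real.exp (-(r * z))) with hc
  have hc0 : c ≠ 0 := by simp [hc, Real.exp_pos]
  have hct : c ≠ ⊤ := ENNReal.ofReal_ne_top
  set sh : (ι → ℝ) → ι → ℝ := fun y j => if j ∈ C then y j - z else y j with hsh
  have hshm : Measurable sh := measurable_pi_lambda _ fun j => by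
    by_cases h : j ∈ C <;> simp only [hsh, h, if_true, if_false] <;> fun_prop
  set A : Set (ι → ℝ) := {y | ∀ j ∈ C, z < y j} with hA
  have hAm : MeasurableSet A := by
    have : A = ⋂ j ∈ C, {y | z < y j} := by ext; simp [hA]
    rw [this]
    exact Finset.measurableSet_biInter _ fun j _ => measurableSet_lt (by fun_prop) (by fun_prop)
  have hcC : ENNReal.ofReal (Real.exp (-(C.card * r * z))) = c ^ C.card := by
    rw [hc, ← ENNReal.ofReal_pow (Real.exp_pos _).le, ← Real.exp_nat_mul]
    congr 2; ring
  -- The law conditioned on `A`, whose probability is `c ^ C.card`, is pushed forward by the shift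
  -- and compared with the product law on boxes, where the claim reduces to one coordinate at a
  -- time.
  have hmeas : ((c ^ C.card)⁻¹ • (iid ι (expMeasure r)).restrict A).map sh =
      iid ι (expMeasure r) := by
    rw [iid, Measure.infinitePi_eq_pi]
    refine (Measure.pi_eq fun s hs => ?_).symm
    have hpre : sh ⁻¹' Set.univ.pi s ∩ A =
        Set.univ.pi fun j => if j ∈ C then (fun y => y - z) ⁻¹' s j ∩ Set.Ioi z else s j := by
      ext y
      simp only [Set.mem_inter_iff, Set.mem_preimage, Set.mem_pi, Set.mem_univ, true_imp_iff, hA,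
        Set.mem_ofPred_eq, hsh]
      constructor
      · rintro ⟨h1, h2⟩ j
        by_cases hj : j ∈ C
        · simpa [hj] using ⟨by simpa [hj] using h1 j, h2 j hj⟩
        · simpa [hj] using h1 j
      · intro h
        refine ⟨fun j => ?_, fun j hj => ?_⟩
        · by_cases hj : j ∈ C
          · simpa [hj] using (by simpa [hj] using h j : _ ∧ _).1
          · simpa [hj] using h j
        · exact (by simpa [hj] using h j : _ ∧ _).2
    rw [Measure.map_apply hshm (.univ_pi hs), Measure.smul_apply,
      Measure.restrict_apply (hshm (.univ_pi hs)), hpre, Measure.pi_pi, smul_eq_mul]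
    have hval : ∀ j, expMeasure r (if j ∈ C then (fun y => y - z) ⁻¹' s j ∩ Set.Ioi z else s j) =
        (if j ∈ C then c else 1) * expMeasure r (s j) := fun j => by
      split_ifs with hj
      · have h := lintegral_expMeasure_memoryless (r := r) hz (f := (s j).indicator 1)
          (measurable_one.indicator (hs j))
        rw [lintegral_indicator_one (hs j)] at h
        have hm : MeasurableSet ((fun y => y - z) ⁻¹' s j) := (measurable_id.sub_const z) (hs j)
        rw [← h, ← Measure.restrict_apply hm, ← lintegral_indicator_one hm]
        rfl
      · rw [one_mul]
    simp_rw [hval]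
    rw [Finset.prod_mul_distrib, Finset.prod_ite_mem, Finset.univ_inter, Finset.prod_const,
      ← mul_assoc, ENNReal.inv_mul_cancel (pow_ne_zero _ hc0) (ENNReal.pow_ne_top hct), one_mul]
  rw [hcC]
  conv_rhs => rw [← hmeas, lintegral_map hf hshm, lintegral_smul_measure, smul_eq_mul, ← mul_assoc,
    ENNReal.mul_inv_cancel (pow_ne_zero _ hc0) (ENNReal.pow_ne_top hct), one_mul,
    ← lintegral_indicator hAm]

end Exponential


/-! ## Races of exponential clocks -/

/-- The end of a period between two decision epochs: the time at which it ends, and the server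
which ends a transmission then, if any, together with the error indicator. -/
abbrev Outcome (M : ℕ) : Type := EReal × Option (Fin M × Bool)

instance instMeasurableSpaceEnding (M : ℕ) : MeasurableSpace (Option (Fin M × Bool)) := ⊤

instance instMeasurableSpaceServers (M : ℕ) : MeasurableSpace (Finset (Fin M)) := ⊤

instance instDiscreteEnding (M : ℕ) : DiscreteMeasurableSpace (Option (Fin M × Bool)) := ⟨fun _ => trivial⟩

instance instDiscreteServers (M : ℕ) : DiscreteMeasurableSpace (Finset (Fin M)) := ⟨fun _ => trivial⟩

section Race

variable {M : ℕ}

/-- Server `m` is the first of the servers in `B` to end its transmission, before the deadline. -/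
def Wins (t : ℝ) (dl : EReal) (B : Finset (Fin M)) (z : Fin M → ℝ) (m : Fin M) : Prop :=
  m ∈ B ∧ ((t + z m : ℝ) : EReal) < dl ∧ ∀ j ∈ B, j ≠ m → z m < z j

lemma Wins.unique {t : ℝ} {dl : EReal} {B : Finset (Fin M)} {z : Fin M → ℝ} {m m' : Fin M}
    (h : Wins t dl B z m) (h' : Wins t dl B z m') : m = m' := by
  by_contra hne
  exact lt_asymm (h.2.2 m' h'.1 (Ne.symm hne)) (h'.2.2 m h.1 hne)

open Classical in
/-- The outcome of a period which starts at time `t` and ends when a server in `B` ends its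
transmission, where server `m` needs the time `z m`, at time `dl` at the latest. -/
noncomputable def raceEnd (t : ℝ) (dl : EReal) (B : Finset (Fin M)) (z : Fin M → ℝ)
    (e : Fin M → Bool) : Outcome M :=
  if h : ∃ m, Wins t dl B z m then
    (((t + z h.choose : ℝ) : EReal), some (h.choose, e h.choose))
  else (dl, none)

lemma raceEnd_of_wins {t : ℝ} {dl : EReal} {B : Finset (Fin M)} {z : Fin M → ℝ} {e : Fin M → Bool}
    {m : Fin M} (h : Wins t dl B z m) :
    raceEnd t dl B z e = (((t + z m : ℝ) : EReal), some (m, e m)) := by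
  have h' : ∃ m, Wins t dl B z m := ⟨m, h⟩
  rw [raceEnd, dif_pos h', h'.choose_spec.unique h]

lemma raceEnd_of_not_wins {t : ℝ} {dl : EReal} {B : Finset (Fin M)} {z : Fin M → ℝ}
    {e : Fin M → Bool} (h : ∀ m, ¬ Wins t dl B z m) : raceEnd t dl B z e = (dl, none) :=
  dif_neg (by simpa using h)

lemma measurable_raceEnd : Measurable fun p : ((ℝ × EReal) × Finset (Fin M)) ×
    ((Fin M → ℝ) × (Fin M → Bool)) => raceEnd p.1.1.1 p.1.1.2 p.1.2 p.2.1 p.2.2 := by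
  have hw : ∀ m, MeasurableSet {p : ((ℝ × EReal) × Finset (Fin M)) ×
      ((Fin M → ℝ) × (Fin M → Bool)) | Wins p.1.1.1 p.1.1.2 p.1.2 p.2.1 m} := fun m => by
    have hB : ∀ j : Fin M, MeasurableSet {p : ((ℝ × EReal) × Finset (Fin M)) ×
        ((Fin M → ℝ) × (Fin M → Bool)) | j ∈ p.1.2} := fun j =>
      (measurable_snd.comp measurable_fst)
        (MeasurableSet.of_discrete (s := {B : Finset (Fin M) | j ∈ B}))
    have hlt : MeasurableSet {p : ((ℝ × EReal) × Finset (Fin M)) ×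
        ((Fin M → ℝ) × (Fin M → Bool)) | ((p.1.1.1 + p.2.1 m : ℝ) : EReal) < p.1.1.2} :=
      measurableSet_lt (by fun_prop) (by fun_prop)
    refine (hB m).inter (hlt.inter ?_)
    refine MeasurableSet.congr (s := ⋂ j, {p | j ∈ p.1.2}ᶜ ∪ ({_p | j = m} ∪ {p | p.2.1 m < p.2.1 j}))
      (.iInter fun j => (hB j).compl.union ((MeasurableSet.const _).union
        (measurableSet_lt (by fun_prop) (by fun_prop)))) ?_
    ext p
    simp only [Set.mem_iInter, Set.mem_union, Set.mem_compl_iff, Set.mem_ofPred_eq]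
    exact forall_congr' fun j => by tauto
  intro S hS
  have : (fun p : ((ℝ × EReal) × Finset (Fin M)) × ((Fin M → ℝ) × (Fin M → Bool)) =>
      raceEnd p.1.1.1 p.1.1.2 p.1.2 p.2.1 p.2.2) ⁻¹' S =
      (⋃ m, {p | Wins p.1.1.1 p.1.1.2 p.1.2 p.2.1 m} ∩
        {p | ((((p.1.1.1 + p.2.1 m : ℝ) : EReal), some (m, p.2.2 m)) : Outcome M) ∈ S}) ∪
      ((⋂ m, {p | Wins p.1.1.1 p.1.1.2 p.1.2 p.2.1 m}ᶜ) ∩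
        {p | ((p.1.1.2, none) : Outcome M) ∈ S}) := by
    ext p
    simp only [Set.mem_preimage, Set.mem_union, Set.mem_iUnion, Set.mem_inter_iff, Set.mem_iInter,
      Set.mem_compl_iff, Set.mem_ofPred_eq]
    by_cases h : ∃ m, Wins p.1.1.1 p.1.1.2 p.1.2 p.2.1 m
    · obtain ⟨m, hm⟩ := h
      rw [raceEnd_of_wins hm]
      refine ⟨fun hs => .inl ⟨m, hm, hs⟩, ?_⟩
      rintro (⟨m', hm', hs⟩ | ⟨hn, _⟩)
      · rwa [hm.unique hm']
      · exact absurd hm (hn m)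
    · push Not at h
      rw [raceEnd_of_not_wins h]
      exact ⟨fun hs => .inr ⟨h, hs⟩, by rintro (⟨m', hm', _⟩ | ⟨_, hs⟩); exacts [absurd hm' (h m'), hs]⟩
  rw [this]
  refine (MeasurableSet.iUnion fun m => (hw m).inter ?_).union
    ((MeasurableSet.iInter fun m => (hw m).compl).inter ?_)
  · refine Measurable.prodMk (by fun_prop) ?_ hS
    exact (Measurable.of_discrete (f := fun b : Bool => some (m, b))).comp
      ((measurable_pi_apply m).comp (measurable_snd.comp measurable_snd))
  · exact Measurable.prodMk (by fun_prop) measurable_const hS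

open Classical in
/-- What remains of the clocks when the period ends: the clocks of the servers in `B` which have
not ended their transmissions run on, the other clocks are replaced by `x`. -/
noncomputable def raceRest (t : ℝ) (B : Finset (Fin M)) (z x : Fin M → ℝ) (o : Outcome M)
    (j : Fin M) : ℝ :=
  if j ∈ B ∧ ∀ b, o.2 ≠ some (j, b) then z j - (o.1.toReal - t) else x j

/-- The probability that no clock in `B` rings between `t` and `dl`. -/
noncomputable def raceSurvival (μ t : ℝ) (dl : EReal) (B : Finset (Fin M)) : ℝ≥0∞ :=
  -- `EReal.toReal` sends `⊤` to `0`, so the infinite deadline needs its own case: an empty race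
  -- never ends, any other race ends almost surely.
  if dl = ⊤ then (if B = ∅ then 1 else 0)
  else ENNReal.ofReal (Real.exp (-(B.card * μ * (dl.toReal - t))))

/-- The expectation of a function of the outcome of a race with deterministic errors. -/
noncomputable def raceExpect (μ t : ℝ) (dl : EReal) (B : Finset (Fin M)) (e : Fin M → Bool)
    (f : Outcome M → ℝ≥0∞) : ℝ≥0∞ :=
  (∑ m ∈ B, ∫⁻ w in Set.Ioi t, ENNReal.ofReal (μ * Real.exp (-(B.card * μ * (w - t)))) *
    ({w : ℝ | (w : EReal) < dl}.indicator (fun w => f ((w : EReal), some (m, e m))) w)) +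
  raceSurvival μ t dl B * f (dl, none)

variable {μ : ℝ}

/-- If coordinate `i` is resampled, it has to hit the single value `z j`, which an exponential law
charges with probability zero. -/
lemma iid_exp_ne [NullSingletonClass (expMeasure μ)] (hμ : 0 < μ) {i j : Fin M} (hij : i ≠ j) :
    ∀ᵐ z ∂iid (Fin M) (expMeasure μ), z i ≠ z j := by
  have := isProbabilityMeasure_expMeasure hμ
  have hm : MeasurableSet {z : Fin M → ℝ | z i = z j} :=
    measurableSet_eq_fun (by fun_prop) (by fun_prop)
  have h := lintegral_iid_update (expMeasure μ) i (measurable_one.indicator hm)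
  rw [lintegral_indicator_one hm] at h
  rw [ae_iff]
  simp only [ne_eq, not_not]
  rw [← h]
  refine (lintegral_congr fun z => ?_).trans lintegral_zero
  have : ∀ a, ({z : Fin M → ℝ | z i = z j}.indicator 1 (Function.update z i a) : ℝ≥0∞) =
      ({z j} : Set ℝ).indicator 1 a := fun a => by
    simp [Set.indicator_apply, Function.update_of_ne hij.symm]
  simp_rw [this]
  rw [lintegral_indicator_one (measurableSet_singleton _), measure_singleton]

lemma iid_exp_ae (hμ : 0 < μ) {p : ℝ → Prop} (hp : ∀ᵐ a ∂expMeasure μ, p a) (j : Fin M) :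
    ∀ᵐ z ∂iid (Fin M) (expMeasure μ), p (z j) := by
  have := isProbabilityMeasure_expMeasure hμ
  exact (measurePreserving_eval_infinitePi (fun _ : Fin M => expMeasure μ) j).quasiMeasurePreserving.ae hp

open Classical in
-- The clock `z m` is independent of the clocks in `C` because `m ∉ C`, and the clocks outside `C`
-- have been replaced by fresh ones. This separates the winner of a race from its competitors.
lemma lintegral_iid_eval_piecewise (hμ : 0 < μ) {C : Finset (Fin M)} {m : Fin M} (hm : m ∉ C)
    {H : ℝ → (Fin M → ℝ) → ℝ≥0∞} (hH : Measurable fun p : ℝ × (Fin M → ℝ) => H p.1 p.2) :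
    ∫⁻ z, ∫⁻ x, H (z m) ((C : Set (Fin M)).piecewise z x) ∂iid (Fin M) (expMeasure μ)
        ∂iid (Fin M) (expMeasure μ) =
      ∫⁻ w, ∫⁻ y, H w y ∂iid (Fin M) (expMeasure μ) ∂expMeasure μ := by
  have := isProbabilityMeasure_expMeasure hμ
  have hpw : Measurable fun p : (Fin M → ℝ) × (Fin M → ℝ) =>
    H (p.1 m) ((C : Set (Fin M)).piecewise p.1 p.2) :=
    hH.comp (((measurable_pi_apply m).comp measurable_fst).prodMk (measurable_piecewise_prod _))
  rw [← lintegral_iid_update (expMeasure μ) m hpw.lintegral_prod_right]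
  have hup : ∀ (z x : Fin M → ℝ) (w : ℝ), (C : Set (Fin M)).piecewise (Function.update z m w) x =
      (C : Set (Fin M)).piecewise z x := fun z x w => by
    ext j
    by_cases hj : j ∈ C
    · have : j ≠ m := fun h => hm (h ▸ hj)
      simp [Set.piecewise, hj, this]
    · simp [Set.piecewise, hj]
  simp_rw [hup, Function.update_self]
  have hpw2 : Measurable fun p : ((Fin M → ℝ) × ℝ) × (Fin M → ℝ) =>
      H p.1.2 ((C : Set (Fin M)).piecewise p.1.1 p.2) :=
    hH.comp ((measurable_snd.comp measurable_fst).prodMk ((measurable_piecewise_prod _).comp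
      ((measurable_fst.comp measurable_fst).prodMk measurable_snd)))
  rw [lintegral_lintegral_swap hpw2.lintegral_prod_right.aemeasurable]
  refine lintegral_congr fun w => ?_
  exact lintegral_iid_piecewise (expMeasure μ) (C : Set (Fin M)) (f := H w)
    (hH.comp (measurable_const.prodMk measurable_id))

open Classical in
-- Condition on the time at which `m` rings. Each of the other `B.card - 1` clocks has to exceed it,
-- which costs one exponential factor each and leaves exponential excesses by memorylessness;
-- together with the density of the clock of `m` the rate becomes `B.card * μ`.
lemma lintegral_race_wins (hμ : 0 < μ) (t : ℝ) (dl : EReal) {B : Finset (Fin M)} (e : Fin M → Bool)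
    {m : Fin M} (hm : m ∈ B) {F : Outcome M → (Fin M → ℝ) → ℝ≥0∞}
    (hF : Measurable fun p : Outcome M × (Fin M → ℝ) => F p.1 p.2) :
    ∫⁻ z, ∫⁻ x, {z | Wins t dl B z m}.indicator
        (fun z => F (raceEnd t dl B z e) (raceRest t B z x (raceEnd t dl B z e))) z
        ∂iid (Fin M) (expMeasure μ) ∂iid (Fin M) (expMeasure μ) =
      ∫⁻ w in Set.Ioi t, ENNReal.ofReal (μ * Real.exp (-(B.card * μ * (w - t)))) *
        ({w : ℝ | (w : EReal) < dl}.indicator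
          (fun w => ∫⁻ y, F ((w : EReal), some (m, e m)) y ∂iid (Fin M) (expMeasure μ)) w) := by
  have := isProbabilityMeasure_expMeasure hμ
  set C := B.erase m with hC
  have hshift : Measurable fun p : ℝ × (Fin M → ℝ) => fun j => if j ∈ C then p.2 j - p.1 else p.2 j := by
    refine measurable_pi_lambda _ fun j => ?_
    by_cases h : j ∈ C <;> simp only [h, if_true, if_false] <;> fun_prop
  set H : ℝ → (Fin M → ℝ) → ℝ≥0∞ := fun w y =>
    {w : ℝ | ((t + w : ℝ) : EReal) < dl}.indicator (fun w =>
      {y : Fin M → ℝ | ∀ j ∈ C, w < y j}.indicator (fun y => F (((t + w : ℝ) : EReal), some (m, e m))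
        (fun j => if j ∈ C then y j - w else y j)) y) w with hH
  have hHm : Measurable fun p : ℝ × (Fin M → ℝ) => H p.1 p.2 := by
    simp only [hH, Set.indicator_apply, Set.mem_ofPred_eq]
    refine Measurable.ite (measurableSet_lt (by fun_prop) (by fun_prop)) (Measurable.ite ?_ ?_ measurable_const) measurable_const
    · have : {p : ℝ × (Fin M → ℝ) | ∀ j ∈ C, p.1 < p.2 j} = ⋂ j ∈ C, {p | p.1 < p.2 j} := by ext; simp
      rw [this]
      exact Finset.measurableSet_biInter _ fun j _ => measurableSet_lt (by fun_prop) (by fun_prop)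
    · exact hF.comp ((Measurable.prodMk (by fun_prop) measurable_const).prodMk hshift)
  -- The winning event and the residual clocks read `z` only at `m` and on `C`. The clock of `m` has
  -- rung, so its residual comes from `x`.
  have h1 : ∀ z x, {z | Wins t dl B z m}.indicator
        (fun z => F (raceEnd t dl B z e) (raceRest t B z x (raceEnd t dl B z e))) z =
      H (z m) ((C : Set (Fin M)).piecewise z x) := fun z x => by
    have hw : Wins t dl B z m ↔ ((t + z m : ℝ) : EReal) < dl ∧
        ∀ j ∈ C, z m < (C : Set (Fin M)).piecewise z x j := by
      simp only [Wins, hm, true_and, hC, Finset.mem_erase]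
      refine and_congr Iff.rfl ⟨fun h j hj => ?_, fun h j hj hne => ?_⟩
      · simpa [Set.piecewise, hj.1, hj.2] using h j hj.2 hj.1
      · simpa [Set.piecewise, hj, hne] using h j ⟨hne, hj⟩
    simp only [hH, Set.indicator_apply, Set.mem_ofPred_eq, ← ite_and]
    by_cases hw' : Wins t dl B z m
    · rw [if_pos hw', if_pos (hw.1 hw'), raceEnd_of_wins hw']
      congr 1
      ext j
      have : (j ∈ B ∧ ∀ b, ¬ (m = j ∧ e m = b)) ↔ j ∈ C := by
        simp only [hC, Finset.mem_erase]
        constructor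
        · rintro ⟨h1, h2⟩; exact ⟨fun h => h2 (e m) ⟨h.symm, rfl⟩, h1⟩
        · rintro ⟨h1, h2⟩; exact ⟨h2, fun b hb => h1 hb.1.symm⟩
      by_cases hj : j ∈ C
      · rw [raceRest, if_pos (by simpa only [ne_eq, Option.some.injEq, Prod.mk.injEq] using this.2 hj)]
        simp [hj, Set.piecewise, -EReal.coe_add]
      · rw [raceRest, if_neg (by simpa only [ne_eq, Option.some.injEq, Prod.mk.injEq] using fun h => hj (this.1 h))]
        simp [hj, Set.piecewise]
    · rw [if_neg hw', if_neg (fun h => hw' (hw.2 h))]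
  simp_rw [h1]
  rw [lintegral_iid_eval_piecewise hμ (by simp [hC]) hHm]
  have h2 : ∀ᵐ w ∂expMeasure μ, ∫⁻ y, H w y ∂iid (Fin M) (expMeasure μ) =
      {w : ℝ | (w : EReal) < dl}.indicator
        (fun v => ENNReal.ofReal (Real.exp (-(C.card * μ * (v - t)))) *
          ∫⁻ y, F ((v : EReal), some (m, e m)) y ∂iid (Fin M) (expMeasure μ)) (t + w) := by
    filter_upwards [expMeasure_pos hμ] with w hw
    by_cases hd : ((t + w : ℝ) : EReal) < dl
    · rw [Set.indicator_of_mem (show _ ∈ {w : ℝ | (w : EReal) < dl} from hd), add_sub_cancel_left]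
      have hHw : H w = fun y => {y : Fin M → ℝ | ∀ j ∈ C, w < y j}.indicator
          (fun y => F (((t + w : ℝ) : EReal), some (m, e m))
            (fun j => if j ∈ C then y j - w else y j)) y :=
        funext fun y => Set.indicator_of_mem (show w ∈ {w : ℝ | ((t + w : ℝ) : EReal) < dl} from hd) _
      rw [hHw]
      exact lintegral_iid_exp_memoryless hμ C hw.le (f := F (((t + w : ℝ) : EReal), some (m, e m)))
        (hF.comp (measurable_const.prodMk measurable_id))
    · simp [hH, Set.indicator_apply, hd, -EReal.coe_add]
  rw [lintegral_congr_ae h2, lintegral_expMeasure_add]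
  · refine lintegral_congr fun v => ?_
    by_cases hd : (v : EReal) < dl
    · simp only [Set.indicator_apply, Set.mem_ofPred_eq, hd, if_true]
      rw [← mul_assoc, ← ENNReal.ofReal_mul (by positivity), mul_assoc, ← Real.exp_add]
      congr 4
      have : (B.card : ℝ) = C.card + 1 := by
        rw [hC, Finset.card_erase_of_mem hm]
        have := Finset.card_pos.2 ⟨m, hm⟩
        push_cast [Nat.cast_sub this]; ring
      rw [this]; ring
    · simp [hd]
  · refine Measurable.indicator ?_ (measurableSet_lt (by fun_prop) (by fun_prop))
    refine Measurable.mul (by fun_prop) (Measurable.lintegral_prod_right'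
      (f := fun p : ℝ × (Fin M → ℝ) => F ((p.1 : EReal), some (m, e m)) p.2) ?_)
    exact hF.comp ((Measurable.prodMk (by fun_prop) measurable_const).prodMk measurable_snd)

open Classical in
-- Memorylessness for all clocks in `B` at once, at the fixed time `dl - t`.
lemma lintegral_race_none (hμ : 0 < μ) {t : ℝ} {dl : EReal} (hdl : (t : EReal) ≤ dl)
    (B : Finset (Fin M)) {F : Outcome M → (Fin M → ℝ) → ℝ≥0∞}
    (hF : Measurable fun p : Outcome M × (Fin M → ℝ) => F p.1 p.2) :
    ∫⁻ z, ∫⁻ x, {z : Fin M → ℝ | ∀ j ∈ B, dl < ((t + z j : ℝ) : EReal)}.indicator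
        (fun z => F (dl, none) (raceRest t B z x (dl, none))) z
        ∂iid (Fin M) (expMeasure μ) ∂iid (Fin M) (expMeasure μ) =
      raceSurvival μ t dl B * ∫⁻ y, F (dl, none) y ∂iid (Fin M) (expMeasure μ) := by
  have := isProbabilityMeasure_expMeasure hμ
  have hFm : Measurable (F (dl, none)) := hF.comp (measurable_const.prodMk measurable_id)
  by_cases htop : dl = ⊤
  · subst htop
    by_cases hB : B = ∅
    · subst hB
      have : ∀ z x : Fin M → ℝ, raceRest t ∅ z x (⊤, none) = x := fun z x => by
        ext j; simp [raceRest]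
      simp [raceSurvival, this]
    · obtain ⟨j, hj⟩ := Finset.nonempty_iff_ne_empty.2 hB
      have : {z : Fin M → ℝ | ∀ j ∈ B, (⊤ : EReal) < ((t + z j : ℝ) : EReal)} = ∅ :=
        Set.eq_empty_of_forall_notMem fun z h => not_top_lt (h j hj)
      simp only [this, Set.indicator_empty, lintegral_zero, raceSurvival, if_true, hB, if_false,
        zero_mul]
  · lift dl to ℝ using ⟨htop, fun h => by simp [h] at hdl⟩
    simp only [EReal.coe_lt_coe_iff, EReal.coe_le_coe_iff] at hdl ⊢
    set f : (Fin M → ℝ) → ℝ≥0∞ := fun y => {y : Fin M → ℝ | ∀ j ∈ B, dl - t < y j}.indicator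
      (fun y => F ((dl : EReal), none) (fun j => if j ∈ B then y j - (dl - t) else y j)) y with hf
    have h1 : ∀ z x : Fin M → ℝ, {z : Fin M → ℝ | ∀ j ∈ B, dl < t + z j}.indicator
        (fun z => F ((dl : EReal), none) (raceRest t B z x ((dl : EReal), none))) z =
        f ((B : Set (Fin M)).piecewise z x) := fun z x => by
      have hc : (∀ j ∈ B, dl < t + z j) ↔
          ∀ j ∈ B, dl - t < (B : Set (Fin M)).piecewise z x j := by
        refine forall₂_congr fun j hj => ?_
        simp [Set.piecewise, hj, sub_lt_iff_lt_add']
      simp only [hf, Set.indicator_apply, Set.mem_ofPred_eq, ← hc]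
      refine if_congr Iff.rfl ?_ rfl
      congr 1; ext j
      by_cases hj : j ∈ B <;> simp [raceRest, Set.piecewise, hj]
    simp_rw [h1]
    rw [lintegral_iid_piecewise (expMeasure μ) (B : Set (Fin M))]
    · rw [hf]
      exact (lintegral_iid_exp_memoryless hμ B (sub_nonneg.2 hdl) hFm).trans (by simp [raceSurvival])
    · refine (hFm.comp ?_).indicator ?_
      · refine measurable_pi_lambda _ fun j => ?_
        by_cases h : j ∈ B <;> simp only [h, if_true, if_false] <;> fun_prop
      · have : {y : Fin M → ℝ | ∀ j ∈ B, dl - t < y j} = ⋂ j ∈ B, {y | dl - t < y j} := by ext; simp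
        rw [this]
        exact Finset.measurableSet_biInter _ fun j _ => measurableSet_lt (by fun_prop) (by fun_prop)

lemma measurable_raceRest (t : ℝ) (B : Finset (Fin M)) :
    Measurable fun p : ((Fin M → ℝ) × (Fin M → ℝ)) × Outcome M => raceRest t B p.1.1 p.1.2 p.2 := by
  classical
  refine measurable_pi_lambda _ fun j => ?_
  have : MeasurableSet {p : ((Fin M → ℝ) × (Fin M → ℝ)) × Outcome M |
      j ∈ B ∧ ∀ b, p.2.2 ≠ some (j, b)} :=
    (measurable_snd.comp measurable_snd)
      (MeasurableSet.of_discrete (s := {o : Option (Fin M × Bool) | j ∈ B ∧ ∀ b, o ≠ some (j, b)}))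
  exact Measurable.ite this (by fun_prop) (by fun_prop)

/-- Almost surely no two clocks agree and none rings exactly at the deadline, so either exactly one
server wins or all clocks in `B` exceed the deadline. In each case the residual clocks are
integrated out separately from the outcome; the right side therefore shows both the law of the
outcome and the independence. -/
lemma lintegral_race (hμ : 0 < μ) {t : ℝ} {dl : EReal} (hdl : (t : EReal) ≤ dl)
    (B : Finset (Fin M)) (e : Fin M → Bool) {F : Outcome M → (Fin M → ℝ) → ℝ≥0∞}
    (hF : Measurable fun p : Outcome M × (Fin M → ℝ) => F p.1 p.2) :
    ∫⁻ z, ∫⁻ x, F (raceEnd t dl B z e) (raceRest t B z x (raceEnd t dl B z e))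
        ∂iid (Fin M) (expMeasure μ) ∂iid (Fin M) (expMeasure μ) =
      raceExpect μ t dl B e fun o => ∫⁻ y, F o y ∂iid (Fin M) (expMeasure μ) := by
  classical
  have := isProbabilityMeasure_expMeasure hμ
  have hties : ∀ᵐ z ∂iid (Fin M) (expMeasure μ),
      (∀ i j, i ≠ j → z i ≠ z j) ∧ ∀ j, ((t + z j : ℝ) : EReal) ≠ dl := by
    simp only [ae_all_iff, eventually_and]
    refine ⟨fun i j hij => iid_exp_ne hμ hij, fun j => iid_exp_ae hμ (p := fun a => ((t + a : ℝ) : EReal) ≠ dl) ?_ j⟩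
    refine measure_mono_null (t := {dl.toReal - t}) (fun a ha => ?_) (measure_singleton _)
    simp only [Set.mem_compl_iff, Set.mem_ofPred_eq, ne_eq, not_not] at ha
    simp [← ha, -EReal.coe_add]
  have hrace : Measurable fun z : Fin M → ℝ => raceEnd t dl B z e :=
    measurable_raceEnd.comp (f := fun z : Fin M → ℝ => (((t, dl), B), (z, e))) (by fun_prop)
  have hmeas : Measurable fun p : (Fin M → ℝ) × (Fin M → ℝ) =>
      F (raceEnd t dl B p.1 e) (raceRest t B p.1 p.2 (raceEnd t dl B p.1 e)) :=
    hF.comp ((hrace.comp measurable_fst).prodMk ((measurable_raceRest t B).comp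
      (measurable_id.prodMk (hrace.comp measurable_fst))))
  have hWm : ∀ m, MeasurableSet {z : Fin M → ℝ | Wins t dl B z m} := fun m => by
    have hlt : MeasurableSet {z : Fin M → ℝ | ((t + z m : ℝ) : EReal) < dl} :=
      measurableSet_lt (by fun_prop) (by fun_prop)
    refine (MeasurableSet.const _).inter (hlt.inter ?_)
    have : {z : Fin M → ℝ | ∀ j ∈ B, j ≠ m → z m < z j} = ⋂ j ∈ B.erase m, {z | z m < z j} := by
      ext z; simp only [Set.mem_ofPred_eq, Set.mem_iInter, Finset.mem_erase]; tauto
    have h2 : MeasurableSet {z : Fin M → ℝ | ∀ j ∈ B, j ≠ m → z m < z j} :=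
      this ▸ Finset.measurableSet_biInter _ fun j _ => measurableSet_lt (by fun_prop) (by fun_prop)
    exact h2
  have hNm : MeasurableSet {z : Fin M → ℝ | ∀ j ∈ B, dl < ((t + z j : ℝ) : EReal)} := by
    have : {z : Fin M → ℝ | ∀ j ∈ B, dl < ((t + z j : ℝ) : EReal)} =
        ⋂ j ∈ B, {z | dl < ((t + z j : ℝ) : EReal)} := by ext; simp
    exact this ▸ Finset.measurableSet_biInter _ fun j _ => measurableSet_lt (by fun_prop) (by fun_prop)
  have hm1 : ∀ m, Measurable fun p : (Fin M → ℝ) × (Fin M → ℝ) => {z | Wins t dl B z m}.indicator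
      (fun z => F (raceEnd t dl B z e) (raceRest t B z p.2 (raceEnd t dl B z e))) p.1 := fun m =>
    hmeas.indicator (measurable_fst (hWm m))
  have hsplit : ∀ᵐ z ∂iid (Fin M) (expMeasure μ), ∫⁻ x, F (raceEnd t dl B z e)
      (raceRest t B z x (raceEnd t dl B z e)) ∂iid (Fin M) (expMeasure μ) =
      ∑ m ∈ B, ∫⁻ x, {z | Wins t dl B z m}.indicator
        (fun z => F (raceEnd t dl B z e) (raceRest t B z x (raceEnd t dl B z e))) z
          ∂iid (Fin M) (expMeasure μ) +
      ∫⁻ x, {z : Fin M → ℝ | ∀ j ∈ B, dl < ((t + z j : ℝ) : EReal)}.indicator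
        (fun z => F (dl, none) (raceRest t B z x (dl, none))) z ∂iid (Fin M) (expMeasure μ) := by
    filter_upwards [hties] with z hz
    by_cases hw : ∃ m, Wins t dl B z m
    · obtain ⟨m, hm⟩ := hw
      have hn : ¬ ∀ j ∈ B, dl < ((t + z j : ℝ) : EReal) := fun h => lt_asymm hm.2.1 (h m hm.1)
      rw [Finset.sum_eq_single_of_mem m hm.1]
      · simp only [Set.indicator_apply, Set.mem_ofPred_eq, hm, hn, if_true, if_false,
          lintegral_zero, add_zero]
      · intro m' _ hne
        have : ¬ Wins t dl B z m' := fun h => hne (h.unique hm)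
        simp only [Set.indicator_apply, Set.mem_ofPred_eq, this, if_false, lintegral_zero]
    · push Not at hw
      have hn : ∀ j ∈ B, dl < ((t + z j : ℝ) : EReal) := by
        intro j hj
        obtain ⟨m, hm, hmin⟩ := B.exists_min_image z ⟨j, hj⟩
        have hdm : dl < ((t + z m : ℝ) : EReal) := by
          by_contra hlt
          refine hw m ⟨hm, lt_of_le_of_ne (not_lt.1 hlt) (hz.2 m), fun i hi hne => ?_⟩
          exact lt_of_le_of_ne (hmin i hi) (hz.1 m i hne.symm)
        exact hdm.trans_le (EReal.coe_le_coe_iff.2 (by linarith [hmin j hj]))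
      have hn' : z ∈ {z : Fin M → ℝ | ∀ j ∈ B, dl < ((t + z j : ℝ) : EReal)} := hn
      simp only [Set.indicator_of_mem hn']
      simp only [Set.indicator_apply, Set.mem_ofPred_eq, hw, if_false, lintegral_zero,
        Finset.sum_const_zero, zero_add, raceEnd_of_not_wins hw]
  have hm2 : Measurable fun p : (Fin M → ℝ) × (Fin M → ℝ) =>
      {z : Fin M → ℝ | ∀ j ∈ B, dl < ((t + z j : ℝ) : EReal)}.indicator
        (fun z => F (dl, none) (raceRest t B z p.2 (dl, none))) p.1 :=
    (hF.comp (measurable_const.prodMk ((measurable_raceRest t B).comp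
      (measurable_id.prodMk measurable_const)))).indicator (measurable_fst hNm)
  rw [lintegral_congr_ae hsplit, lintegral_add_left, lintegral_finsetSum, lintegral_race_none hμ hdl B hF,
    Finset.sum_congr rfl fun m hm => lintegral_race_wins hμ t dl e hm hF]
  · simp only [raceExpect]
  · exact fun m _ => (hm1 m).lintegral_prod_right'
  · exact Finset.measurable_sum _ fun m _ => (hm1 m).lintegral_prod_right'

lemma lintegral_raceEnd (hμ : 0 < μ) {t : ℝ} {dl : EReal} (hdl : (t : EReal) ≤ dl)
    (B : Finset (Fin M)) (e : Fin M → Bool) {f : Outcome M → ℝ≥0∞} (hf : Measurable f) :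
    ∫⁻ z, f (raceEnd t dl B z e) ∂iid (Fin M) (expMeasure μ) = raceExpect μ t dl B e f := by
  have := isProbabilityMeasure_expMeasure hμ
  simpa using lintegral_race hμ hdl B e (F := fun o _ => f o) (hf.comp measurable_fst)

/-- When the race ends, what remains of the clocks is independent of the outcome. -/
lemma lintegral_race_rest (hμ : 0 < μ) {t : ℝ} {dl : EReal} (hdl : (t : EReal) ≤ dl)
    (B : Finset (Fin M)) (e : Fin M → Bool) {F : Outcome M → (Fin M → ℝ) → ℝ≥0∞}
    (hF : Measurable fun p : Outcome M × (Fin M → ℝ) => F p.1 p.2) :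
    ∫⁻ z, ∫⁻ x, F (raceEnd t dl B z e) (raceRest t B z x (raceEnd t dl B z e))
        ∂iid (Fin M) (expMeasure μ) ∂iid (Fin M) (expMeasure μ) =
      ∫⁻ z, ∫⁻ y, F (raceEnd t dl B z e) y ∂iid (Fin M) (expMeasure μ)
        ∂iid (Fin M) (expMeasure μ) := by
  have := isProbabilityMeasure_expMeasure hμ
  rw [lintegral_race hμ hdl B e hF, ← lintegral_raceEnd hμ hdl B e]
  exact hF.lintegral_prod_right'

end Race


/-! ## Streams of ticks -/

/-- A tick of a Poisson clock: the time since the previous tick, the server that it belongs to, and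
the error indicator of the transmission which it ends. -/
abbrev Tick (M : ℕ) : Type := ℝ × (Fin M × Bool)

/-- A sequence of ticks. -/
abbrev Stream (M : ℕ) : Type := ℕ → Tick M

/-- The uniform distribution on the servers. -/
noncomputable def serverLaw (M : ℕ) : Measure (Fin M) := (M : ℝ≥0∞)⁻¹ • Measure.count

/-- The law of a tick: the clocks of the `M` servers have rate `μ`. -/
noncomputable def tickLaw (M : ℕ) (μ : ℝ) (β : Measure Bool) : Measure (Tick M) :=
  (expMeasure (M * μ)).prod ((serverLaw M).prod β)

/-- The law of the ticks. -/
noncomputable abbrev streamLaw (M : ℕ) (μ : ℝ) (β : Measure Bool) : Measure (Stream M) :=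
  iid ℕ (tickLaw M μ β)

instance instServerLaw {M : ℕ} [NeZero M] : IsProbabilityMeasure (serverLaw M) := by
  constructor
  rw [serverLaw, Measure.smul_apply, Measure.count_univ, ENat.card_eq_coe_fintype_card,
    Fintype.card_fin, smul_eq_mul]
  exact ENNReal.inv_mul_cancel (by simp [NeZero.ne M]) (by simp)

lemma lintegral_serverLaw {M : ℕ} (f : Fin M → ℝ≥0∞) :
    ∫⁻ m, f m ∂serverLaw M = (M : ℝ≥0∞)⁻¹ * ∑ m, f m := by
  rw [serverLaw, lintegral_smul_measure, lintegral_count, tsum_fintype, smul_eq_mul]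

lemma tickRate_pos {M : ℕ} [NeZero M] {μ : ℝ} (hμ : 0 < μ) : 0 < (M : ℝ) * μ :=
  mul_pos (Nat.cast_pos.2 (NeZero.pos M)) hμ

lemma isProbabilityMeasure_tickLaw {M : ℕ} [NeZero M] {μ : ℝ} (hμ : 0 < μ) (β : Measure Bool)
    [IsProbabilityMeasure β] : IsProbabilityMeasure (tickLaw M μ β) := by
  have := isProbabilityMeasure_expMeasure (tickRate_pos (M := M) hμ)
  rw [tickLaw]; infer_instance

/-! ### Thinning of competing exponential clocks. -/

section Thinning

variable {c d : ℝ}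

/-- The combined exponent `-(c + d)(v - t) - d (w - v)` has derivative `-c` in `v`, so the integrand
has an explicit antiderivative, also for `c = 0`. -/
lemma lintegral_exp_convolution (hc : 0 ≤ c) {t w : ℝ} (htw : t ≤ w) :
    ∫⁻ v in Set.Ioo t w, ENNReal.ofReal (c * Real.exp (-((c + d) * (v - t))) *
      Real.exp (-(d * (w - v)))) =
      ENNReal.ofReal (Real.exp (-(d * (w - t))) - Real.exp (-((c + d) * (w - t)))) := by
  have hderiv : ∀ v ∈ Set.uIcc t w, HasDerivAt
      (fun v => -(Real.exp (-((c + d) * (v - t)) - d * (w - v))))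
      (c * Real.exp (-((c + d) * (v - t))) * Real.exp (-(d * (w - v)))) v := fun v _ => by
    have h1 : HasDerivAt (fun v => -((c + d) * (v - t)) - d * (w - v)) (-((c + d) * 1) - d * (-1)) v :=
      (((hasDerivAt_id v).sub_const t).const_mul (c + d)).neg.sub
        (((hasDerivAt_id v).const_sub w).const_mul d)
    have h2 := h1.exp.neg
    have h3 : c * Real.exp (-((c + d) * (v - t))) * Real.exp (-(d * (w - v))) =
        -(Real.exp (-((c + d) * (v - t)) - d * (w - v)) * (-((c + d) * 1) - d * -1)) := by
      rw [mul_assoc, ← Real.exp_add]; ring_nf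
    rw [h3]
    exact h2
  have hcont : Continuous fun v => c * Real.exp (-((c + d) * (v - t))) * Real.exp (-(d * (w - v))) := by
    fun_prop
  have hint := intervalIntegral.integral_eq_sub_of_hasDerivAt hderiv (hcont.intervalIntegrable t w)
  rw [← ofReal_integral_eq_lintegral_ofReal]
  · rw [← integral_Ioc_eq_integral_Ioo, ← intervalIntegral.integral_of_le htw, hint]
    congr 1
    simp only [sub_self, mul_zero, neg_zero, sub_zero, zero_sub]
    ring
  · exact (hcont.integrableOn_Icc (a := t) (b := w)).mono_set Set.Ioo_subset_Icc_self
  · exact ae_of_all _ fun v => by positivity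

/-- The clock with rate `d` stays silent on `(t, w)` in one of two ways: the clock with rate `c` is
silent too, or it first rings at some `v` and the clock with rate `d` remains silent from `v` to
`w`. -/
lemma lintegral_exp_convolution_add (hc : 0 ≤ c) {t w : ℝ} (htw : t ≤ w) :
    ENNReal.ofReal (Real.exp (-((c + d) * (w - t)))) +
      ∫⁻ v in Set.Ioo t w, ENNReal.ofReal (c * Real.exp (-((c + d) * (v - t))) *
        Real.exp (-(d * (w - v)))) = ENNReal.ofReal (Real.exp (-(d * (w - t)))) := by
  rw [lintegral_exp_convolution hc htw, ← ENNReal.ofReal_add (Real.exp_pos _).le, add_sub_cancel]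
  rw [sub_nonneg, Real.exp_le_exp]
  nlinarith [mul_nonneg hc (sub_nonneg.2 htw)]

/-- The first of two competing exponential clocks, with rates `c` and `d`, where the clock with
rate `c` is restarted when it rings. -/
lemma lintegral_exp_thinning (hc : 0 ≤ c) {a : ℝ} (ha : 0 ≤ a) (t : ℝ) {φ : ℝ → ℝ≥0∞}
    (hφ : Measurable φ) :
    (∫⁻ v in Set.Ioi t, ENNReal.ofReal (a * Real.exp (-((c + d) * (v - t)))) * φ v) +
      (∫⁻ v in Set.Ioi t, ENNReal.ofReal (c * Real.exp (-((c + d) * (v - t)))) *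
        ∫⁻ w in Set.Ioi v, ENNReal.ofReal (a * Real.exp (-(d * (w - v)))) * φ w) =
      ∫⁻ w in Set.Ioi t, ENNReal.ofReal (a * Real.exp (-(d * (w - t)))) * φ w := by
  -- By Tonelli the ring `v` of the restarted clock is integrated first, for a fixed ring `w` of the
  -- other clock; `lintegral_exp_convolution_add` then evaluates the sum.
  have hswap : (∫⁻ v in Set.Ioi t, ENNReal.ofReal (c * Real.exp (-((c + d) * (v - t)))) *
        ∫⁻ w in Set.Ioi v, ENNReal.ofReal (a * Real.exp (-(d * (w - v)))) * φ w) =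
      ∫⁻ w in Set.Ioi t, ENNReal.ofReal a * φ w * ∫⁻ v in Set.Ioo t w, ENNReal.ofReal
        (c * Real.exp (-((c + d) * (v - t))) * Real.exp (-(d * (w - v)))) := by
    have hG : Measurable fun p : ℝ × ℝ => {p : ℝ × ℝ | t < p.1 ∧ p.1 < p.2}.indicator
        (fun p => ENNReal.ofReal (c * Real.exp (-((c + d) * (p.1 - t)))) *
          (ENNReal.ofReal (a * Real.exp (-(d * (p.2 - p.1)))) * φ p.2)) p := by
      refine Measurable.indicator (by fun_prop) ?_
      have h1 : MeasurableSet {p : ℝ × ℝ | t < p.1} := measurableSet_lt (by fun_prop) (by fun_prop)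
      have h2 : MeasurableSet {p : ℝ × ℝ | p.1 < p.2} := measurableSet_lt (by fun_prop) (by fun_prop)
      exact h1.inter h2
    rw [← lintegral_indicator measurableSet_Ioi, ← lintegral_indicator measurableSet_Ioi]
    calc _ = ∫⁻ v, ∫⁻ w, ({p : ℝ × ℝ | t < p.1 ∧ p.1 < p.2}.indicator
        (fun p => ENNReal.ofReal (c * Real.exp (-((c + d) * (p.1 - t)))) *
          (ENNReal.ofReal (a * Real.exp (-(d * (p.2 - p.1)))) * φ p.2)) (v, w)) := by
          refine lintegral_congr fun v => ?_
          by_cases hv : t < v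
          · rw [Set.indicator_of_mem (Set.mem_Ioi.2 hv), ← lintegral_const_mul _ (by fun_prop),
              ← lintegral_indicator measurableSet_Ioi]
            refine lintegral_congr fun w => ?_
            by_cases hw : v < w <;> simp [hv, hw]
          · simp [hv]
    _ = _ := by
          rw [lintegral_lintegral_swap hG.aemeasurable]
          refine lintegral_congr fun w => ?_
          by_cases hw : t < w
          · rw [Set.indicator_of_mem (Set.mem_Ioi.2 hw), ← lintegral_const_mul _ (by fun_prop),
              ← lintegral_indicator measurableSet_Ioo]
            refine lintegral_congr fun v => ?_
            by_cases hv : t < v ∧ v < w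
            · simp only [Set.indicator_apply, Set.mem_ofPred_eq, hv, Set.mem_Ioo, and_self, if_true]
              rw [ENNReal.ofReal_mul ha, ENNReal.ofReal_mul
                (p := c * Real.exp (-((c + d) * (v - t)))) (by positivity)]
              ring
            · simp [hv]
          · rw [Set.indicator_of_notMem (by simpa using hw)]
            refine (lintegral_congr fun v => ?_).trans lintegral_zero
            rw [Set.indicator_of_notMem]
            rintro ⟨h1, h2⟩
            exact hw (h1.trans h2)
  rw [hswap, ← lintegral_add_left (by fun_prop)]
  refine setLIntegral_congr_fun measurableSet_Ioi fun w hw => ?_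
  have h := lintegral_exp_convolution_add (d := d) hc (le_of_lt hw)
  rw [ENNReal.ofReal_mul ha, ENNReal.ofReal_mul ha, ← h]
  ring

end Thinning

/-! ### Outcomes of races with random transmission errors. -/

variable {M : ℕ}

/-- The expectation of a function of the outcome of a race, where errors occur with law `β`. -/
noncomputable def raceMean (μ : ℝ) (β : Measure Bool) (t : ℝ) (dl : EReal) (B : Finset (Fin M))
    (f : Outcome M → ℝ≥0∞) : ℝ≥0∞ :=
  (∫⁻ w in Set.Ioi t, ENNReal.ofReal (μ * Real.exp (-(B.card * μ * (w - t)))) *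
    ({w : ℝ | (w : EReal) < dl}.indicator
      (fun w => ∑ m ∈ B, ∫⁻ b, f ((w : EReal), some (m, b)) ∂β) w)) +
  raceSurvival μ t dl B * f (dl, none)

variable {μ : ℝ} {β : Measure Bool}

lemma measurable_ending (m : Fin M) {f : Outcome M → ℝ≥0∞} (hf : Measurable f) :
    Measurable fun p : ℝ × Bool => f ((p.1 : EReal), some (m, p.2)) :=
  hf.comp (Measurable.prodMk (by fun_prop)
    ((Measurable.of_discrete (f := fun b : Bool => some (m, b))).comp measurable_snd))

lemma measurable_endings [SFinite β] (B : Finset (Fin M)) {f : Outcome M → ℝ≥0∞} (hf : Measurable f) :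
    Measurable fun w : ℝ => ∑ m ∈ B, ∫⁻ b, f ((w : EReal), some (m, b)) ∂β :=
  Finset.measurable_fun_sum _ fun m _ => (measurable_ending m hf).lintegral_prod_right'

variable [IsProbabilityMeasure β]

lemma measurableSet_coe_lt (dl : EReal) : MeasurableSet {w : ℝ | (w : EReal) < dl} :=
  measurableSet_lt (by fun_prop) (by fun_prop)

/-- The outcome contains the error bit of the winner only, so averaging over all bits amounts to one
average with law `β`. -/
lemma lintegral_raceExpect (t : ℝ) (dl : EReal) (B : Finset (Fin M)) {f : Outcome M → ℝ≥0∞}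
    (hf : Measurable f) :
    ∫⁻ e, raceExpect μ t dl B e f ∂iid (Fin M) β = raceMean μ β t dl B f := by
  have hm : ∀ m, Measurable fun p : (Fin M → Bool) × ℝ =>
      ENNReal.ofReal (μ * Real.exp (-(B.card * μ * (p.2 - t)))) *
        ({w : ℝ | (w : EReal) < dl}.indicator (fun w => f ((w : EReal), some (m, p.1 m))) p.2) :=
    fun m => by
      refine Measurable.mul (by fun_prop) (Measurable.indicator ?_ (measurable_snd (measurableSet_coe_lt dl)))
      exact (measurable_ending m hf).comp (measurable_snd.prodMk ((measurable_pi_apply m).comp measurable_fst))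
  simp only [raceExpect, raceMean]
  rw [lintegral_add_right _ measurable_const, lintegral_const, measure_univ, mul_one,
    lintegral_finsetSum _ fun m _ => (hm m).lintegral_prod_right']
  congr 1
  have h1 : ∀ w, ENNReal.ofReal (μ * Real.exp (-(B.card * μ * (w - t)))) *
      ({w : ℝ | (w : EReal) < dl}.indicator
        (fun w => ∑ m ∈ B, ∫⁻ b, f ((w : EReal), some (m, b)) ∂β) w) =
      ∑ m ∈ B, ENNReal.ofReal (μ * Real.exp (-(B.card * μ * (w - t)))) *
      ({w : ℝ | (w : EReal) < dl}.indicator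
        (fun w => ∫⁻ b, f ((w : EReal), some (m, b)) ∂β) w) := fun w => by
    rw [← Finset.mul_sum]
    congr 1
    by_cases hw : (w : EReal) < dl <;> simp [hw]
  simp_rw [h1]
  rw [lintegral_finsetSum _ fun m _ => ?_]
  · refine Finset.sum_congr rfl fun m _ => ?_
    rw [lintegral_lintegral_swap (hm m).aemeasurable]
    refine lintegral_congr fun w => ?_
    have hmw : Measurable fun b => f ((w : EReal), some (m, b)) :=
      (measurable_ending m hf).comp (measurable_const.prodMk measurable_id)
    by_cases hw : (w : EReal) < dl
    · simp only [Set.indicator_apply, Set.mem_ofPred_eq, hw, if_true]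
      have hmw' : Measurable fun e : Fin M → Bool => f ((w : EReal), some (m, e m)) :=
        hmw.comp (measurable_pi_apply m)
      rw [lintegral_const_mul _ hmw', lintegral_iid_eval β m hmw]
    · simp [hw]
  · refine Measurable.mul (by fun_prop) (Measurable.indicator ?_ (measurableSet_coe_lt dl))
    exact (measurable_ending m hf).lintegral_prod_right'

/-- The law of the outcome of a race of independent exponential clocks with rate `μ`. -/
noncomputable def raceLaw (μ : ℝ) (β : Measure Bool) (t : ℝ) (dl : EReal) (B : Finset (Fin M)) :
    Measure (Outcome M) :=
  ((iid (Fin M) (expMeasure μ)).prod (iid (Fin M) β)).map fun p => raceEnd t dl B p.1 p.2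

lemma measurable_raceEnd' (t : ℝ) (dl : EReal) (B : Finset (Fin M)) :
    Measurable fun p : (Fin M → ℝ) × (Fin M → Bool) => raceEnd t dl B p.1 p.2 :=
  measurable_raceEnd.comp (f := fun p : (Fin M → ℝ) × (Fin M → Bool) => (((t, dl), B), p))
    (by fun_prop)

lemma isProbabilityMeasure_raceLaw (hμ : 0 < μ) (t : ℝ) (dl : EReal) (B : Finset (Fin M)) :
    IsProbabilityMeasure (raceLaw μ β t dl B) := by
  have := isProbabilityMeasure_expMeasure hμ
  exact Measure.isProbabilityMeasure_map (measurable_raceEnd' t dl B).aemeasurable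

lemma lintegral_raceLaw (hμ : 0 < μ) {t : ℝ} {dl : EReal} (hdl : (t : EReal) ≤ dl)
    (B : Finset (Fin M)) {f : Outcome M → ℝ≥0∞} (hf : Measurable f) :
    ∫⁻ o, f o ∂raceLaw μ β t dl B = raceMean μ β t dl B f := by
  have := isProbabilityMeasure_expMeasure hμ
  rw [raceLaw, lintegral_map hf (measurable_raceEnd' t dl B), lintegral_prod_symm]
  · simp only [lintegral_raceEnd hμ hdl B _ hf]
    exact lintegral_raceExpect t dl B hf
  · exact (hf.comp (measurable_raceEnd' t dl B)).aemeasurable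


/-! ## Races driven by a stream of ticks -/

variable {M : ℕ}

open Classical in
/-- The outcome of a period which starts at time `t` and is ended by a tick of one of the servers
in `B`, at time `dl` at the latest, together with the ticks which remain and the number of ticks
which have been used up. At most `n` ticks are considered; if the period has not ended then, the
time in the outcome is `⊤`. -/
noncomputable def tickRace (dl : EReal) (B : Finset (Fin M)) :
    ℕ → ℝ → Stream M → (Outcome M × Stream M) × ℕ
  | 0, _, r => (((⊤, none), r), 0)
  | n + 1, t, r =>
    -- A tick after the deadline is not used up: its overshoot becomes the first gap of the
    -- remaining stream, and the count stays the same. The condition forces `dl` to be finite, so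
    -- the time `⊤` occurs only in undecided races.
    if dl ≤ ((t + (r 0).1 : ℝ) : EReal) then
      (((dl, none), cons (t + (r 0).1 - dl.toReal, (r 0).2) fun i => r (i + 1)), 0)
    else if (r 0).2.1 ∈ B then
      (((((t + (r 0).1 : ℝ) : EReal), some (r 0).2), fun i => r (i + 1)), 1)
    else
      ((tickRace dl B n (t + (r 0).1) fun i => r (i + 1)).1,
        (tickRace dl B n (t + (r 0).1) fun i => r (i + 1)).2 + 1)

open Classical in
lemma tickRace_succ (dl : EReal) (B : Finset (Fin M)) (n : ℕ) (t : ℝ) (r : Stream M) :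
    tickRace dl B (n + 1) t r =
      if dl ≤ ((t + (r 0).1 : ℝ) : EReal) then
        (((dl, none), cons (t + (r 0).1 - dl.toReal, (r 0).2) fun i => r (i + 1)), 0)
      else if (r 0).2.1 ∈ B then
        (((((t + (r 0).1 : ℝ) : EReal), some (r 0).2), fun i => r (i + 1)), 1)
      else
        ((tickRace dl B n (t + (r 0).1) fun i => r (i + 1)).1,
          (tickRace dl B n (t + (r 0).1) fun i => r (i + 1)).2 + 1) := by
  rw [tickRace]

lemma tickRace_succ_of_ne_top {dl : EReal} {B : Finset (Fin M)} {n : ℕ} {t : ℝ} {r : Stream M}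
    (h : (tickRace dl B n t r).1.1.1 ≠ ⊤) : tickRace dl B (n + 1) t r = tickRace dl B n t r := by
  induction n generalizing t r with
  | zero => exact absurd rfl h
  | succ n ih =>
    rw [tickRace_succ] at h
    have e1 := tickRace_succ dl B (n + 1) t r
    have e2 := tickRace_succ dl B n t r
    rw [e1, e2]
    split_ifs at h ⊢
    · rfl
    · rfl
    · rw [ih h]

lemma tickRace_of_le {dl : EReal} {B : Finset (Fin M)} {n k : ℕ} (hnk : n ≤ k) {t : ℝ}
    {r : Stream M} (h : (tickRace dl B n t r).1.1.1 ≠ ⊤) :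
    tickRace dl B k t r = tickRace dl B n t r := by
  induction k, hnk using Nat.le_induction with
  | base => rfl
  | succ k _ ih => rw [tickRace_succ_of_ne_top (by rwa [ih]), ih]

open Classical in
/-- The outcome of a period which starts at time `t` and is ended by a tick of one of the servers
in `B`, at time `dl` at the latest. -/
noncomputable def streamRace (t : ℝ) (dl : EReal) (B : Finset (Fin M)) (r : Stream M) :
    (Outcome M × Stream M) × ℕ :=
  if h : ∃ n, (tickRace dl B n t r).1.1.1 ≠ ⊤ then tickRace dl B (Nat.find h) t r
  else (((⊤, none), r), 0)

lemma streamRace_of_ne_top {dl : EReal} {B : Finset (Fin M)} {n : ℕ} {t : ℝ} {r : Stream M}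
    (h : (tickRace dl B n t r).1.1.1 ≠ ⊤) : streamRace t dl B r = tickRace dl B n t r := by
  classical
  have h' : ∃ n, (tickRace dl B n t r).1.1.1 ≠ ⊤ := ⟨n, h⟩
  rw [streamRace, dif_pos h', ← tickRace_of_le (Nat.find_min' h' h) (Nat.find_spec h')]

lemma streamRace_of_eq_top {dl : EReal} {B : Finset (Fin M)} {t : ℝ} {r : Stream M}
    (h : ∀ n, (tickRace dl B n t r).1.1.1 = ⊤) : streamRace t dl B r = (((⊤, none), r), 0) :=
  dif_neg (by simpa using h)

lemma tickRace_top_empty (n : ℕ) (t : ℝ) (r : Stream M) :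
    (tickRace ⊤ (∅ : Finset (Fin M)) n t r).1.1.1 = ⊤ := by
  induction n generalizing t r with
  | zero => rfl
  | succ n ih =>
    rw [tickRace_succ, if_neg (by simp [-EReal.coe_add]), if_neg (by simp)]
    exact ih _ _

lemma measurable_tickRace (n : ℕ) : Measurable fun p : ((ℝ × EReal) × Finset (Fin M)) × Stream M =>
    tickRace p.1.1.2 p.1.2 n p.1.1.1 p.2 := by
  induction n with
  | zero => simp only [tickRace]; fun_prop
  | succ n ih =>
    have hrec : Measurable fun p : ((ℝ × EReal) × Finset (Fin M)) × Stream M =>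
        tickRace p.1.1.2 p.1.2 n (p.1.1.1 + (p.2 0).1) fun i => p.2 (i + 1) :=
      ih.comp (f := fun p : ((ℝ × EReal) × Finset (Fin M)) × Stream M =>
        (((p.1.1.1 + (p.2 0).1, p.1.1.2), p.1.2), fun i => p.2 (i + 1))) (by fun_prop)
    have hmem : MeasurableSet {p : ((ℝ × EReal) × Finset (Fin M)) × Stream M | (p.2 0).2.1 ∈ p.1.2} := by
      have h1 : Measurable fun p : ((ℝ × EReal) × Finset (Fin M)) × Stream M => ((p.2 0).2.1, p.1.2) := by
        fun_prop
      exact h1 (MeasurableSet.of_discrete (s := {q : Fin M × Finset (Fin M) | q.1 ∈ q.2}))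
    have hsome : Measurable fun p : ((ℝ × EReal) × Finset (Fin M)) × Stream M => some (p.2 0).2 :=
      (Measurable.of_discrete (f := fun b : Fin M × Bool => some b)).comp (by fun_prop)
    simp only [tickRace]
    refine Measurable.ite (measurableSet_le (by fun_prop) (by fun_prop)) ?_
      (Measurable.ite hmem ?_ ?_)
    · fun_prop
    · fun_prop
    · exact hrec.fst.prodMk (hrec.snd.add_const 1)

lemma measurable_streamRace : Measurable fun p : ((ℝ × EReal) × Finset (Fin M)) × Stream M =>
    streamRace p.1.1.1 p.1.1.2 p.1.2 p.2 := by
  have hr : ∀ n, MeasurableSet {p : ((ℝ × EReal) × Finset (Fin M)) × Stream M |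
      (tickRace p.1.1.2 p.1.2 n p.1.1.1 p.2).1.1.1 ≠ ⊤} := fun n =>
    ((measurable_tickRace n).fst.fst.fst (measurableSet_singleton _)).compl
  intro S hS
  have : (fun p : ((ℝ × EReal) × Finset (Fin M)) × Stream M =>
      streamRace p.1.1.1 p.1.1.2 p.1.2 p.2) ⁻¹' S =
      (⋃ n, {p | (tickRace p.1.1.2 p.1.2 n p.1.1.1 p.2).1.1.1 ≠ ⊤} ∩
        (fun p => tickRace p.1.1.2 p.1.2 n p.1.1.1 p.2) ⁻¹' S) ∪
      ((⋂ n, {p | (tickRace p.1.1.2 p.1.2 n p.1.1.1 p.2).1.1.1 ≠ ⊤}ᶜ) ∩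
        (fun p => ((((⊤, none), p.2), 0) : (Outcome M × Stream M) × ℕ)) ⁻¹' S) := by
    ext p
    simp only [Set.mem_preimage, Set.mem_union, Set.mem_iUnion, Set.mem_inter_iff, Set.mem_iInter,
      Set.mem_compl_iff, Set.mem_ofPred_eq, not_not]
    by_cases h : ∃ n, (tickRace p.1.1.2 p.1.2 n p.1.1.1 p.2).1.1.1 ≠ ⊤
    · obtain ⟨n, hn⟩ := h
      rw [streamRace_of_ne_top hn]
      refine ⟨fun hs => .inl ⟨n, hn, hs⟩, ?_⟩
      rintro (⟨k, hk, hs⟩ | ⟨h, _⟩)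
      · rwa [← streamRace_of_ne_top hn, streamRace_of_ne_top hk]
      · exact absurd (h n) hn
    · push Not at h
      rw [streamRace_of_eq_top h]
      exact ⟨fun hs => .inr ⟨h, hs⟩, by
        rintro (⟨k, hk, _⟩ | ⟨_, hs⟩); exacts [absurd (h k) hk, hs]⟩
  rw [this]
  refine (MeasurableSet.iUnion fun n => (hr n).inter (measurable_tickRace n hS)).union
    ((MeasurableSet.iInter fun n => (hr n).compl).inter ?_)
  have h0 : Measurable fun p : ((ℝ × EReal) × Finset (Fin M)) × Stream M =>
      ((((⊤, none), p.2), 0) : (Outcome M × Stream M) × ℕ) := by fun_prop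
  exact h0 hS

lemma measurable_tickRace' (dl : EReal) (B : Finset (Fin M)) (n : ℕ) :
    Measurable fun p : ℝ × Stream M => tickRace dl B n p.1 p.2 :=
  (measurable_tickRace n).comp (f := fun p : ℝ × Stream M => (((p.1, dl), B), p.2)) (by fun_prop)

lemma measurable_streamRace' (t : ℝ) (dl : EReal) (B : Finset (Fin M)) :
    Measurable fun r : Stream M => streamRace t dl B r :=
  measurable_streamRace.comp (f := fun r : Stream M => (((t, dl), B), r)) (by fun_prop)

/-! ### First-tick analysis of races driven by a stream. -/

section Law

variable {μ : ℝ} {β : Measure Bool}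

/-- Functions of a race which is decided within `n` ticks. -/
noncomputable def decided (dl : EReal) (B : Finset (Fin M)) (n : ℕ) (t : ℝ)
    (F : Outcome M × Stream M → ℝ≥0∞) (r : Stream M) : ℝ≥0∞ :=
  {r | (tickRace dl B n t r).1.1.1 ≠ ⊤}.indicator (fun r => F (tickRace dl B n t r).1) r

lemma decided_succ {dl : EReal} {B : Finset (Fin M)} {n : ℕ} {t : ℝ}
    {F : Outcome M × Stream M → ℝ≥0∞} (x : Tick M) (s : Stream M) :
    decided dl B (n + 1) t F (cons x s) =
      {x : Tick M | dl ≤ ((t + x.1 : ℝ) : EReal)}.indicator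
        (fun x => F ((dl, none), cons (t + x.1 - dl.toReal, x.2) s)) x +
      {x : Tick M | ((t + x.1 : ℝ) : EReal) < dl}.indicator (fun x =>
        if x.2.1 ∈ B then F ((((t + x.1 : ℝ) : EReal), some x.2), s)
        else decided dl B n (t + x.1) F s) x := by
  by_cases h1 : dl ≤ ((t + x.1 : ℝ) : EReal)
  · have h2 : dl ≠ ⊤ := fun h => by simp [h, -EReal.coe_add] at h1
    have h3 : x ∉ {x : Tick M | ((t + x.1 : ℝ) : EReal) < dl} := not_lt.2 h1
    have h4 : tickRace dl B (n + 1) t (cons x s) =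
        (((dl, none), cons (t + x.1 - dl.toReal, x.2) s), 0) := by
      rw [tickRace]; simp only [cons_zero, cons_succ, h1, if_true]
    have h5 : cons x s ∈ {r | (tickRace dl B (n + 1) t r).1.1.1 ≠ ⊤} := by
      simp only [Set.mem_ofPred_eq, h4]; exact h2
    rw [decided, Set.indicator_of_mem h5, Set.indicator_of_notMem h3, add_zero, Set.indicator_of_mem
      (show x ∈ {x : Tick M | dl ≤ ((t + x.1 : ℝ) : EReal)} from h1), h4]
  · have h3 : x ∈ {x : Tick M | ((t + x.1 : ℝ) : EReal) < dl} := not_le.1 h1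
    rw [Set.indicator_of_mem h3, Set.indicator_of_notMem
      (show x ∉ {x : Tick M | dl ≤ ((t + x.1 : ℝ) : EReal)} from h1), zero_add]
    by_cases hB : x.2.1 ∈ B
    · have h4 : tickRace dl B (n + 1) t (cons x s) = (((((t + x.1 : ℝ) : EReal), some x.2), s), 1) := by
        rw [tickRace]; simp only [cons_zero, cons_succ, h1, if_false, hB, if_true]
      have h5 : cons x s ∈ {r | (tickRace dl B (n + 1) t r).1.1.1 ≠ ⊤} := by
        simp only [Set.mem_ofPred_eq, h4]; exact EReal.coe_ne_top _
      rw [decided, Set.indicator_of_mem h5, h4, if_pos hB]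
    · have h4 : (tickRace dl B (n + 1) t (cons x s)).1 = (tickRace dl B n (t + x.1) s).1 := by
        rw [tickRace]; simp only [cons_zero, cons_succ, h1, if_false, hB]
      rw [if_neg hB, decided, decided]
      simp only [Set.indicator_apply, Set.mem_ofPred_eq, h4]

lemma measurable_decided (dl : EReal) (B : Finset (Fin M)) (n : ℕ)
    {F : Outcome M × Stream M → ℝ≥0∞} (hF : Measurable F) :
    Measurable fun p : ℝ × Stream M => decided dl B n p.1 F p.2 := by
  have h := measurable_tickRace' dl B n
  have hs : MeasurableSet {p : ℝ × Stream M | (tickRace dl B n p.1 p.2).1.1.1 ≠ ⊤} :=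
    (h.fst.fst.fst (measurableSet_singleton _)).compl
  exact (hF.comp h.fst).indicator hs

lemma lintegral_tick_before (t : ℝ) (dl : EReal) {ψ : ℝ → ℝ≥0∞}
    (hψ : Measurable ψ) :
    ∫⁻ g, {g : ℝ | ((t + g : ℝ) : EReal) < dl}.indicator (fun g => ψ (t + g)) g ∂expMeasure (M * μ) =
      ∫⁻ v in Set.Ioi t, ENNReal.ofReal (M * μ * Real.exp (-(M * μ * (v - t)))) *
        {w : ℝ | (w : EReal) < dl}.indicator ψ v := by
  rw [← lintegral_expMeasure_add t (hψ.indicator (measurableSet_coe_lt dl))]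
  exact lintegral_congr fun g => by simp [Set.indicator_apply, -EReal.coe_add]

variable [NeZero M]

lemma lintegral_tickLaw [SFinite β] (hμ : 0 < μ) {f : Tick M → ℝ≥0∞} (hf : Measurable f) :
    ∫⁻ x, f x ∂tickLaw M μ β =
      ∫⁻ g, (M : ℝ≥0∞)⁻¹ * ∑ m, ∫⁻ b, f (g, (m, b)) ∂β ∂expMeasure (M * μ) := by
  have := isProbabilityMeasure_expMeasure (tickRate_pos (M := M) hμ)
  rw [tickLaw, lintegral_prod _ hf.aemeasurable]
  refine lintegral_congr fun g => ?_
  have hg : Measurable fun y => f (g, y) := hf.comp (measurable_const.prodMk measurable_id)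
  rw [lintegral_prod _ hg.aemeasurable, lintegral_serverLaw]

/-- The deadline is reached before the first tick. -/
lemma lintegral_deadline [SFinite β] (hμ : 0 < μ) {t : ℝ} {dl : ℝ} (hdl : t ≤ dl)
    {f : Tick M → ℝ≥0∞} (hf : Measurable f) :
    ∫⁻ x, {x : Tick M | (dl : EReal) ≤ ((t + x.1 : ℝ) : EReal)}.indicator
      (fun x => f (t + x.1 - dl, x.2)) x ∂tickLaw M μ β =
      ENNReal.ofReal (Real.exp (-(M * μ * (dl - t)))) * ∫⁻ x, f x ∂tickLaw M μ β := by
  have := isProbabilityMeasure_expMeasure (tickRate_pos (M := M) hμ)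
  have hm : Measurable fun x : Tick M => {x : Tick M | (dl : EReal) ≤ ((t + x.1 : ℝ) : EReal)}.indicator
      (fun x => f (t + x.1 - dl, x.2)) x :=
    Measurable.indicator (hf.comp (by fun_prop)) (measurableSet_le (by fun_prop) (by fun_prop))
  have hm2 : Measurable fun g : ℝ => (M : ℝ≥0∞)⁻¹ * ∑ m : Fin M, ∫⁻ b, f (g, (m, b)) ∂β :=
    Measurable.const_mul (Finset.measurable_fun_sum _ fun m _ =>
      Measurable.lintegral_prod_right' (f := fun p : ℝ × Bool => f (p.1, (m, p.2)))
        (hf.comp (by fun_prop))) _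
  rw [lintegral_tickLaw hμ hm, lintegral_tickLaw hμ hf,
    ← lintegral_expMeasure_memoryless (sub_nonneg.2 hdl) hm2, ← lintegral_indicator measurableSet_Ioi]
  have hne : ∀ᵐ g ∂expMeasure (M * μ), g ≠ dl - t := by simp [ae_iff, measure_singleton]
  refine lintegral_congr_ae (hne.mono fun g hg => ?_)
  have hiff : (dl : EReal) ≤ ((t + g : ℝ) : EReal) ↔ dl - t < g := by
    rw [EReal.coe_le_coe_iff]
    exact ⟨fun h => lt_of_le_of_ne (by linarith) hg.symm, fun h => by linarith⟩
  by_cases h : dl - t < g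
  · have h2 : t + g - dl = g - (dl - t) := by ring
    simp only [Set.indicator_apply, Set.mem_ofPred_eq, hiff, h, Set.mem_Ioi, if_true, h2]
  · have h3 : ¬ dl ≤ t + g := by rwa [← EReal.coe_le_coe_iff, hiff]
    simp [h3, h, -EReal.coe_add]

/-- Renewal at the first tick, which has rate `M * μ`: it comes after the deadline, or it belongs to
a server in `B` and ends the race, or it belongs to one of the other `M - B.card` servers and the
race starts afresh. That a race with rate `B.card * μ` is compatible with this is thinning. An upper
bound is enough, because total masses are compared later. -/
lemma raceMean_renewal [SFinite β] (hμ : 0 < μ) {t : ℝ} {dl : EReal} (hdl : (t : EReal) ≤ dl)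
    (B : Finset (Fin M)) {f : Outcome M → ℝ≥0∞} (hf : Measurable f) :
    (if dl = ⊤ then 0 else ENNReal.ofReal (Real.exp (-(M * μ * (dl.toReal - t))))) * f (dl, none) +
      (∫⁻ v in Set.Ioi t, ENNReal.ofReal (M * μ * Real.exp (-(M * μ * (v - t)))) *
        {w : ℝ | (w : EReal) < dl}.indicator (fun v => (M : ℝ≥0∞)⁻¹ *
          ((∑ m ∈ B, ∫⁻ b, f ((v : EReal), some (m, b)) ∂β) +
            (M - B.card : ℕ) * raceMean μ β v dl B f)) v) ≤
    raceMean μ β t dl B f := by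
  set φ : ℝ → ℝ≥0∞ := {w : ℝ | (w : EReal) < dl}.indicator
    (fun w => ∑ m ∈ B, ∫⁻ b, f ((w : EReal), some (m, b)) ∂β) with hφ
  have hφm : Measurable φ := (measurable_endings B hf).indicator (measurableSet_coe_lt dl)
  -- `d` is the rate of the ticks that end the race and `c` that of the void ticks; they add up to
  -- the rate of all ticks.
  set d : ℝ := B.card * μ with hd
  set c : ℝ := (M - B.card : ℕ) * μ with hc
  have hcard : B.card ≤ M := by simpa using Finset.card_le_univ B
  have hcd : (M : ℝ) * μ = c + d := by
    rw [hc, hd, Nat.cast_sub hcard]; ring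
  have hc0 : 0 ≤ c := by positivity
  have hM0 : (M : ℝ) ≠ 0 := Nat.cast_ne_zero.2 (NeZero.ne M)
  set I : ℝ → ℝ≥0∞ := fun v => ∫⁻ w in Set.Ioi v, ENNReal.ofReal (μ * Real.exp (-(d * (w - v)))) * φ w
    with hI
  have hIm : Measurable I := by
    have : ∀ v, I v = ∫⁻ w, {p : ℝ × ℝ | p.1 < p.2}.indicator
        (fun p => ENNReal.ofReal (μ * Real.exp (-(d * (p.2 - p.1)))) * φ p.2) (v, w) := fun v => by
      rw [hI]; simp only
      rw [← lintegral_indicator measurableSet_Ioi]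
      exact lintegral_congr fun w => by simp [Set.indicator_apply]
    rw [funext this]
    refine Measurable.lintegral_prod_right' (f := fun p : ℝ × ℝ => {p : ℝ × ℝ | p.1 < p.2}.indicator
        (fun p => ENNReal.ofReal (μ * Real.exp (-(d * (p.2 - p.1)))) * φ p.2) p) ?_
    exact Measurable.indicator (by fun_prop) (measurableSet_lt (by fun_prop) (by fun_prop))
  have hmean : ∀ v, raceMean μ β v dl B f = I v + raceSurvival μ v dl B * f (dl, none) := fun v => rfl
  have hrate : ∀ x : ℝ, ENNReal.ofReal (M * μ * Real.exp x) * (M : ℝ≥0∞)⁻¹ =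
      ENNReal.ofReal (μ * Real.exp x) := fun x => by
    rw [mul_assoc, ENNReal.ofReal_mul (by positivity), ENNReal.ofReal_natCast, mul_comm, ← mul_assoc,
      ENNReal.inv_mul_cancel (by simp [NeZero.ne M]) (by simp), one_mul]
  have hrate2 : ∀ x : ℝ, ENNReal.ofReal (M * μ * Real.exp x) * (M : ℝ≥0∞)⁻¹ * (M - B.card : ℕ) =
      ENNReal.ofReal (c * Real.exp x) := fun x => by
    rw [hrate, hc, mul_assoc, ENNReal.ofReal_mul (p := ((M - B.card : ℕ) : ℝ)) (by positivity),
      ENNReal.ofReal_natCast, mul_comm]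
  have hsplit : ∀ v ∈ Set.Ioi t, ENNReal.ofReal (M * μ * Real.exp (-(M * μ * (v - t)))) *
        {w : ℝ | (w : EReal) < dl}.indicator (fun v => (M : ℝ≥0∞)⁻¹ *
          ((∑ m ∈ B, ∫⁻ b, f ((v : EReal), some (m, b)) ∂β) +
            (M - B.card : ℕ) * raceMean μ β v dl B f)) v =
      ENNReal.ofReal (μ * Real.exp (-((c + d) * (v - t)))) * φ v +
      (ENNReal.ofReal (c * Real.exp (-((c + d) * (v - t)))) * I v +
        ENNReal.ofReal (c * Real.exp (-((c + d) * (v - t)))) *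
          {w : ℝ | (w : EReal) < dl}.indicator
            (fun v => raceSurvival μ v dl B * f (dl, none)) v) := fun v _ => by
    by_cases hv : (v : EReal) < dl
    · have hv' : v ∈ {w : ℝ | (w : EReal) < dl} := hv
      rw [hφ, Set.indicator_of_mem hv', Set.indicator_of_mem hv', Set.indicator_of_mem hv', hmean,
        ← hcd, ← hrate2, ← hrate]
      ring
    · have hv' : v ∉ {w : ℝ | (w : EReal) < dl} := hv
      have hI0 : I v = 0 := by
        rw [hI]; simp only
        refine (setLIntegral_congr_fun (g := fun _ => 0) measurableSet_Ioi fun w hw => ?_).trans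
          (by simp)
        have : w ∉ {w : ℝ | (w : EReal) < dl} := fun h =>
          hv ((EReal.coe_lt_coe_iff.2 hw).trans h)
        simp only [hφ, Set.indicator_of_notMem this, mul_zero]
      rw [hφ, Set.indicator_of_notMem hv', Set.indicator_of_notMem hv', Set.indicator_of_notMem hv', hI0]
      simp
  rw [setLIntegral_congr_fun measurableSet_Ioi hsplit, lintegral_add_left (by fun_prop),
    lintegral_add_left (by fun_prop), hmean t, ← add_assoc
      (∫⁻ v in Set.Ioi t, ENNReal.ofReal (μ * Real.exp (-((c + d) * (v - t)))) * φ v),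
    lintegral_exp_thinning hc0 hμ.le t hφm, add_left_comm]
  refine add_le_add le_rfl ?_
  -- What remains is the contribution of the deadline. Without a deadline it vanishes unless `B` is
  -- empty, and then the first tick has rate `c` and comes with probability one.
  by_cases htop : dl = ⊤
  · subst htop
    simp only [if_true, zero_mul, zero_add, EReal.coe_lt_top]
    by_cases hB : B = ∅
    · subst hB
      have h1 := lintegral_expMeasure_add (r := c) t (f := fun _ => 1) measurable_const
      have hcpos : 0 < c := by
        have h2 := tickRate_pos (M := M) hμ
        rw [hcd] at h2
        simpa [hd] using h2
      have := isProbabilityMeasure_expMeasure hcpos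
      simp only [lintegral_one, measure_univ, mul_one] at h1
      simp only [raceSurvival, if_true, one_mul, hd, Finset.card_empty, Nat.cast_zero, zero_mul, add_zero]
      have h2 : ∀ v : ℝ, {w : ℝ | True}.indicator (fun _ => f (⊤, none)) v = f (⊤, none) := fun v =>
        Set.indicator_of_mem (s := {w : ℝ | True}) trivial _
      simp only [h2]
      rw [lintegral_mul_const _ (by fun_prop), ← h1, one_mul]
    · simp [raceSurvival, hB]
  · lift dl to ℝ using ⟨htop, fun h => by simp [h] at hdl⟩
    rw [if_neg htop]
    have hdl' : t ≤ dl := EReal.coe_le_coe_iff.1 hdl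
    have h1 : ∫⁻ v in Set.Ioi t, ENNReal.ofReal (c * Real.exp (-((c + d) * (v - t)))) *
          {w : ℝ | (w : EReal) < dl}.indicator
            (fun v => raceSurvival μ v dl B * f (dl, none)) v =
        (∫⁻ v in Set.Ioo t dl, ENNReal.ofReal (c * Real.exp (-((c + d) * (v - t))) *
          Real.exp (-(d * (dl - v))))) * f (dl, none) := by
      rw [← lintegral_mul_const _ (by fun_prop), ← lintegral_indicator measurableSet_Ioi,
        ← lintegral_indicator measurableSet_Ioo]
      refine lintegral_congr fun v => ?_
      by_cases h1 : t < v <;> by_cases h2 : v < dl <;>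
        simp [Set.indicator_apply, h1, h2, raceSurvival, hd]
      rw [ENNReal.ofReal_mul (q := Real.exp (-(↑B.card * μ * (dl - v)))) (by positivity)]
      ring
    rw [h1, ← add_mul, hcd, EReal.toReal_coe, lintegral_exp_convolution_add hc0 hdl', raceSurvival, if_neg htop,
      EReal.toReal_coe, hd]

end Law


/-! ### The law of the outcome of a race driven by a stream. -/

section Law

variable {M : ℕ}

/-- The properties of a stream of ticks that hold almost surely. -/
structure GoodStream (s : Stream M) : Prop where
  gap_pos : ∀ i, 0 < (s i).1
  gap_large : ∀ k, ∃ i ≥ k, 1 ≤ (s i).1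
  mark : ∀ m k, ∃ i ≥ k, (s i).2.1 = m

lemma tickRace_ne_top_of_mark {dl : EReal} {B : Finset (Fin M)} {i : ℕ} {t : ℝ} {r : Stream M}
    (h : (r i).2.1 ∈ B) : (tickRace dl B (i + 1) t r).1.1.1 ≠ ⊤ := by
  induction i generalizing t r with
  | zero =>
    rw [tickRace_succ]
    split_ifs with h1
    · rintro h2; simp only at h2; subst h2; simp [-EReal.coe_add] at h1
    · exact EReal.coe_ne_top _
  | succ i ih =>
    rw [tickRace_succ]
    split_ifs with h1
    · rintro h2; simp only at h2; subst h2; simp [-EReal.coe_add] at h1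
    · exact EReal.coe_ne_top _
    · exact ih (r := fun i => r (i + 1)) h

lemma tickRace_ne_top_of_le {dl : EReal} {B : Finset (Fin M)} {i : ℕ} {t : ℝ} {r : Stream M}
    (h : dl ≤ ((t + ∑ j ∈ Finset.range (i + 1), (r j).1 : ℝ) : EReal)) :
    (tickRace dl B (i + 1) t r).1.1.1 ≠ ⊤ := by
  induction i generalizing t r with
  | zero =>
    rw [tickRace_succ]
    split_ifs with h1
    · rintro h2; simp only at h2; subst h2; simp [-EReal.coe_add] at h1
    · exact EReal.coe_ne_top _
    · exact absurd (by simpa [-EReal.coe_add] using h) h1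
  | succ i ih =>
    rw [tickRace_succ]
    split_ifs with h1
    · rintro h2; simp only at h2; subst h2; simp [-EReal.coe_add] at h1
    · exact EReal.coe_ne_top _
    · refine ih (r := fun i => r (i + 1)) (h.trans_eq ?_)
      rw [Finset.sum_range_succ' _ (i + 1)]
      congr 1; ring

/-- Infinitely many gaps are at least `1`, so the tick times diverge. -/
lemma GoodStream.exists_sum_ge {s : Stream M} (h : GoodStream s) (c : ℝ) :
    ∃ n, c ≤ ∑ j ∈ Finset.range (n + 1), (s j).1 := by
  have key : ∀ k : ℕ, ∃ n, (k : ℝ) ≤ ∑ j ∈ Finset.range n, (s j).1 := fun k => by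
    induction k with
    | zero => exact ⟨0, by simp⟩
    | succ k ih =>
      obtain ⟨n, hn⟩ := ih
      obtain ⟨i, hi, h1⟩ := h.gap_large n
      refine ⟨i + 1, ?_⟩
      rw [Finset.sum_range_succ]
      have := Finset.sum_le_sum_of_subset_of_nonneg (f := fun j => (s j).1)
        (Finset.range_subset_range.2 hi) fun j _ _ => (h.gap_pos j).le
      push_cast
      linarith
  obtain ⟨k, hk⟩ := exists_nat_ge c
  obtain ⟨n, hn⟩ := key k
  refine ⟨n, hk.trans (hn.trans ?_)⟩
  rw [Finset.sum_range_succ]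
  linarith [h.gap_pos n]

lemma GoodStream.exists_tickRace_ne_top {s : Stream M} (h : GoodStream s) {dl : EReal}
    {B : Finset (Fin M)} (hB : dl ≠ ⊤ ∨ B.Nonempty) (t : ℝ) :
    ∃ n, (tickRace dl B n t s).1.1.1 ≠ ⊤ := by
  obtain hdl | ⟨m, hm⟩ := hB
  · obtain ⟨n, hn⟩ := h.exists_sum_ge (dl.toReal - t)
    refine ⟨n + 1, tickRace_ne_top_of_le ((EReal.le_coe_toReal hdl).trans ?_)⟩
    exact EReal.coe_le_coe_iff.2 (by linarith)
  · obtain ⟨i, -, hi⟩ := h.mark m 0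
    exact ⟨i + 1, tickRace_ne_top_of_mark (by rwa [hi])⟩

/-- The probability that `n` consecutive terms miss `A` is the `n`-th power of a number below one.
-/
lemma iid_ae_exists_mem {α : Type*} [MeasurableSpace α] (m : Measure α) [IsProbabilityMeasure m]
    {A : Set α} (hA : MeasurableSet A) (h0 : m A ≠ 0) (k : ℕ) :
    ∀ᵐ s ∂iid ℕ m, ∃ i ≥ k, s i ∈ A := by
  have hlt : m Aᶜ < 1 := by
    refine lt_of_le_of_ne prob_le_one fun h => h0 ?_
    rwa [prob_compl_eq_one_iff hA] at h
  have hle : ∀ n : ℕ, iid ℕ m {s | ¬ ∃ i ≥ k, s i ∈ A} ≤ m Aᶜ ^ n := fun n => by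
    have hb := iid_box m (Finset.Ico k (k + n)) (fun _ => Aᶜ) fun _ => hA.compl
    rw [Finset.prod_const, Nat.card_Ico, Nat.add_sub_cancel_left] at hb
    rw [← hb]
    refine measure_mono fun s hs i hi => ?_
    exact fun h => hs ⟨i, (Finset.mem_Ico.1 hi).1, h⟩
  rw [ae_iff]
  exact le_antisymm (ge_of_tendsto' (ENNReal.tendsto_pow_atTop_nhds_zero_of_lt_one hlt) hle) bot_le

lemma decided_mono {dl : EReal} {B : Finset (Fin M)} {t : ℝ} {F : Outcome M × Stream M → ℝ≥0∞} :
    Monotone fun n r => decided dl B n t F r := by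
  refine monotone_nat_of_le_succ fun n r => ?_
  by_cases h : (tickRace dl B n t r).1.1.1 = ⊤
  · have h0 : r ∉ {r | (tickRace dl B n t r).1.1.1 ≠ ⊤} := by simpa using h
    simp only [decided, Set.indicator_of_notMem h0]
    exact bot_le
  · have h' : (tickRace dl B (n + 1) t r).1.1.1 ≠ ⊤ := by rwa [tickRace_succ_of_ne_top h]
    simp only [decided]
    rw [Set.indicator_of_mem (show r ∈ {r | (tickRace dl B n t r).1.1.1 ≠ ⊤} from h),
      Set.indicator_of_mem (show r ∈ {r | (tickRace dl B (n + 1) t r).1.1.1 ≠ ⊤} from h'),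
      tickRace_succ_of_ne_top h]

variable {μ : ℝ} {β : Measure Bool} [NeZero M] [IsProbabilityMeasure β]

/-- Induction on the number of ticks, with `raceMean_renewal` as the induction step. There is only
an inequality because the races that are still undecided after `n` ticks are left out. -/
lemma lintegral_decided_le (hμ : 0 < μ) (dl : EReal) (B : Finset (Fin M)) (n : ℕ) {t : ℝ}
    (hdl : (t : EReal) ≤ dl) {F : Outcome M × Stream M → ℝ≥0∞} (hF : Measurable F) :
    ∫⁻ r, decided dl B n t F r ∂streamLaw M μ β ≤
      raceMean μ β t dl B fun o => ∫⁻ s, F (o, s) ∂streamLaw M μ β := by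
  have := isProbabilityMeasure_tickLaw (M := M) hμ β
  set f : Outcome M → ℝ≥0∞ := fun o => ∫⁻ s, F (o, s) ∂streamLaw M μ β with hf
  have hfm : Measurable f := hF.lintegral_prod_right'
  induction n generalizing t with
  | zero => simp [decided, tickRace]
  | succ n ih =>
    set W : ℝ → ℝ≥0∞ := fun v => ∫⁻ s, decided dl B n v F s ∂streamLaw M μ β with hW
    have hWm : Measurable W := (measurable_decided dl B n hF).lintegral_prod_right'
    have hdec : Measurable fun r => decided dl B (n + 1) t F r :=
      (measurable_decided dl B (n + 1) hF).comp (f := fun r : Stream M => (t, r)) (by fun_prop)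
    have hsome : Measurable fun x : Tick M => some x.2 :=
      (Measurable.of_discrete (f := fun b : Fin M × Bool => some b)).comp measurable_snd
    have hmem : MeasurableSet {x : Tick M | x.2.1 ∈ B} :=
      measurable_snd.fst (MeasurableSet.of_discrete (s := {m | m ∈ B}))
    have hbm : MeasurableSet {x : Tick M | ((t + x.1 : ℝ) : EReal) < dl} :=
      measurableSet_lt (by fun_prop) (by fun_prop)
    have hA : Measurable fun x : Tick M => {x : Tick M | dl ≤ ((t + x.1 : ℝ) : EReal)}.indicator
        (fun x => ∫⁻ s, F ((dl, none), cons (t + x.1 - dl.toReal, x.2) s) ∂streamLaw M μ β) x := by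
      refine Measurable.indicator ?_ (measurableSet_le (by fun_prop) (by fun_prop))
      exact Measurable.lintegral_prod_right' (f := fun p : Tick M × Stream M =>
        F ((dl, none), cons (t + p.1.1 - dl.toReal, p.1.2) p.2)) (hF.comp (by fun_prop))
    have hψ : Measurable fun v : ℝ => (M : ℝ≥0∞)⁻¹ *
        ((∑ m ∈ B, ∫⁻ b, f ((v : EReal), some (m, b)) ∂β) + (M - B.card : ℕ) * W v) :=
      ((measurable_endings B hfm).add (hWm.const_mul _)).const_mul _
    have hlater : Measurable fun x : Tick M => if x.2.1 ∈ B then f (((t + x.1 : ℝ) : EReal), some x.2)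
        else W (t + x.1) :=
      Measurable.ite hmem (hfm.comp (by fun_prop)) (hWm.comp (by fun_prop))
    calc ∫⁻ r, decided dl B (n + 1) t F r ∂streamLaw M μ β
        = ∫⁻ x, ({x : Tick M | dl ≤ ((t + x.1 : ℝ) : EReal)}.indicator
            (fun x => ∫⁻ s, F ((dl, none), cons (t + x.1 - dl.toReal, x.2) s) ∂streamLaw M μ β) x +
          {x : Tick M | ((t + x.1 : ℝ) : EReal) < dl}.indicator (fun x =>
            if x.2.1 ∈ B then f (((t + x.1 : ℝ) : EReal), some x.2) else W (t + x.1)) x)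
            ∂tickLaw M μ β := by
          rw [lintegral_iid_cons _ hdec]
          refine lintegral_congr fun x => ?_
          simp only [decided_succ]
          by_cases h1 : dl ≤ ((t + x.1 : ℝ) : EReal)
          · have h3 : x ∉ {x : Tick M | ((t + x.1 : ℝ) : EReal) < dl} := not_lt.2 h1
            have h4 : x ∈ {x : Tick M | dl ≤ ((t + x.1 : ℝ) : EReal)} := h1
            simp only [Set.indicator_of_notMem h3, Set.indicator_of_mem h4, add_zero]
          · have h3 : x ∈ {x : Tick M | ((t + x.1 : ℝ) : EReal) < dl} := not_le.1 h1
            have h4 : x ∉ {x : Tick M | dl ≤ ((t + x.1 : ℝ) : EReal)} := h1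
            simp only [Set.indicator_of_notMem h4, Set.indicator_of_mem h3, zero_add]
            split_ifs <;> rfl
      _ = (if dl = ⊤ then 0 else ENNReal.ofReal (Real.exp (-(M * μ * (dl.toReal - t))))) * f (dl, none) +
          (∫⁻ v in Set.Ioi t, ENNReal.ofReal (M * μ * Real.exp (-(M * μ * (v - t)))) *
            {w : ℝ | (w : EReal) < dl}.indicator (fun v => (M : ℝ≥0∞)⁻¹ *
              ((∑ m ∈ B, ∫⁻ b, f ((v : EReal), some (m, b)) ∂β) + (M - B.card : ℕ) * W v)) v) := by
          rw [lintegral_add_left hA]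
          congr 1
          · by_cases htop : dl = ⊤
            · subst htop
              simp [-EReal.coe_add]
            · lift dl to ℝ using ⟨htop, fun h => by simp [h] at hdl⟩
              rw [if_neg htop]
              have hdl' : t ≤ dl := EReal.coe_le_coe_iff.1 hdl
              have hc : Measurable fun x : Tick M => ∫⁻ s, F (((dl : EReal), none), cons x s) ∂streamLaw M μ β :=
                Measurable.lintegral_prod_right' (f := fun p : Tick M × Stream M =>
                  F (((dl : EReal), none), cons p.1 p.2)) (hF.comp (by fun_prop))
              -- The overshoot of the first tick beyond the deadline is again exponential, so
              -- together with the later ticks it forms a fresh stream.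
              have h1 := lintegral_deadline (β := β) hμ hdl' hc
              rw [EReal.toReal_coe, h1, hf]
              simp only
              rw [lintegral_iid_cons (tickLaw M μ β) (f := fun s => F (((dl : EReal), none), s))
                (hF.comp (by fun_prop))]
          · rw [← lintegral_tick_before t dl hψ, lintegral_tickLaw hμ (hlater.indicator hbm)]
            refine lintegral_congr fun g => ?_
            by_cases h1 : ((t + g : ℝ) : EReal) < dl
            · have h2 : ∀ y : Fin M × Bool, (g, y) ∈ {x : Tick M | ((t + x.1 : ℝ) : EReal) < dl} :=
                fun _ => h1
              rw [Set.indicator_of_mem (show g ∈ {g : ℝ | ((t + g : ℝ) : EReal) < dl} from h1)]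
              simp only [Set.indicator_of_mem (h2 _)]
              congr 1
              rw [← Finset.sum_add_sum_compl B]
              congr 1
              · exact Finset.sum_congr rfl fun m hm => by simp only [hm, if_true]
              · rw [Finset.sum_congr rfl fun m hm => by
                  rw [lintegral_congr fun b => if_neg (Finset.mem_compl.1 hm), lintegral_const, measure_univ, mul_one]]
                rw [Finset.sum_const, Finset.card_compl, Fintype.card_fin, nsmul_eq_mul]
            · have h2 : ∀ y : Fin M × Bool, (g, y) ∉ {x : Tick M | ((t + x.1 : ℝ) : EReal) < dl} :=
                fun _ => h1
              rw [Set.indicator_of_notMem (show g ∉ {g : ℝ | ((t + g : ℝ) : EReal) < dl} from h1)]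
              simp only [Set.indicator_of_notMem (h2 _)]
              simp
      _ ≤ raceMean μ β t dl B f := by
          refine le_trans (add_le_add le_rfl (lintegral_mono fun v => ?_))
            (raceMean_renewal (β := β) hμ hdl B hfm)
          by_cases hv : (v : EReal) < dl
          · simp only [Set.indicator_of_mem (show v ∈ {w : ℝ | (w : EReal) < dl} from hv)]
            gcongr
            exact ih hv.le
          · simp only [Set.indicator_of_notMem (show v ∉ {w : ℝ | (w : EReal) < dl} from hv)]
            exact le_rfl

lemma ae_goodStream (hμ : 0 < μ) : ∀ᵐ s ∂streamLaw M μ β, GoodStream s := by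
  have := isProbabilityMeasure_tickLaw (M := M) hμ β
  have hr := tickRate_pos (M := M) hμ
  have := isProbabilityMeasure_expMeasure hr
  have h1 : ∀ᵐ s ∂streamLaw M μ β, ∀ i, 0 < (s i).1 := by
    refine ae_all_iff.2 fun i => ?_
    have hp : ∀ᵐ x ∂tickLaw M μ β, 0 < x.1 :=
      Measure.quasiMeasurePreserving_fst.ae (expMeasure_pos hr)
    have he := (measurePreserving_eval_infinitePi (fun _ : ℕ => tickLaw M μ β) i)
    exact he.quasiMeasurePreserving.ae hp
  have h2 : ∀ᵐ s ∂streamLaw M μ β, ∀ k : ℕ, ∃ i ≥ k, 1 ≤ (s i).1 := by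
    refine ae_all_iff.2 fun k => ?_
    refine iid_ae_exists_mem (tickLaw M μ β) (A := {x | 1 ≤ x.1})
      (measurableSet_le measurable_const measurable_fst) ?_ k
    have he : {x : Tick M | 1 ≤ x.1} = Set.Ici 1 ×ˢ Set.univ := by ext x; simp
    rw [he, tickLaw, Measure.prod_prod, measure_univ, mul_one]
    refine ne_of_gt (lt_of_lt_of_le ?_ (measure_mono (Set.Ioi_subset_Ici_self)))
    rw [expMeasure_Ioi hr zero_le_one]
    exact ENNReal.ofReal_pos.2 (Real.exp_pos _)
  have h3 : ∀ᵐ s ∂streamLaw M μ β, ∀ m : Fin M, ∀ k : ℕ, ∃ i ≥ k, (s i).2.1 = m := by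
    refine ae_all_iff.2 fun m => ae_all_iff.2 fun k => ?_
    refine iid_ae_exists_mem (tickLaw M μ β) (A := {x | x.2.1 = m})
      (measurable_snd.fst (measurableSet_singleton m)) ?_ k
    have he : {x : Tick M | x.2.1 = m} = Set.univ ×ˢ ({m} ×ˢ Set.univ) := by ext x; simp
    rw [he, tickLaw, Measure.prod_prod, Measure.prod_prod, measure_univ, measure_univ, mul_one, one_mul,
      serverLaw, Measure.smul_apply, Measure.count_singleton, smul_eq_mul, mul_one]
    simp
  filter_upwards [h1, h2, h3] with s a b c using ⟨a, b, c⟩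

/-- A race driven by ticks has the outcome law of a race of independent clocks, and the remaining
ticks are fresh and independent of the outcome. Monotone convergence in `lintegral_decided_le`
bounds one probability measure by another, which forces equality. An empty race without deadline is
never decided and is treated separately. -/
lemma map_streamRace (hμ : 0 < μ) {t : ℝ} {dl : EReal} (hdl : (t : EReal) ≤ dl)
    (B : Finset (Fin M)) :
    (streamLaw M μ β).map (fun r => (streamRace t dl B r).1) =
      (raceLaw μ β t dl B).prod (streamLaw M μ β) := by
  have := isProbabilityMeasure_tickLaw (M := M) hμ β
  have := isProbabilityMeasure_raceLaw (β := β) hμ t dl B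
  have hm : Measurable fun r : Stream M => (streamRace t dl B r).1 := (measurable_streamRace' t dl B).fst
  have hp : IsProbabilityMeasure ((streamLaw M μ β).map fun r => (streamRace t dl B r).1) :=
    Measure.isProbabilityMeasure_map hm.aemeasurable
  by_cases hB : dl ≠ ⊤ ∨ B.Nonempty
  · refine Measure.eq_of_le_of_isProbabilityMeasure (Measure.le_iff.2 fun A hA => ?_)
    have hF : Measurable (A.indicator (1 : Outcome M × Stream M → ℝ≥0∞)) := measurable_one.indicator hA
    have hdm : ∀ n, Measurable fun r => decided dl B n t (A.indicator 1) r := fun n =>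
      (measurable_decided dl B n hF).comp (f := fun r : Stream M => (t, r)) (by fun_prop)
    rw [← lintegral_indicator_one hA, lintegral_map hF hm, ← lintegral_indicator_one hA,
      lintegral_prod _ hF.aemeasurable, lintegral_raceLaw hμ hdl B hF.lintegral_prod_right']
    calc ∫⁻ r, A.indicator 1 (streamRace t dl B r).1 ∂streamLaw M μ β
        ≤ ∫⁻ r, ⨆ n, decided dl B n t (A.indicator 1) r ∂streamLaw M μ β := by
          refine lintegral_mono_ae ((ae_goodStream hμ).mono fun r hr => ?_)
          obtain ⟨n, hn⟩ := hr.exists_tickRace_ne_top hB t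
          refine le_iSup_of_le n ?_
          rw [decided, Set.indicator_of_mem (show r ∈ {r | (tickRace dl B n t r).1.1.1 ≠ ⊤} from hn),
            streamRace_of_ne_top hn]
      _ = ⨆ n, ∫⁻ r, decided dl B n t (A.indicator 1) r ∂streamLaw M μ β :=
          lintegral_iSup hdm decided_mono
      _ ≤ _ := iSup_le fun n => lintegral_decided_le hμ dl B n hdl hF
  · push Not at hB
    obtain ⟨rfl, rfl⟩ := hB
    have h1 : ∀ r : Stream M, (streamRace t ⊤ ∅ r).1 = ((⊤, none), r) := fun r => by
      rw [streamRace_of_eq_top fun n => tickRace_top_empty n t r]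
    have h2 : raceLaw μ β t ⊤ (∅ : Finset (Fin M)) = Measure.dirac (⊤, none) := by
      have := isProbabilityMeasure_expMeasure hμ
      rw [raceLaw]
      have : (fun p : (Fin M → ℝ) × (Fin M → Bool) => raceEnd t ⊤ (∅ : Finset (Fin M)) p.1 p.2) =
          fun _ => (⊤, none) := funext fun p => raceEnd_of_not_wins fun m h => by simpa using h.1
      rw [this, Measure.map_const, measure_univ, one_smul]
    simp_rw [h1, h2]
    rw [Measure.dirac_prod]

end Law


/-! ## Measurability of observations -/

section Observations

variable {N M : ℕ} {α : Type*} [MeasurableSpace α]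

instance instDiscreteSlot (N : ℕ) : DiscreteMeasurableSpace (Slot N) := ⟨fun _ => trivial⟩

instance instCountableSlot (N : ℕ) : Countable (Slot N) := inferInstanceAs (Countable (Option (Fin N × ℕ)))

lemma measurable_toProd : Measurable (Obs.toProd : Obs N M → _) := comap_measurable _

lemma measurable_obs_mk {f : α → Obs N M} (h : Measurable fun x => (f x).toProd) : Measurable f :=
  measurable_comap_iff.2 h

lemma Obs.measurable_time : Measurable (Obs.time : Obs N M → _) := measurable_toProd.fst

lemma Obs.measurable_del : Measurable (Obs.del : Obs N M → _) := measurable_toProd.snd.snd.snd.fst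

lemma Obs.measurable_inService : Measurable (Obs.inService : Obs N M → _) :=
  measurable_toProd.snd.snd.snd.snd.fst

lemma Measurable.observe {I : α → Arrivals N} {T : α → EReal} {del : α → Fin N → ℕ → EReal}
    {s f : α → Fin M → Slot N} (hI : Measurable I) (hT : Measurable T) (hdel : Measurable del)
    (hs : Measurable s) (hf : Measurable f) :
    Measurable fun x => observe (I x) (T x) (del x) (s x) (f x) := by
  have hA : ∀ n i, MeasurableSet {x | ((I x).2 n i : EReal) ≤ T x} := fun n i =>
    measurableSet_le (by fun_prop) hT
  refine measurable_obs_mk (hT.prodMk (Measurable.prodMk ?_ (Measurable.prodMk ?_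
    (hdel.prodMk (hs.prodMk hf)))))
  · refine measurable_pi_lambda _ fun n => measurable_pi_lambda _ fun i => ?_
    exact Measurable.ite (hA n i) (by fun_prop) measurable_const
  · refine measurable_pi_lambda _ fun n => measurable_pi_lambda _ fun i => ?_
    exact Measurable.ite (hA n i) (by fun_prop) measurable_const

lemma Measurable.nextArrival {I : α → Arrivals N} {T : α → EReal} (hI : Measurable I)
    (hT : Measurable T) : Measurable fun x => nextArrival (I x) (T x) := by
  refine Measurable.iInf fun n => Measurable.iInf fun i => ?_
  exact Measurable.ite (measurableSet_lt hT (by fun_prop)) (by fun_prop) measurable_const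

lemma le_nextArrival (I : Arrivals N) (T : EReal) : T ≤ nextArrival I T := by
  refine le_iInf fun n => le_iInf fun i => ?_
  split_ifs with h
  exacts [h.le, le_top]

/-- The observation which stands for a decision epoch that never comes. -/
noncomputable def Obs.never : Obs N M where
  time := ⊤
  gen _ _ := ⊤
  arr _ _ := ⊤
  del _ _ := ⊤
  inService _ := none
  failed _ := none

open Classical in
/-- Observations at an infinite time carry no information. -/
noncomputable def Obs.trunc (o : Obs N M) : Obs N M := if o.time = ⊤ then Obs.never else o

lemma Obs.measurable_trunc : Measurable (Obs.trunc : Obs N M → _) :=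
  Measurable.ite (Obs.measurable_time (measurableSet_singleton ⊤)) measurable_const measurable_id

/-- Nothing has arrived in `Obs.never`, so all servers must be idle; this makes infinite time
absorbing, independently of the policy. -/
lemma Obs.Feasible.eq_none_of_never {a : Fin M → Slot N} (h : (Obs.never : Obs N M).Feasible a)
    (m : Fin M) : a m = none := by
  cases ham : a m with
  | none => rfl
  | some p => exact absurd rfl (h.1 m p.1 p.2 ham).1

open Classical in
/-- The observation after a period with observation `o` at its beginning, assignment `a`, and
outcome `r`. -/
noncomputable def nextObs (I : Arrivals N) (o : Obs N M) (a : Fin M → Slot N) (r : Outcome M) :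
    Obs N M :=
  if r.1 = ⊤ then Obs.never else observe I r.1
    (fun n i => if ∃ m, r.2 = some (m, false) ∧ a m = some (n, i) then r.1 else o.del n i)
    (fun m => if ∃ e, r.2 = some (m, e) then none else a m)
    (fun m => if r.2 = some (m, true) then a m else none)

lemma Measurable.nextObs {I : α → Arrivals N} {o : α → Obs N M} {a : α → Fin M → Slot N}
    {r : α → Outcome M} (hI : Measurable I) (ho : Measurable o) (ha : Measurable a)
    (hr : Measurable r) : Measurable fun x => nextObs (I x) (o x) (a x) (r x) := by
  have hset : ∀ s : Set (Option (Fin M × Bool) × (Fin M → Slot N)),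
      MeasurableSet {x | ((r x).2, a x) ∈ s} := fun s =>
    (hr.snd.prodMk ha) (MeasurableSet.of_discrete (s := s))
  refine Measurable.ite (hr.fst (measurableSet_singleton ⊤)) measurable_const
    (Measurable.observe hI hr.fst ?_ ?_ ?_)
  · refine measurable_pi_lambda _ fun n => measurable_pi_lambda _ fun i => ?_
    exact Measurable.ite (hset {p | ∃ m, p.1 = some (m, false) ∧ p.2 m = some (n, i)}) hr.fst
      (measurable_pi_apply i |>.comp ((measurable_pi_apply n).comp (Obs.measurable_del.comp ho)))
  · refine measurable_pi_lambda _ fun m => ?_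
    exact Measurable.ite (hset {p | ∃ e, p.1 = some (m, e)}) measurable_const
      ((measurable_pi_apply m).comp ha)
  · refine measurable_pi_lambda _ fun m => ?_
    exact Measurable.ite (hset {p | p.1 = some (m, true)}) ((measurable_pi_apply m).comp ha)
      measurable_const

lemma nextObs_time (I : Arrivals N) (o : Obs N M) (a : Fin M → Slot N) (r : Outcome M) :
    (nextObs I o a r).time = r.1 := by
  rw [nextObs]; split_ifs with h
  exacts [h.symm, rfl]

end Observations

/-! ## One period -/

section Period

variable {N M k : ℕ} (π : Policy N M)

/-- The time at which a period ends if no transmission ends before. -/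
noncomputable def deadline (I : Arrivals N) (u : ℝ) (h : Fin (k + 1) → Obs N M) : EReal :=
  min ((h (Fin.last k)).time + π.wait k h u) (nextArrival I (h (Fin.last k)).time)

/-- The busy servers. -/
def busy (a : Fin M → Slot N) : Finset (Fin M) := Finset.univ.filter fun m => a m ≠ none

lemma mem_busy {a : Fin M → Slot N} {m : Fin M} : m ∈ busy a ↔ a m ≠ none := by simp [busy]

/-- This remains true at infinite time, where `toReal` is `0`, so the law of a race can be applied
at every epoch without distinguishing cases. -/
lemma coe_toReal_le_deadline (I : Arrivals N) (u : ℝ) {h : Fin (k + 1) → Obs N M}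
    (h0 : (h (Fin.last k)).time ≠ ⊥) :
    ((h (Fin.last k)).time.toReal : EReal) ≤ deadline π I u h := by
  refine (EReal.coe_toReal_le h0).trans (le_min ?_ (le_nextArrival _ _))
  conv_lhs => rw [← add_zero (h (Fin.last k)).time]
  gcongr
  exact (π.wait_pos k h u).le

variable {α : Type*} [MeasurableSpace α]

lemma measurable_busy : Measurable (busy : (Fin M → Slot N) → _) := Measurable.of_discrete

lemma measurable_assign' {h : α → Fin (k + 1) → Obs N M} {u : α → ℝ} (hh : Measurable h)
    (hu : Measurable u) : Measurable fun x => π.assign k (h x) (u x) :=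
  (π.measurable_assign k).comp (hh.prodMk hu)

lemma measurable_last_time {h : α → Fin (k + 1) → Obs N M} (hh : Measurable h) :
    Measurable fun x => (h x (Fin.last k)).time :=
  Obs.measurable_time.comp (g := Obs.time) (f := fun x => h x (Fin.last k))
    ((measurable_pi_apply (Fin.last k)).comp hh)

lemma measurable_deadline {I : α → Arrivals N} {u : α → ℝ} {h : α → Fin (k + 1) → Obs N M}
    (hI : Measurable I) (hu : Measurable u) (hh : Measurable h) :
    Measurable fun x => deadline π (I x) (u x) (h x) := by
  have ht := measurable_last_time hh
  exact (ht.add ((π.measurable_wait k).comp (hh.prodMk hu))).min (Measurable.nextArrival hI ht)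

lemma measurable_snoc {h : α → Fin (k + 1) → Obs N M} {o : α → Obs N M} (hh : Measurable h)
    (ho : Measurable o) :
    Measurable fun x => Fin.snoc (α := fun _ => Obs N M) (h x) (o x) := by
  refine measurable_pi_lambda _ fun j => ?_
  refine Fin.lastCases ?_ (fun i => ?_) j
  · simpa using ho
  · simp only [Fin.snoc_castSucc]; exact (measurable_pi_apply _).comp hh

/-- The history after the next period, if `r` is the outcome of that period. -/
noncomputable def extend (I : Arrivals N) (u : ℝ) (h : Fin (k + 1) → Obs N M) (r : Outcome M) :
    Fin (k + 1 + 1) → Obs N M :=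
  Fin.snoc (α := fun _ => Obs N M) h (nextObs I (h (Fin.last k)) (π.assign k h u) r)

lemma Measurable.extend {I : α → Arrivals N} {u : α → ℝ} {h : α → Fin (k + 1) → Obs N M}
    {r : α → Outcome M} (hI : Measurable I) (hu : Measurable u) (hh : Measurable h)
    (hr : Measurable r) : Measurable fun x => extend π (I x) (u x) (h x) (r x) :=
  measurable_snoc hh (Measurable.nextObs hI ((measurable_pi_apply _).comp hh)
    (measurable_assign' π hh hu) hr)

/-- The law of the outcome of the next period. -/
noncomputable def periodLaw (μ : ℝ) (β : Measure Bool) (I : Arrivals N) (u : ℝ)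
    (h : Fin (k + 1) → Obs N M) : Measure (Outcome M) :=
  raceLaw μ β (h (Fin.last k)).time.toReal (deadline π I u h) (busy (π.assign k h u))

end Period


/-! ## The system driven by a stream of ticks -/

section TickRun

variable {N M : ℕ}

lemma tickRace_ne_bot {dl : EReal} (hdl : dl ≠ ⊥) (B : Finset (Fin M)) (n : ℕ) (t : ℝ)
    (r : Stream M) : (tickRace dl B n t r).1.1.1 ≠ ⊥ := by
  induction n generalizing t r with
  | zero => exact top_ne_bot
  | succ n ih =>
    rw [tickRace_succ]
    split_ifs
    · exact hdl
    · exact EReal.coe_ne_bot _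
    · exact ih _ _

lemma streamRace_ne_bot {dl : EReal} (hdl : dl ≠ ⊥) (B : Finset (Fin M)) (t : ℝ)
    (r : Stream M) : (streamRace t dl B r).1.1.1 ≠ ⊥ := by
  by_cases h : ∃ n, (tickRace dl B n t r).1.1.1 ≠ ⊤
  · obtain ⟨n, hn⟩ := h
    rw [streamRace_of_ne_top hn]
    exact tickRace_ne_bot hdl B n t r
  · push Not at h
    rw [streamRace_of_eq_top h]
    exact top_ne_bot

/-- The observation at time `0`. -/
noncomputable def initObs (I : Arrivals N) : Obs N M :=
  observe I 0 (fun _ _ => ⊤) (fun _ => none) fun _ => none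

/-- The history at the `k`-th decision epoch in the system which is driven by a stream of ticks,
together with the ticks which remain and the number of ticks which have been used up. -/
noncomputable def tickRun (π : Policy N M) (I : Arrivals N) (u : ℝ) (s : Stream M) :
    (k : ℕ) → (Fin (k + 1) → Obs N M) × Stream M × ℕ
  | 0 => (fun _ => initObs I, s, 0)
  | k + 1 =>
    let h := (tickRun π I u s k).1
    let out := streamRace (h (Fin.last k)).time.toReal (deadline π I u h)
      (busy (π.assign k h u)) (tickRun π I u s k).2.1
    (extend π I u h out.1.1, out.1.2, (tickRun π I u s k).2.2 + out.2)

variable (π : Policy N M)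

lemma tickRun_time_ne_bot (I : Arrivals N) (u : ℝ) (s : Stream M) (k : ℕ) :
    ((tickRun π I u s k).1 (Fin.last k)).time ≠ ⊥ := by
  induction k with
  | zero => exact EReal.zero_ne_bot
  | succ k ih =>
    simp only [tickRun, extend, Fin.snoc_last, nextObs_time]
    refine streamRace_ne_bot (fun h => ?_) _ _ _
    have := coe_toReal_le_deadline π I u ih
    rw [h] at this
    exact absurd this (by simp)

lemma measurable_tickRun (k : ℕ) :
    Measurable fun p : (Arrivals N × ℝ) × Stream M => tickRun π p.1.1 p.1.2 p.2 k := by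
  induction k with
  | zero =>
    refine Measurable.prodMk ?_ (measurable_snd.prodMk measurable_const)
    exact measurable_pi_lambda _ fun _ => Measurable.observe (by fun_prop) measurable_const
      measurable_const measurable_const measurable_const
  | succ k ih =>
    have hh := ih.fst
    have ht : Measurable fun p : (Arrivals N × ℝ) × Stream M =>
        ((tickRun π p.1.1 p.1.2 p.2 k).1 (Fin.last k)).time.toReal :=
      (measurable_last_time hh).ereal_toReal
    have hI : Measurable fun p : (Arrivals N × ℝ) × Stream M => p.1.1 := by fun_prop
    have hu : Measurable fun p : (Arrivals N × ℝ) × Stream M => p.1.2 := by fun_prop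
    have hout := measurable_streamRace.comp (((ht.prodMk (measurable_deadline π hI hu hh)).prodMk
      (measurable_busy.comp (measurable_assign' π hh hu))).prodMk ih.snd.fst)
    exact (Measurable.extend π hI hu hh hout.fst.fst).prodMk
      (hout.fst.snd.prodMk (ih.snd.snd.add hout.snd))

variable {μ : ℝ} {β : Measure Bool} [NeZero M] [IsProbabilityMeasure β]

/-- By `hk` the race of the next period is driven by a fresh stream, and `map_streamRace` splits it
into an outcome and again a fresh stream. The independence at epoch `k` is a hypothesis because this
lemma is the step of the induction which proves it. -/
lemma lintegral_tickRun_succ (hμ : 0 < μ) (I : Arrivals N) (u : ℝ) (k : ℕ)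
    (hk : ∀ f : (Fin (k + 1) → Obs N M) × Stream M → ℝ≥0∞, Measurable f →
      ∫⁻ s, f ((tickRun π I u s k).1, (tickRun π I u s k).2.1) ∂streamLaw M μ β =
        ∫⁻ s, ∫⁻ r, f ((tickRun π I u s k).1, r) ∂streamLaw M μ β ∂streamLaw M μ β)
    {f : (Fin (k + 1 + 1) → Obs N M) × Stream M → ℝ≥0∞} (hf : Measurable f) :
    ∫⁻ s, f ((tickRun π I u s (k + 1)).1, (tickRun π I u s (k + 1)).2.1) ∂streamLaw M μ β =
      ∫⁻ s, ∫⁻ o, ∫⁻ r, f (extend π I u (tickRun π I u s k).1 o, r) ∂streamLaw M μ β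
        ∂periodLaw π μ β I u (tickRun π I u s k).1 ∂streamLaw M μ β := by
  have := isProbabilityMeasure_tickLaw (M := M) hμ β
  set Φ : (Fin (k + 1) → Obs N M) × Stream M → ℝ≥0∞ := fun p =>
    f (extend π I u p.1 (streamRace (p.1 (Fin.last k)).time.toReal (deadline π I u p.1)
      (busy (π.assign k p.1 u)) p.2).1.1, (streamRace (p.1 (Fin.last k)).time.toReal
      (deadline π I u p.1) (busy (π.assign k p.1 u)) p.2).1.2) with hΦ
  have hΦm : Measurable Φ := by
    have ht : Measurable fun p : (Fin (k + 1) → Obs N M) × Stream M =>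
        (p.1 (Fin.last k)).time.toReal :=
      (measurable_last_time measurable_fst).ereal_toReal
    have hI : Measurable fun _ : (Fin (k + 1) → Obs N M) × Stream M => I := measurable_const
    have hu : Measurable fun _ : (Fin (k + 1) → Obs N M) × Stream M => u := measurable_const
    have hout := measurable_streamRace.comp (((ht.prodMk (measurable_deadline π hI hu measurable_fst)).prodMk
      (measurable_busy.comp (measurable_assign' π measurable_fst hu))).prodMk measurable_snd)
    exact hf.comp ((Measurable.extend π hI hu measurable_fst hout.fst.fst).prodMk hout.fst.snd)
  refine (hk Φ hΦm).trans (lintegral_congr fun s => ?_)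
  have hle := coe_toReal_le_deadline π I u (tickRun_time_ne_bot π I u s k)
  set h := (tickRun π I u s k).1
  have hg : Measurable fun q : Outcome M × Stream M => f (extend π I u h q.1, q.2) :=
    hf.comp ((Measurable.extend π measurable_const measurable_const measurable_const
      measurable_fst).prodMk measurable_snd)
  have hmap := map_streamRace (β := β) hμ hle (busy (π.assign k h u))
  have hpr := isProbabilityMeasure_raceLaw (β := β) hμ (h (Fin.last k)).time.toReal
    (deadline π I u h) (busy (π.assign k h u))
  refine (lintegral_map hg (measurable_streamRace' (h (Fin.last k)).time.toReal
    (deadline π I u h) (busy (π.assign k h u))).fst).symm.trans ?_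
  rw [hmap, lintegral_prod _ hg.aemeasurable]
  rfl

/-- The ticks which remain are independent of the history. -/
lemma lintegral_tickRun_rest (hμ : 0 < μ) (I : Arrivals N) (u : ℝ) (k : ℕ)
    {f : (Fin (k + 1) → Obs N M) × Stream M → ℝ≥0∞} (hf : Measurable f) :
    ∫⁻ s, f ((tickRun π I u s k).1, (tickRun π I u s k).2.1) ∂streamLaw M μ β =
      ∫⁻ s, ∫⁻ r, f ((tickRun π I u s k).1, r) ∂streamLaw M μ β ∂streamLaw M μ β := by
  have := isProbabilityMeasure_tickLaw (M := M) hμ β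
  induction k with
  | zero => simp [tickRun]
  | succ k ih =>
    rw [lintegral_tickRun_succ π hμ I u k (fun f hf => ih hf) hf]
    have hf0 : Measurable fun p : (Fin (k + 1 + 1) → Obs N M) × Stream M =>
        ∫⁻ r, f (p.1, r) ∂streamLaw M μ β :=
      hf.lintegral_prod_right'.comp measurable_fst
    -- Applied to the average of `f` over the remaining ticks, the one-period formula has the same
    -- right side as for `f` itself.
    have := lintegral_tickRun_succ π hμ I u k (fun f hf => ih hf) hf0
    simp only [lintegral_const, measure_univ, mul_one] at this
    exact this.symm

lemma lintegral_tickRun (hμ : 0 < μ) (I : Arrivals N) (u : ℝ) (k : ℕ)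
    {f : (Fin (k + 1 + 1) → Obs N M) → ℝ≥0∞} (hf : Measurable f) :
    ∫⁻ s, f (tickRun π I u s (k + 1)).1 ∂streamLaw M μ β =
      ∫⁻ s, ∫⁻ o, f (extend π I u (tickRun π I u s k).1 o)
        ∂periodLaw π μ β I u (tickRun π I u s k).1 ∂streamLaw M μ β := by
  have := isProbabilityMeasure_tickLaw (M := M) hμ β
  have := lintegral_tickRun_succ (β := β) π hμ I u k
    (fun f hf => lintegral_tickRun_rest π hμ I u k hf) (f := fun p => f p.1) (hf.comp measurable_fst)
  simpa using this

end TickRun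


/-! ## The residual transmission times -/

section Residual

variable {N M k : ℕ}

open Classical in
/-- The time at which server `m` ends its transmission if the transmission needs the time `z m`
from time `t` on. -/
noncomputable def ringTime (a : Fin M → Slot N) (t : ℝ) (z : Fin M → ℝ) (m : Fin M) : EReal :=
  if a m = none then ⊤ else ((t + z m : ℝ) : EReal)

/-- The next decision epoch, if the transmissions need the times `z`. -/
noncomputable def endTime (dl : EReal) (a : Fin M → Slot N) (t : ℝ) (z : Fin M → ℝ) : EReal :=
  min dl (⨅ m, ringTime a t z m)

open Classical in
/-- The observation at the next decision epoch, if the transmissions need the times `z` and `e`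
indicates the errors. -/
noncomputable def endObs (I : Arrivals N) (o : Obs N M) (dl : EReal) (a : Fin M → Slot N) (t : ℝ)
    (z : Fin M → ℝ) (e : Fin M → Bool) : Obs N M :=
  observe I (endTime dl a t z)
    (fun n i => if ∃ m, a m = some (n, i) ∧ ringTime a t z m = endTime dl a t z ∧ e m = false
      then endTime dl a t z else o.del n i)
    (fun m => if ringTime a t z m = endTime dl a t z then none else a m)
    (fun m => if ringTime a t z m = endTime dl a t z ∧ e m = true then a m else none)

/-- In the absence of ties at most one transmission ends at the next epoch, and none ends exactly at
the deadline, so the observation is determined by the outcome of the race of the busy servers.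
Truncation removes what would be recorded at infinite time. -/
lemma trunc_endObs {I : Arrivals N} {o : Obs N M} {dl : EReal} {a : Fin M → Slot N} {t : ℝ}
    {z : Fin M → ℝ} {e : Fin M → Bool} (hz : ∀ i j, i ≠ j → z i ≠ z j)
    (hdl : ∀ m, ((t + z m : ℝ) : EReal) ≠ dl) :
    (endObs I o dl a t z e).trunc = nextObs I o a (raceEnd t dl (busy a) z e) := by
  have hring : ∀ m, m ∈ busy a → ringTime a t z m = ((t + z m : ℝ) : EReal) := fun m hm =>
    if_neg (mem_busy.1 hm)
  have hidle : ∀ m, m ∉ busy a → ringTime a t z m = ⊤ := fun m hm =>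
    if_pos (by simpa [mem_busy] using hm)
  by_cases hw : ∃ m, Wins t dl (busy a) z m
  · obtain ⟨w, hw⟩ := hw
    rw [raceEnd_of_wins hw]
    have hT : endTime dl a t z = ((t + z w : ℝ) : EReal) := by
      refine le_antisymm ((min_le_right _ _).trans ((iInf_le _ w).trans (hring w hw.1).le))
        (le_min hw.2.1.le (le_iInf fun m => ?_))
      by_cases hm : m ∈ busy a
      · rw [hring m hm, EReal.coe_le_coe_iff]
        by_cases hmw : m = w
        · rw [hmw]
        · linarith [hw.2.2 m hm hmw]
      · rw [hidle m hm]; exact le_top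
    have hiff : ∀ m, ringTime a t z m = endTime dl a t z ↔ m = w := fun m => by
      rw [hT]
      by_cases hm : m ∈ busy a
      · rw [hring m hm, EReal.coe_eq_coe_iff]
        refine ⟨fun h => ?_, fun h => by rw [h]⟩
        by_contra hmw
        exact hz m w hmw (by linarith)
      · rw [hidle m hm]
        exact ⟨fun h => absurd h.symm (EReal.coe_ne_top _), fun h => absurd (h ▸ hw.1) hm⟩
    have htop : (endObs I o dl a t z e).time ≠ ⊤ := by
      simp only [endObs, observe, hT]; exact EReal.coe_ne_top _
    rw [Obs.trunc, if_neg htop, nextObs, if_neg (EReal.coe_ne_top _), endObs]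
    simp only [hiff]
    rw [hT]
    congr 1
    · funext n i
      congr 1
      simp only [Option.some.injEq, Prod.mk.injEq, eq_iff_iff]
      constructor
      · rintro ⟨m, h1, rfl, h3⟩; exact ⟨m, ⟨rfl, h3⟩, h1⟩
      · rintro ⟨m, ⟨rfl, h3⟩, h1⟩; exact ⟨w, h1, rfl, h3⟩
    · funext m
      congr 1
      simp [eq_comm]
    · funext m
      congr 1
      simp only [Option.some.injEq, Prod.mk.injEq, eq_iff_iff]
      constructor
      · rintro ⟨rfl, h⟩; exact ⟨rfl, h⟩
      · rintro ⟨rfl, h⟩; exact ⟨rfl, h⟩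
  · push Not at hw
    rw [raceEnd_of_not_wins hw]
    have hlt : ∀ m ∈ busy a, dl < ringTime a t z m := by
      by_contra! hcon
      obtain ⟨m, hm, hle⟩ := hcon
      obtain ⟨w, hwB, hmin⟩ := Finset.exists_min_image (busy a) z ⟨m, hm⟩
      refine hw w ⟨hwB, lt_of_le_of_ne ?_ (hdl w), fun j hj hjw =>
        lt_of_le_of_ne (hmin j hj) (hz w j (Ne.symm hjw))⟩
      refine le_trans ?_ hle
      rw [hring m hm, EReal.coe_le_coe_iff]
      linarith [hmin m hm]
    have hT : endTime dl a t z = dl := by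
      refine min_eq_left (le_iInf fun m => ?_)
      by_cases hm : m ∈ busy a
      · exact (hlt m hm).le
      · rw [hidle m hm]; exact le_top
    by_cases htop : dl = ⊤
    · rw [nextObs, if_pos htop, Obs.trunc, if_pos (show (endObs I o dl a t z e).time = ⊤ from hT.trans htop)]
    · have hne : ∀ m, ringTime a t z m ≠ endTime dl a t z := fun m => by
        rw [hT]
        by_cases hm : m ∈ busy a
        · exact (hlt m hm).ne'
        · rw [hidle m hm]; exact Ne.symm htop
      have htop' : (endObs I o dl a t z e).time ≠ ⊤ := by
        simp only [endObs, observe, hT]; exact htop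
      rw [Obs.trunc, if_neg htop', nextObs, if_neg htop, endObs]
      simp only [hne, false_and, and_false, if_false, exists_false]
      rw [hT]
      simp

variable (π : Policy N M)

/-- The history at the next decision epoch, if the transmissions need the times `z` and `e`
indicates the errors. -/
noncomputable def endExtend (I : Arrivals N) (u : ℝ) (h : Fin (k + 1) → Obs N M)
    (z : Fin M → ℝ) (e : Fin M → Bool) : Fin (k + 1 + 1) → Obs N M :=
  Fin.snoc (α := fun _ => Obs N M) h (endObs I (h (Fin.last k)) (deadline π I u h)
    (π.assign k h u) (h (Fin.last k)).time.toReal z e).trunc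

lemma endExtend_eq {I : Arrivals N} {u : ℝ} {h : Fin (k + 1) → Obs N M} {z : Fin M → ℝ}
    (e : Fin M → Bool) (hz : ∀ i j, i ≠ j → z i ≠ z j)
    (hdl : ∀ m, (((h (Fin.last k)).time.toReal + z m : ℝ) : EReal) ≠ deadline π I u h) :
    endExtend π I u h z e = extend π I u h (raceEnd (h (Fin.last k)).time.toReal (deadline π I u h)
      (busy (π.assign k h u)) z e) := by
  rw [endExtend, trunc_endObs hz hdl, extend]

/-- Server `m` continues its transmission. -/
def Continues (u : ℝ) (h : Fin (k + 1) → Obs N M) (m : Fin M) : Prop :=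
  (h (Fin.last k)).inService m ≠ none ∧ π.assign k h u m = (h (Fin.last k)).inService m

open Classical in
/-- The transmission times from the last epoch of `h` on: `y m` if server `m` continues its
transmission, and `x m` otherwise. -/
noncomputable def mixTimes (u : ℝ) (h : Fin (k + 1) → Obs N M) (y x : Fin M → ℝ) : Fin M → ℝ :=
  fun m => if Continues π u h m then y m else x m

variable {α : Type*} [MeasurableSpace α]

lemma measurable_ringTime {a : α → Fin M → Slot N} {t : α → ℝ} {z : α → Fin M → ℝ}
    (ha : Measurable a) (ht : Measurable t) (hz : Measurable z) (m : Fin M) :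
    Measurable fun x => ringTime (a x) (t x) (z x) m :=
  Measurable.ite (((measurable_pi_apply m).comp ha) (measurableSet_singleton none))
    measurable_const (by fun_prop)

lemma measurable_endTime {dl : α → EReal} {a : α → Fin M → Slot N} {t : α → ℝ} {z : α → Fin M → ℝ}
    (hdl : Measurable dl) (ha : Measurable a) (ht : Measurable t) (hz : Measurable z) :
    Measurable fun x => endTime (dl x) (a x) (t x) (z x) :=
  hdl.min (Measurable.iInf fun m => measurable_ringTime ha ht hz m)

lemma measurable_endObs {I : α → Arrivals N} {o : α → Obs N M} {dl : α → EReal}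
    {a : α → Fin M → Slot N} {t : α → ℝ} {z : α → Fin M → ℝ} {e : α → Fin M → Bool}
    (hI : Measurable I) (ho : Measurable o)
    (hdl : Measurable dl) (ha : Measurable a) (ht : Measurable t) (hz : Measurable z)
    (he : Measurable e) : Measurable fun x => endObs (I x) (o x) (dl x) (a x) (t x) (z x) (e x) := by
  have hT := measurable_endTime hdl ha ht hz
  have hring : ∀ m, MeasurableSet {x | ringTime (a x) (t x) (z x) m =
      endTime (dl x) (a x) (t x) (z x)} := fun m =>
    measurableSet_eq_fun (measurable_ringTime ha ht hz m) hT
  have hem : ∀ m b, MeasurableSet {x | e x m = b} := fun m b =>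
    ((measurable_pi_apply m).comp he) (measurableSet_singleton b)
  have ham : ∀ m s, MeasurableSet {x | a x m = s} := fun m s =>
    ((measurable_pi_apply m).comp ha) (measurableSet_singleton s)
  refine Measurable.observe hI hT ?_ ?_ ?_
  · refine measurable_pi_lambda _ fun n => measurable_pi_lambda _ fun i => Measurable.ite ?_ hT
      ((measurable_pi_apply i).comp ((measurable_pi_apply n).comp (Obs.measurable_del.comp ho)))
    have : {x | ∃ m, a x m = some (n, i) ∧ ringTime (a x) (t x) (z x) m =
        endTime (dl x) (a x) (t x) (z x) ∧ e x m = false} = ⋃ m, {x | a x m = some (n, i)} ∩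
        ({x | ringTime (a x) (t x) (z x) m = endTime (dl x) (a x) (t x) (z x)} ∩
          {x | e x m = false}) := by
      ext x; simp
    rw [this]
    exact MeasurableSet.iUnion fun m => (ham m _).inter ((hring m).inter (hem m _))
  · exact measurable_pi_lambda _ fun m => Measurable.ite (hring m) measurable_const
      ((measurable_pi_apply m).comp ha)
  · exact measurable_pi_lambda _ fun m => Measurable.ite ((hring m).inter (hem m true))
      ((measurable_pi_apply m).comp ha) measurable_const

lemma Measurable.endExtend {I : α → Arrivals N} {u : α → ℝ} {h : α → Fin (k + 1) → Obs N M}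
    {z : α → Fin M → ℝ} {e : α → Fin M → Bool} (hI : Measurable I) (hu : Measurable u)
    (hh : Measurable h) (hz : Measurable z) (he : Measurable e) :
    Measurable fun x => endExtend π (I x) (u x) (h x) (z x) (e x) :=
  measurable_snoc hh (Obs.measurable_trunc.comp (measurable_endObs hI
    ((measurable_pi_apply _).comp hh) (measurable_deadline π hI hu hh) (measurable_assign' π hh hu)
    (measurable_last_time hh).ereal_toReal hz he))

lemma Measurable.mixTimes {u : α → ℝ} {h : α → Fin (k + 1) → Obs N M}
    {y x : α → Fin M → ℝ} (hu : Measurable u) (hh : Measurable h) (hy : Measurable y)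
    (hx : Measurable x) : Measurable fun p => mixTimes π (u p) (h p) (y p) (x p) := by
  refine measurable_pi_lambda _ fun m => Measurable.ite ?_ (by fun_prop) (by fun_prop)
  have hs : Measurable fun p => (h p (Fin.last k)).inService m :=
    (measurable_pi_apply m).comp (Obs.measurable_inService.comp ((measurable_pi_apply _).comp hh))
  have ha : Measurable fun p => π.assign k (h p) (u p) m :=
    (measurable_pi_apply m).comp (measurable_assign' π hh hu)
  exact (hs (measurableSet_singleton none)).compl.inter (measurableSet_eq_fun ha hs)

end Residual


/-! ### The law of one period of the original system. -/

section ResidualLaw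

/-- All rows from the `k`-th on are replaced by an independent copy; `F` does not notice this in its
first argument, and its second argument becomes an independent row. -/
lemma lintegral_iid_row {α : Type*} [MeasurableSpace α] (m : Measure α) [IsProbabilityMeasure m]
    {M : ℕ} (k : ℕ) {F : (ℕ × Fin M → α) → (Fin M → α) → ℝ≥0∞}
    (hF : Measurable fun p : (ℕ × Fin M → α) × (Fin M → α) => F p.1 p.2)
    (hpast : ∀ x x' y, (∀ p : ℕ × Fin M, p.1 < k → x p = x' p) → F x y = F x' y) :
    ∫⁻ x, F x (fun j => x (k, j)) ∂iid (ℕ × Fin M) m =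
      ∫⁻ x, ∫⁻ y, F x y ∂iid (Fin M) m ∂iid (ℕ × Fin M) m := by
  classical
  have hrow : Measurable fun (x : ℕ × Fin M → α) (j : Fin M) => x (k, j) := by fun_prop
  rw [← lintegral_iid_piecewise m {p : ℕ × Fin M | p.1 < k}
    (f := fun x => F x fun j => x (k, j)) (hF.comp (measurable_id.prodMk hrow))]
  refine lintegral_congr fun x => ?_
  have hFx : Measurable fun y => F x y := hF.comp measurable_prodMk_left
  rw [← iid_map_injective m (e := fun j : Fin M => (k, j)) (fun i j h => (Prod.mk.inj h).2),
    lintegral_map hFx hrow]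
  refine lintegral_congr fun y => ?_
  rw [hpast _ x _ fun p hp =>
    Set.piecewise_eq_of_mem {p : ℕ × Fin M | p.1 < k} _ _ (show p ∈ {p : ℕ × Fin M | p.1 < k} from hp)]
  congr 1
  funext j
  exact Set.piecewise_eq_of_notMem {p : ℕ × Fin M | p.1 < k} _ _ (by simp)

variable {N M k : ℕ} (π : Policy N M) {μ : ℝ} {β : Measure Bool}

/-- The residual transmission times at the end of a period. -/
noncomputable def nextResid (u : ℝ) (t : ℝ) (h' : Fin (k + 1 + 1) → Obs N M) (z x : Fin M → ℝ) :
    Fin M → ℝ :=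
  mixTimes π u h' (fun m => z m - ((h' (Fin.last (k + 1))).time.toReal - t)) x

/-- A server can continue only if it was busy and its transmission did not end, and for such a
server both sides give the old time minus the length of the period. The times `x'` are never read,
hence are arbitrary. -/
lemma nextResid_extend (I : Arrivals N) (u : ℝ) (h : Fin (k + 1) → Obs N M) (z x x' : Fin M → ℝ)
    (t : ℝ) (r : Outcome M) :
    nextResid π u t (extend π I u h r) z x =
      mixTimes π u (extend π I u h r) (raceRest t (busy (π.assign k h u)) z x' r) x := by
  funext m
  simp only [nextResid, mixTimes]
  split_ifs with hm
  · have h1 := hm.1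
    simp only [extend, Fin.snoc_last, nextObs_time]
    simp only [extend, Fin.snoc_last, nextObs] at h1
    split_ifs at h1 with htop
    · exact absurd rfl h1
    · simp only [observe] at h1
      split_ifs at h1 with he
      · exact absurd rfl h1
      · rw [raceRest, if_pos ⟨mem_busy.2 h1, by simpa using he⟩]
  · rfl

/-- If the residual times at the beginning of a period are fresh, then so are those at its end,
independently of the outcome. Continuing servers have residuals from `lintegral_race_rest`, the
other servers draw new times, and the choice between the two depends only on the new history. -/
lemma lintegral_period [IsProbabilityMeasure β] (hμ : 0 < μ) (I : Arrivals N) (u : ℝ) {h : Fin (k + 1) → Obs N M}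
    (h0 : (h (Fin.last k)).time ≠ ⊥)
    {f : (Fin (k + 1 + 1) → Obs N M) × (Fin M → ℝ) → ℝ≥0∞} (hf : Measurable f) :
    ∫⁻ z, ∫⁻ x, ∫⁻ e, f (endExtend π I u h z e,
        nextResid π u (h (Fin.last k)).time.toReal (endExtend π I u h z e) z x) ∂iid (Fin M) β
        ∂iid (Fin M) (expMeasure μ) ∂iid (Fin M) (expMeasure μ) =
      ∫⁻ o, ∫⁻ y, f (extend π I u h o, y) ∂iid (Fin M) (expMeasure μ) ∂periodLaw π μ β I u h := by
  classical
  have := isProbabilityMeasure_expMeasure hμ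
  have hle := coe_toReal_le_deadline π I u h0
  set t := (h (Fin.last k)).time.toReal with ht
  set dl := deadline π I u h with hdl
  set B := busy (π.assign k h u) with hB
  set Q := iid (Fin M) (expMeasure μ) with hQ
  have hext : ∀ {α : Type} [MeasurableSpace α] {r : α → Outcome M}, Measurable r →
      Measurable fun x => extend π I u h (r x) := fun hr =>
    Measurable.extend π measurable_const measurable_const measurable_const hr
  have hmix : Measurable fun p : (Outcome M × (Fin M → ℝ)) × (Fin M → ℝ) =>
      f (extend π I u h p.1.1, mixTimes π u (extend π I u h p.1.1) p.1.2 p.2) :=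
    hf.comp ((hext (by fun_prop)).prodMk (Measurable.mixTimes π measurable_const
      (hext (by fun_prop)) (by fun_prop) (by fun_prop)))
  have hend : Measurable fun p : ((Fin M → ℝ) × (Fin M → ℝ)) × (Fin M → Bool) =>
      endExtend π I u h p.1.1 p.2 :=
    Measurable.endExtend π measurable_const measurable_const measurable_const (by fun_prop) (by fun_prop)
  have hres : Measurable fun p : ((Fin M → ℝ) × (Fin M → ℝ)) × (Fin M → Bool) =>
      f (endExtend π I u h p.1.1 p.2, nextResid π u t (endExtend π I u h p.1.1 p.2) p.1.1 p.1.2) := by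
    refine hf.comp (hend.prodMk (Measurable.mixTimes π measurable_const hend ?_ (by fun_prop)))
    have := (measurable_last_time hend).ereal_toReal
    fun_prop
  have hgen : ∀ᵐ z ∂Q, (∀ i j, i ≠ j → z i ≠ z j) ∧ ∀ m, ((t + z m : ℝ) : EReal) ≠ dl := by
    refine Filter.Eventually.and ?_ ?_
    · refine ae_all_iff.2 fun i => ae_all_iff.2 fun j => ?_
      by_cases hij : i = j
      · exact .of_forall fun z h => absurd hij h
      · exact (iid_exp_ne hμ hij).mono fun z h _ => h
    · refine ae_all_iff.2 fun m => iid_exp_ae hμ (p := fun a => ((t + a : ℝ) : EReal) ≠ dl) ?_ m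
      have hne : ∀ᵐ a ∂expMeasure μ, a ≠ dl.toReal - t := by simp [ae_iff, measure_singleton]
      refine hne.mono fun a ha h => ha ?_
      rw [← h, EReal.toReal_coe]; ring
  calc ∫⁻ z, ∫⁻ x, ∫⁻ e, f (endExtend π I u h z e, nextResid π u t (endExtend π I u h z e) z x)
        ∂iid (Fin M) β ∂Q ∂Q
      = ∫⁻ e, ∫⁻ z, ∫⁻ x, f (endExtend π I u h z e, nextResid π u t (endExtend π I u h z e) z x)
          ∂Q ∂Q ∂iid (Fin M) β := by
        have h1 : ∀ z, ∫⁻ x, ∫⁻ e, f (endExtend π I u h z e, nextResid π u t (endExtend π I u h z e) z x)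
            ∂iid (Fin M) β ∂Q = ∫⁻ e, ∫⁻ x, f (endExtend π I u h z e,
              nextResid π u t (endExtend π I u h z e) z x) ∂Q ∂iid (Fin M) β := fun z =>
          lintegral_lintegral_swap (hres.comp (f := fun p : (Fin M → ℝ) × (Fin M → Bool) =>
            ((z, p.1), p.2)) (by fun_prop)).aemeasurable
        simp_rw [h1]
        exact lintegral_lintegral_swap (Measurable.lintegral_prod_right'
          (f := fun p : ((Fin M → ℝ) × (Fin M → Bool)) × (Fin M → ℝ) =>
            f (endExtend π I u h p.1.1 p.1.2, nextResid π u t (endExtend π I u h p.1.1 p.1.2) p.1.1 p.2))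
          (hres.comp (f := fun p : ((Fin M → ℝ) × (Fin M → Bool)) × (Fin M → ℝ) =>
            ((p.1.1, p.2), p.1.2)) (by fun_prop))).aemeasurable
    _ = ∫⁻ e, ∫⁻ z, ∫⁻ x, f (extend π I u h (raceEnd t dl B z e),
          mixTimes π u (extend π I u h (raceEnd t dl B z e)) (raceRest t B z x
            (raceEnd t dl B z e)) x) ∂Q ∂Q ∂iid (Fin M) β := by
        refine lintegral_congr fun e => lintegral_congr_ae (hgen.mono fun z hz => ?_)
        refine lintegral_congr fun x => ?_
        rw [endExtend_eq π e hz.1 hz.2, ← nextResid_extend]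
    _ = ∫⁻ e, ∫⁻ z, ∫⁻ y, f (extend π I u h (raceEnd t dl B z e), y) ∂Q ∂Q ∂iid (Fin M) β := by
        refine lintegral_congr fun e => ?_
        have hF : Measurable fun p : Outcome M × (Fin M → ℝ) =>
            ∫⁻ x, f (extend π I u h p.1, mixTimes π u (extend π I u h p.1) p.2 x) ∂Q :=
          hmix.lintegral_prod_right'
        have hrest := lintegral_race_rest hμ hle B e (F := fun o y =>
          ∫⁻ x, f (extend π I u h o, mixTimes π u (extend π I u h o) y x) ∂Q) hF
        -- `mixTimes` does not read the times filled in for the servers that do not continue. The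
        -- same fresh `x'` may therefore serve in both places, and the integral over `x` is trivial.
        have h1 : ∀ z x : Fin M → ℝ, ∫⁻ x', f (extend π I u h (raceEnd t dl B z e),
            mixTimes π u (extend π I u h (raceEnd t dl B z e))
              (raceRest t B z x (raceEnd t dl B z e)) x') ∂Q =
            ∫⁻ x', f (extend π I u h (raceEnd t dl B z e),
            mixTimes π u (extend π I u h (raceEnd t dl B z e))
              (raceRest t B z x' (raceEnd t dl B z e)) x') ∂Q := fun z x =>
          lintegral_congr fun x' => by
            rw [← nextResid_extend, ← nextResid_extend]
        simp only [h1, lintegral_const, measure_univ, mul_one, ← hQ] at hrest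
        rw [hrest]
        refine lintegral_congr fun z => ?_
        -- Once the outcome is fixed, so is the set of continuing servers, and combining two
        -- independent families along a fixed set gives the same law.
        have := lintegral_iid_piecewise (expMeasure μ)
          {m | Continues π u (extend π I u h (raceEnd t dl B z e)) m}
          (f := fun y => f (extend π I u h (raceEnd t dl B z e), y)) (hf.comp measurable_prodMk_left)
        rw [← this]
        refine lintegral_congr fun y => lintegral_congr fun x => ?_
        congr 2
    _ = ∫⁻ o, ∫⁻ y, f (extend π I u h o, y) ∂Q ∂periodLaw π μ β I u h := by
        have hg : Measurable fun o => ∫⁻ y, f (extend π I u h o, y) ∂Q :=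
          Measurable.lintegral_prod_right' (f := fun p : Outcome M × (Fin M → ℝ) =>
            f (extend π I u h p.1, p.2)) (hf.comp ((hext measurable_fst).prodMk measurable_snd))
        rw [periodLaw, raceLaw, lintegral_map hg (measurable_raceEnd' t dl B)]
        exact (lintegral_prod_symm _ (hg.comp (measurable_raceEnd' t dl B)).aemeasurable).symm

end ResidualLaw


/-! ## Truncated histories of the original system -/

section TruncHist

variable {N M : ℕ} (π : Policy N M) (ω : Sample N M)

/-- The history without the observations at infinite times. -/
noncomputable def truncHist (k : ℕ) : Fin (k + 1) → Obs N M := fun j => ((π.run ω k).hist j).trunc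

open Classical in
/-- The residual transmission times after the `k`-th decision epoch. -/
noncomputable def resid (k : ℕ) : Fin M → ℝ := fun m =>
  if Continues π ω.seed (truncHist π ω k) m then
    ((π.run ω k).finish m).toReal - (truncHist π ω k (Fin.last k)).time.toReal
  else ω.txTime (k, m)

lemma resid_apply (k : ℕ) (m : Fin M) [Decidable (Continues π ω.seed (truncHist π ω k) m)] :
    resid π ω k m = if Continues π ω.seed (truncHist π ω k) m then
      ((π.run ω k).finish m).toReal - (truncHist π ω k (Fin.last k)).time.toReal
    else ω.txTime (k, m) := by
  rw [resid]; congr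

lemma trunc_of_eq_top {o : Obs N M} (h : o.time = ⊤) : o.trunc = Obs.never := if_pos h

open Classical in
/-- The time at which server `m` will end its transmission. -/
noncomputable def clock (k : ℕ) (m : Fin M) : EReal :=
  if π.assign k (π.run ω k).hist ω.seed m = none then ⊤
  else if π.assign k (π.run ω k).hist ω.seed m = ((π.run ω k).hist (Fin.last k)).inService m then
    (π.run ω k).finish m
  else ((π.run ω k).hist (Fin.last k)).time + (ω.txTime (k, m) : EReal)

/-- The time of the next decision epoch. -/
noncomputable def nextTime (k : ℕ) : EReal :=
  min (deadline π ω.arrivals ω.seed (π.run ω k).hist) (⨅ m, clock π ω k m)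

open Classical in
lemma run_succ_hist (k : ℕ) : (π.run ω (k + 1)).hist =
    Fin.snoc (α := fun _ => Obs N M) (π.run ω k).hist (observe ω.arrivals (nextTime π ω k)
    (fun n i => if ∃ m, π.assign k (π.run ω k).hist ω.seed m = some (n, i) ∧
        clock π ω k m = nextTime π ω k ∧ ω.txError (k, m) = false then nextTime π ω k
      else ((π.run ω k).hist (Fin.last k)).del n i)
    (fun m => if clock π ω k m = nextTime π ω k then none else π.assign k (π.run ω k).hist ω.seed m)
    (fun m => if clock π ω k m = nextTime π ω k ∧ ω.txError (k, m) = true then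
      π.assign k (π.run ω k).hist ω.seed m else none)) := by
  have hT : nextTime π ω k = min (((π.run ω k).hist (Fin.last k)).time +
      π.wait k (π.run ω k).hist ω.seed) (min (nextArrival ω.arrivals
        ((π.run ω k).hist (Fin.last k)).time) (⨅ m, clock π ω k m)) := by
    rw [nextTime, deadline, min_assoc]
  rw [hT]
  rfl

lemma run_succ_finish (k : ℕ) : (π.run ω (k + 1)).finish = clock π ω k := rfl

lemma iInf_ne_bot {ι : Type*} [Finite ι] {f : ι → EReal} (h : ∀ i, f i ≠ ⊥) : ⨅ i, f i ≠ ⊥ := by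
  have := Fintype.ofFinite ι
  rw [← Finset.inf_univ_eq_iInf, ← bot_lt_iff_ne_bot, Finset.lt_inf_iff bot_lt_top]
  exact fun i _ => bot_lt_iff_ne_bot.2 (h i)

/-- The times of the decision epochs and the ends of the transmissions are not degenerate. -/
structure Regular (k : ℕ) : Prop where
  time_ne_bot : ((π.run ω k).hist (Fin.last k)).time ≠ ⊥
  idle : ((π.run ω k).hist (Fin.last k)).time = ⊤ →
    ∀ m, ((π.run ω k).hist (Fin.last k)).inService m = none
  finish_ne_top : ∀ m, ((π.run ω k).hist (Fin.last k)).inService m ≠ none →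
    (π.run ω k).finish m ≠ ⊤
  finish_ne_bot : ∀ m, ((π.run ω k).hist (Fin.last k)).inService m ≠ none →
    (π.run ω k).finish m ≠ ⊥
  time_ne_top : ((π.run ω k).hist (Fin.last k)).time ≠ ⊤ → ∀ j, ((π.run ω k).hist j).time ≠ ⊤

variable {π ω}

lemma Regular.clock_ne_bot {k : ℕ} (h : Regular π ω k) (m : Fin M) : clock π ω k m ≠ ⊥ := by
  rw [clock]
  split_ifs with h1 h2
  · exact top_ne_bot
  · exact h.finish_ne_bot m (by rwa [← h2])
  · simp [EReal.add_eq_bot_iff, h.time_ne_bot]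

lemma deadline_eq_top {k : ℕ} {I : Arrivals N} {u : ℝ} {h : Fin (k + 1) → Obs N M}
    (ht : (h (Fin.last k)).time = ⊤) : deadline π I u h = ⊤ := by
  have hw : π.wait k h u ≠ ⊥ := ((bot_le).trans_lt (π.wait_pos k h u)).ne'
  have h2 : ⊤ ≤ nextArrival I ⊤ := le_nextArrival I ⊤
  rw [deadline, ht, EReal.top_add_of_ne_bot hw, top_le_iff.1 h2, min_self]

lemma Regular.clock_eq_top {k : ℕ} (h : Regular π ω k)
    (ht : ((π.run ω k).hist (Fin.last k)).time = ⊤) (m : Fin M) : clock π ω k m = ⊤ := by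
  rw [clock]
  split_ifs with h1 h2
  · rfl
  · exact absurd (h2.trans (h.idle ht m)) h1
  · rw [ht, EReal.top_add_of_ne_bot (EReal.coe_ne_bot _)]

lemma Regular.nextTime_eq_top {k : ℕ} (h : Regular π ω k)
    (ht : ((π.run ω k).hist (Fin.last k)).time = ⊤) : nextTime π ω k = ⊤ := by
  rw [nextTime, deadline_eq_top ht]
  simp [h.clock_eq_top ht]

lemma Regular.clock_eq {k : ℕ} (h : Regular π ω k)
    (ht : ((π.run ω k).hist (Fin.last k)).time ≠ ⊤) {m : Fin M}
    (hm : π.assign k (π.run ω k).hist ω.seed m ≠ none) : clock π ω k m ≠ ⊤ := by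
  rw [clock, if_neg hm]
  split_ifs with h2
  · exact h.finish_ne_top m (by rwa [← h2])
  · lift ((π.run ω k).hist (Fin.last k)).time to ℝ using ⟨ht, h.time_ne_bot⟩ with t
    exact EReal.coe_ne_top _

variable (π ω)

/-- If the next epoch is at infinite time, then all clocks show `⊤` and thus count as having rung,
which empties the servers; so infinite time is absorbing. At finite times the clocks of the busy
servers are finite. -/
lemma regular (k : ℕ) : Regular π ω k := by
  induction k with
  | zero =>
    refine ⟨EReal.zero_ne_bot, fun h => absurd h EReal.zero_ne_top, fun m h => absurd rfl h,
      fun m h => absurd rfl h, fun _ j => EReal.zero_ne_top⟩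
  | succ k ih =>
    have hlast := congrFun (run_succ_hist π ω k) (Fin.last (k + 1))
    rw [Fin.snoc_last] at hlast
    have htime : ((π.run ω (k + 1)).hist (Fin.last (k + 1))).time = nextTime π ω k := by
      rw [hlast]; rfl
    have hserv : ∀ m, ((π.run ω (k + 1)).hist (Fin.last (k + 1))).inService m ≠ none →
        clock π ω k m ≠ nextTime π ω k ∧ π.assign k (π.run ω k).hist ω.seed m ≠ none := fun m h => by
      rw [hlast] at h
      simp only [observe] at h
      split_ifs at h with h1
      · exact absurd rfl h
      · exact ⟨h1, h⟩
    have htop : nextTime π ω k ≠ ⊤ → ((π.run ω k).hist (Fin.last k)).time ≠ ⊤ := fun h1 h2 =>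
      h1 (ih.nextTime_eq_top h2)
    have hle : ∀ m, nextTime π ω k ≤ clock π ω k m := fun m => (min_le_right _ _).trans (iInf_le _ m)
    refine ⟨?_, ?_, ?_, ?_, ?_⟩
    · rw [htime, nextTime, ← bot_lt_iff_ne_bot, lt_min_iff, bot_lt_iff_ne_bot, bot_lt_iff_ne_bot]
      refine ⟨?_, iInf_ne_bot ih.clock_ne_bot⟩
      exact fun h => absurd ((coe_toReal_le_deadline π ω.arrivals ω.seed ih.time_ne_bot).trans h.le)
        (by simp)
    · intro h m
      by_contra hm
      rw [htime] at h
      exact (hserv m hm).1 ((top_le_iff.1 (h ▸ hle m)).trans h.symm)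
    · intro m hm
      rw [run_succ_finish]
      refine ih.clock_eq (fun h => ?_) (hserv m hm).2
      exact (hserv m hm).1 ((ih.clock_eq_top h m).trans (ih.nextTime_eq_top h).symm)
    · intro m hm
      exact ih.clock_ne_bot m
    · intro h j
      rw [htime] at h
      have := ih.time_ne_top (htop h)
      rw [run_succ_hist]
      refine Fin.lastCases ?_ (fun i => ?_) j
      · rw [Fin.snoc_last]; exact h
      · rw [Fin.snoc_castSucc]; exact this i

variable {π ω}

lemma truncHist_eq {k : ℕ} (ht : ((π.run ω k).hist (Fin.last k)).time ≠ ⊤) :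
    truncHist π ω k = (π.run ω k).hist := by
  funext j
  exact if_neg ((regular π ω k).time_ne_top ht j)

lemma truncHist_last_of_eq_top {k : ℕ} (ht : ((π.run ω k).hist (Fin.last k)).time = ⊤) :
    truncHist π ω k (Fin.last k) = Obs.never := if_pos ht

lemma trunc_time (o : Obs N M) : o.trunc.time = o.time := by
  rw [Obs.trunc]; split_ifs with h
  exacts [h.symm, rfl]

lemma truncHist_time (k : ℕ) :
    (truncHist π ω k (Fin.last k)).time = ((π.run ω k).hist (Fin.last k)).time := trunc_time _

/-- A new transmission ends after its transmission time and a continuing one after its residual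
time; `resid` is defined to make both cases one formula. -/
lemma clock_eq_ringTime {k : ℕ} (ht : ((π.run ω k).hist (Fin.last k)).time ≠ ⊤) (m : Fin M) :
    clock π ω k m = ringTime (π.assign k (truncHist π ω k) ω.seed)
      (truncHist π ω k (Fin.last k)).time.toReal (resid π ω k) m := by
  rw [ringTime, clock, ← truncHist_eq ht]
  split_ifs with h1 h2
  · rfl
  · have hs : (truncHist π ω k (Fin.last k)).inService m ≠ none := by rwa [← h2]
    have hs' := hs
    rw [truncHist_eq ht] at hs'
    have hc : Continues π ω.seed (truncHist π ω k) m := ⟨hs, h2⟩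
    rw [resid, if_pos hc, add_sub_cancel, EReal.coe_toReal ((regular π ω k).finish_ne_top m hs')
      ((regular π ω k).finish_ne_bot m hs')]
  · have hc : ¬ Continues π ω.seed (truncHist π ω k) m := fun h => h2 h.2
    rw [resid, if_neg hc, EReal.coe_add, EReal.coe_toReal]
    · rwa [truncHist_time]
    · rw [truncHist_time]; exact (regular π ω k).time_ne_bot

/-- One step of the original system is a race of the residual times. At infinite time both sides
append `Obs.never`, whatever the untruncated policy does there. -/
lemma truncHist_succ (k : ℕ) : truncHist π ω (k + 1) =
    endExtend π ω.arrivals ω.seed (truncHist π ω k) (resid π ω k) fun m => ω.txError (k, m) := by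
  have h1 : truncHist π ω (k + 1) = Fin.snoc (α := fun _ => Obs N M) (truncHist π ω k)
      ((π.run ω (k + 1)).hist (Fin.last (k + 1))).trunc := by
    funext j
    refine Fin.lastCases ?_ (fun i => ?_) j
    · rw [Fin.snoc_last]; rfl
    · rw [Fin.snoc_castSucc, truncHist, run_succ_hist, Fin.snoc_castSucc]; rfl
  rw [h1, endExtend, run_succ_hist, Fin.snoc_last]
  congr 1
  by_cases ht : ((π.run ω k).hist (Fin.last k)).time = ⊤
  · have hnone : ∀ m, π.assign k (truncHist π ω k) ω.seed m = none :=
      Obs.Feasible.eq_none_of_never (by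
        rw [← truncHist_last_of_eq_top ht]; exact π.feasible k _ _)
    refine (trunc_of_eq_top ((regular π ω k).nextTime_eq_top ht)).trans (trunc_of_eq_top ?_).symm
    simp [endObs, observe, endTime, deadline_eq_top ((truncHist_time k).trans ht), ringTime, hnone]
  · have hT : nextTime π ω k = endTime (deadline π ω.arrivals ω.seed (truncHist π ω k))
        (π.assign k (truncHist π ω k) ω.seed) (truncHist π ω k (Fin.last k)).time.toReal
        (resid π ω k) := by
      rw [nextTime, endTime, truncHist_eq ht]
      congr 1
      refine iInf_congr fun m => ?_
      rw [clock_eq_ringTime ht, truncHist_eq ht]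
    simp only [clock_eq_ringTime ht, hT, ← truncHist_eq ht]
    rfl

lemma resid_succ (k : ℕ) : resid π ω (k + 1) =
    nextResid π ω.seed (truncHist π ω k (Fin.last k)).time.toReal (truncHist π ω (k + 1))
      (resid π ω k) fun m => ω.txTime (k + 1, m) := by
  funext m
  classical
  rw [resid_apply, nextResid, mixTimes]
  by_cases hc : Continues π ω.seed (truncHist π ω (k + 1)) m
  · rw [if_pos hc, if_pos hc]
    have hs := hc.1
    have ht' : ((π.run ω (k + 1)).hist (Fin.last (k + 1))).time ≠ ⊤ := fun h => by
      rw [truncHist_last_of_eq_top h] at hs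
      exact hs rfl
    have ht : ((π.run ω k).hist (Fin.last k)).time ≠ ⊤ := fun h => by
      refine ht' ?_
      rw [run_succ_hist, Fin.snoc_last]
      exact (regular π ω k).nextTime_eq_top h
    rw [truncHist_eq ht', run_succ_hist, Fin.snoc_last] at hs
    simp only [observe] at hs
    have ha : π.assign k (truncHist π ω k) ω.seed m ≠ none := by
      split_ifs at hs with h1
      · exact absurd rfl hs
      · rwa [truncHist_eq ht]
    rw [run_succ_finish, clock_eq_ringTime ht, ringTime, if_neg ha, EReal.toReal_coe]
    ring
  · rw [if_neg hc, if_neg hc]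

lemma truncHist_zero : truncHist π ω 0 = fun _ => initObs ω.arrivals := by
  funext j
  show (initObs ω.arrivals : Obs N M).trunc = _
  rw [Obs.trunc, if_neg (show (initObs ω.arrivals : Obs N M).time ≠ ⊤ from EReal.zero_ne_top)]

lemma resid_zero : resid π ω 0 = fun m => ω.txTime (0, m) := by
  funext m
  refine if_neg fun h => h.1 ?_
  rw [truncHist_zero]
  rfl

end TruncHist


/-! ### The law of the truncated histories. -/

section TruncLaw

variable {N M : ℕ} (π : Policy N M)

/-- Observations at infinite time contribute nothing to the infimum: a step to infinite time either
writes `⊤` or keeps the earlier entry. -/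
lemma delivery_eq_truncHist (ω : Sample N M) (n : Fin N) (i : ℕ) :
    π.delivery ω n i = ⨅ k, (truncHist π ω k (Fin.last k)).del n i := by
  refine le_antisymm (iInf_mono fun k => ?_) (le_iInf fun k => ?_)
  · by_cases ht : ((π.run ω k).hist (Fin.last k)).time = ⊤
    · rw [truncHist_last_of_eq_top ht]; exact le_top
    · rw [truncHist_eq ht]
  · induction k with
    | zero => exact le_top
    | succ k ih =>
      by_cases ht : ((π.run ω (k + 1)).hist (Fin.last (k + 1))).time = ⊤
      · have ht' : nextTime π ω k = ⊤ := by
          rw [run_succ_hist, Fin.snoc_last] at ht; exact ht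
        rw [run_succ_hist, Fin.snoc_last]
        simp only [observe]
        split_ifs
        · rw [ht']; exact le_top
        · exact ih
      · refine (iInf_le _ (k + 1)).trans (le_of_eq ?_)
        rw [truncHist_eq ht]

lemma measurable_truncHist_resid (k : ℕ) :
    Measurable fun ω : Sample N M => (truncHist π ω k, resid π ω k) := by
  induction k with
  | zero =>
    simp only [truncHist_zero, resid_zero, Sample.arrivals, Sample.txTime]
    refine Measurable.prodMk (measurable_pi_lambda _ fun _ => Measurable.observe (by fun_prop)
      measurable_const measurable_const measurable_const measurable_const) (by fun_prop)
  | succ k ih =>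
    simp only [resid_succ]
    have h1 : Measurable fun ω : Sample N M => truncHist π ω (k + 1) := by
      simp only [truncHist_succ, Sample.arrivals, Sample.seed, Sample.txError]
      exact Measurable.endExtend π (by fun_prop) (by fun_prop) ih.fst ih.snd (by fun_prop)
    refine h1.prodMk (Measurable.mixTimes π ?_ h1 ?_ ?_)
    · exact measurable_snd.snd.snd
    · have h2 := (measurable_last_time h1).ereal_toReal
      have h3 := (measurable_last_time ih.fst).ereal_toReal
      have h4 := ih.snd
      exact measurable_pi_lambda _ fun m =>
        ((measurable_pi_apply m).comp h4).sub (h2.sub h3)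
    · simp only [Sample.txTime]; fun_prop

/-- Causality: up to the `k`-th epoch only the transmission times of the rows up to `k` and the
errors of the rows below `k` have been used. This allows the next rows to be treated as fresh in
`lintegral_iid_row`. -/
lemma truncHist_resid_congr (I : Arrivals N) (u : ℝ) {X X' : ℕ × Fin M → ℝ}
    {E E' : ℕ × Fin M → Bool} (k : ℕ) (hX : ∀ p : ℕ × Fin M, p.1 < k + 1 → X p = X' p)
    (hE : ∀ p : ℕ × Fin M, p.1 < k → E p = E' p) :
    truncHist π (I, X, E, u) k = truncHist π (I, X', E', u) k ∧
      resid π (I, X, E, u) k = resid π (I, X', E', u) k := by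
  induction k with
  | zero =>
    rw [truncHist_zero, truncHist_zero, resid_zero, resid_zero]
    exact ⟨rfl, funext fun m => hX _ zero_lt_one⟩
  | succ k ih =>
    obtain ⟨h1, h2⟩ := ih (fun p hp => hX p (by omega)) fun p hp => hE p (by omega)
    have h3 : truncHist π (I, X, E, u) (k + 1) = truncHist π (I, X', E', u) (k + 1) := by
      rw [truncHist_succ, truncHist_succ, h1, h2]
      have : (fun m => Sample.txError (I, X, E, u) (k, m)) =
          fun m => Sample.txError (I, X', E', u) (k, m) := funext fun m => hE _ (Nat.lt_succ_self k)
      rw [this]; rfl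
    refine ⟨h3, ?_⟩
    rw [resid_succ, resid_succ, h1, h2, h3]
    have : (fun m => Sample.txTime (I, X, E, u) (k + 1, m)) =
        fun m => Sample.txTime (I, X', E', u) (k + 1, m) := funext fun m => hX _ (Nat.lt_succ_self _)
    rw [this]; rfl

variable {μ : ℝ} {β : Measure Bool} [IsProbabilityMeasure β]

lemma truncHist_time_ne_bot (ω : Sample N M) (k : ℕ) :
    (truncHist π ω k (Fin.last k)).time ≠ ⊥ := by
  rw [truncHist_time]; exact (regular π ω k).time_ne_bot

/-- The transmission times of row `k + 1` and the errors of row `k` are independent of the history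
and residuals at epoch `k`; by `hk` these residuals are fresh, and `lintegral_period` applies. As in
`lintegral_tickRun_succ`, `hk` is the induction hypothesis of the lemma that follows. -/
lemma lintegral_truncHist_succ (hμ : 0 < μ) (I : Arrivals N) (u : ℝ) (k : ℕ)
    (hk : ∀ f : (Fin (k + 1) → Obs N M) × (Fin M → ℝ) → ℝ≥0∞, Measurable f →
      ∫⁻ X, ∫⁻ E, f (truncHist π (I, X, E, u) k, resid π (I, X, E, u) k)
          ∂iid (ℕ × Fin M) β ∂iid (ℕ × Fin M) (expMeasure μ) =
        ∫⁻ X, ∫⁻ E, ∫⁻ z, f (truncHist π (I, X, E, u) k, z) ∂iid (Fin M) (expMeasure μ)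
          ∂iid (ℕ × Fin M) β ∂iid (ℕ × Fin M) (expMeasure μ))
    {f : (Fin (k + 1 + 1) → Obs N M) × (Fin M → ℝ) → ℝ≥0∞} (hf : Measurable f) :
    ∫⁻ X, ∫⁻ E, f (truncHist π (I, X, E, u) (k + 1), resid π (I, X, E, u) (k + 1))
        ∂iid (ℕ × Fin M) β ∂iid (ℕ × Fin M) (expMeasure μ) =
      ∫⁻ X, ∫⁻ E, ∫⁻ o, ∫⁻ y, f (extend π I u (truncHist π (I, X, E, u) k) o, y)
        ∂iid (Fin M) (expMeasure μ) ∂periodLaw π μ β I u (truncHist π (I, X, E, u) k)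
        ∂iid (ℕ × Fin M) β ∂iid (ℕ × Fin M) (expMeasure μ) := by
  have := isProbabilityMeasure_expMeasure hμ
  set G : ((Fin (k + 1) → Obs N M) × (Fin M → ℝ)) × (Fin M → ℝ) × (Fin M → Bool) → ℝ≥0∞ := fun p =>
    f (endExtend π I u p.1.1 p.1.2 p.2.2, nextResid π u (p.1.1 (Fin.last k)).time.toReal
      (endExtend π I u p.1.1 p.1.2 p.2.2) p.1.2 p.2.1) with hG
  have hGm : Measurable G := by
    have h1 : Measurable fun p : ((Fin (k + 1) → Obs N M) × (Fin M → ℝ)) × (Fin M → ℝ) ×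
        (Fin M → Bool) => endExtend π I u p.1.1 p.1.2 p.2.2 :=
      Measurable.endExtend π measurable_const measurable_const (by fun_prop) (by fun_prop) (by fun_prop)
    refine hf.comp (h1.prodMk (Measurable.mixTimes π measurable_const h1 ?_ (by fun_prop)))
    have h2 := (measurable_last_time h1).ereal_toReal
    have h3 : Measurable fun p : ((Fin (k + 1) → Obs N M) × (Fin M → ℝ)) × (Fin M → ℝ) ×
        (Fin M → Bool) => (p.1.1 (Fin.last k)).time.toReal :=
      (measurable_last_time (by fun_prop)).ereal_toReal
    fun_prop
  have hTR : Measurable fun p : (ℕ × Fin M → ℝ) × (ℕ × Fin M → Bool) =>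
      (truncHist π (I, p.1, p.2, u) k, resid π (I, p.1, p.2, u) k) :=
    (measurable_truncHist_resid π k).comp (f := fun p : (ℕ × Fin M → ℝ) × (ℕ × Fin M → Bool) =>
      (I, p.1, p.2, u)) (by fun_prop)
  have hstep : ∀ X E, f (truncHist π (I, X, E, u) (k + 1), resid π (I, X, E, u) (k + 1)) =
      G ((truncHist π (I, X, E, u) k, resid π (I, X, E, u) k),
        (fun m => X (k + 1, m)), fun m => E (k, m)) := fun X E => by
    rw [resid_succ, truncHist_succ]; rfl
  simp_rw [hstep]
  have hE : ∀ X x, ∫⁻ E, G ((truncHist π (I, X, E, u) k, resid π (I, X, E, u) k),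
        x, fun m => E (k, m)) ∂iid (ℕ × Fin M) β =
      ∫⁻ E, ∫⁻ e, G ((truncHist π (I, X, E, u) k, resid π (I, X, E, u) k), x, e)
        ∂iid (Fin M) β ∂iid (ℕ × Fin M) β := fun X x => by
    refine lintegral_iid_row β k (F := fun E e =>
      G ((truncHist π (I, X, E, u) k, resid π (I, X, E, u) k), x, e)) ?_ ?_
    · exact hGm.comp ((hTR.comp (f := fun p : (ℕ × Fin M → Bool) × (Fin M → Bool) => (X, p.1))
        (by fun_prop)).prodMk (by fun_prop))
    · intro E E' e h
      obtain ⟨h1, h2⟩ := truncHist_resid_congr π I u (X := X) k (fun _ _ => rfl) h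
      simp only [h1, h2]
  simp_rw [hE]
  have hX : ∫⁻ X, ∫⁻ E, ∫⁻ e, G ((truncHist π (I, X, E, u) k, resid π (I, X, E, u) k),
        (fun m => X (k + 1, m)), e) ∂iid (Fin M) β ∂iid (ℕ × Fin M) β
        ∂iid (ℕ × Fin M) (expMeasure μ) =
      ∫⁻ X, ∫⁻ x, ∫⁻ E, ∫⁻ e, G ((truncHist π (I, X, E, u) k, resid π (I, X, E, u) k), x, e)
        ∂iid (Fin M) β ∂iid (ℕ × Fin M) β ∂iid (Fin M) (expMeasure μ)
        ∂iid (ℕ × Fin M) (expMeasure μ) := by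
    refine lintegral_iid_row (expMeasure μ) (k + 1) (F := fun X x => ∫⁻ E, ∫⁻ e,
      G ((truncHist π (I, X, E, u) k, resid π (I, X, E, u) k), x, e)
        ∂iid (Fin M) β ∂iid (ℕ × Fin M) β) ?_ ?_
    · refine Measurable.lintegral_prod_right' (f := fun p : ((ℕ × Fin M → ℝ) × (Fin M → ℝ)) ×
        (ℕ × Fin M → Bool) => ∫⁻ e, G ((truncHist π (I, p.1.1, p.2, u) k,
          resid π (I, p.1.1, p.2, u) k), p.1.2, e) ∂iid (Fin M) β) ?_
      refine Measurable.lintegral_prod_right' (f := fun p : (((ℕ × Fin M → ℝ) × (Fin M → ℝ)) ×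
        (ℕ × Fin M → Bool)) × (Fin M → Bool) => G ((truncHist π (I, p.1.1.1, p.1.2, u) k,
          resid π (I, p.1.1.1, p.1.2, u) k), p.1.1.2, p.2)) ?_
      exact hGm.comp ((hTR.comp (f := fun p : (((ℕ × Fin M → ℝ) × (Fin M → ℝ)) ×
        (ℕ × Fin M → Bool)) × (Fin M → Bool) => (p.1.1.1, p.1.2)) (by fun_prop)).prodMk (by fun_prop))
    · intro X X' x h
      refine lintegral_congr fun E => ?_
      obtain ⟨h1, h2⟩ := truncHist_resid_congr π I u (E := E) k h (fun _ _ => rfl)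
      simp only [h1, h2]
  rw [hX]
  have hg : Measurable fun q : (Fin (k + 1) → Obs N M) × (Fin M → ℝ) =>
      ∫⁻ x, ∫⁻ e, G (q, x, e) ∂iid (Fin M) β ∂iid (Fin M) (expMeasure μ) := by
    refine Measurable.lintegral_prod_right' (f := fun p : ((Fin (k + 1) → Obs N M) × (Fin M → ℝ)) ×
      (Fin M → ℝ) => ∫⁻ e, G (p.1, p.2, e) ∂iid (Fin M) β) ?_
    exact Measurable.lintegral_prod_right' (f := fun p : (((Fin (k + 1) → Obs N M) × (Fin M → ℝ)) ×
      (Fin M → ℝ)) × (Fin M → Bool) => G (p.1.1, p.1.2, p.2)) (hGm.comp (by fun_prop))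
  have hswap : ∀ X, ∫⁻ x, ∫⁻ E, ∫⁻ e, G ((truncHist π (I, X, E, u) k, resid π (I, X, E, u) k), x, e)
        ∂iid (Fin M) β ∂iid (ℕ × Fin M) β ∂iid (Fin M) (expMeasure μ) =
      ∫⁻ E, ∫⁻ x, ∫⁻ e, G ((truncHist π (I, X, E, u) k, resid π (I, X, E, u) k), x, e)
        ∂iid (Fin M) β ∂iid (Fin M) (expMeasure μ) ∂iid (ℕ × Fin M) β := fun X => by
    refine lintegral_lintegral_swap (Measurable.aemeasurable ?_)
    refine Measurable.lintegral_prod_right' (f := fun p : ((Fin M → ℝ) × (ℕ × Fin M → Bool)) ×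
      (Fin M → Bool) => G ((truncHist π (I, X, p.1.2, u) k, resid π (I, X, p.1.2, u) k), p.1.1, p.2)) ?_
    exact hGm.comp ((hTR.comp (f := fun p : ((Fin M → ℝ) × (ℕ × Fin M → Bool)) ×
      (Fin M → Bool) => (X, p.1.2)) (by fun_prop)).prodMk (by fun_prop))
  simp_rw [hswap]
  refine (hk _ hg).trans (lintegral_congr fun X => lintegral_congr fun E => ?_)
  exact lintegral_period π hμ I u (truncHist_time_ne_bot π _ k) hf

/-- The residual transmission times are independent of the history. -/
lemma lintegral_truncHist_resid (hμ : 0 < μ) (I : Arrivals N) (u : ℝ) (k : ℕ)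
    {f : (Fin (k + 1) → Obs N M) × (Fin M → ℝ) → ℝ≥0∞} (hf : Measurable f) :
    ∫⁻ X, ∫⁻ E, f (truncHist π (I, X, E, u) k, resid π (I, X, E, u) k)
        ∂iid (ℕ × Fin M) β ∂iid (ℕ × Fin M) (expMeasure μ) =
      ∫⁻ X, ∫⁻ E, ∫⁻ z, f (truncHist π (I, X, E, u) k, z) ∂iid (Fin M) (expMeasure μ)
        ∂iid (ℕ × Fin M) β ∂iid (ℕ × Fin M) (expMeasure μ) := by
  have := isProbabilityMeasure_expMeasure hμ
  induction k with
  | zero =>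
    simp only [truncHist_zero, resid_zero, Sample.arrivals, Sample.txTime, lintegral_const,
      measure_univ, mul_one]
    have h := lintegral_iid_row (expMeasure μ) 0 (F := fun (_ : ℕ × Fin M → ℝ) (y : Fin M → ℝ) =>
      f (fun _ => initObs I, y)) (hf.comp (by fun_prop)) (fun _ _ _ _ => rfl)
    simpa using h
  | succ k ih =>
    rw [lintegral_truncHist_succ π hμ I u k (fun f hf => ih hf) hf]
    have hf0 : Measurable fun p : (Fin (k + 1 + 1) → Obs N M) × (Fin M → ℝ) =>
        ∫⁻ r, f (p.1, r) ∂iid (Fin M) (expMeasure μ) :=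
      hf.lintegral_prod_right'.comp measurable_fst
    have := lintegral_truncHist_succ (β := β) π hμ I u k (fun f hf => ih hf) hf0
    simp only [lintegral_const, measure_univ, mul_one] at this
    exact this.symm

lemma lintegral_truncHist (hμ : 0 < μ) (I : Arrivals N) (u : ℝ) (k : ℕ)
    {f : (Fin (k + 1 + 1) → Obs N M) → ℝ≥0∞} (hf : Measurable f) :
    ∫⁻ X, ∫⁻ E, f (truncHist π (I, X, E, u) (k + 1))
        ∂iid (ℕ × Fin M) β ∂iid (ℕ × Fin M) (expMeasure μ) =
      ∫⁻ X, ∫⁻ E, ∫⁻ o, f (extend π I u (truncHist π (I, X, E, u) k) o)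
        ∂periodLaw π μ β I u (truncHist π (I, X, E, u) k)
        ∂iid (ℕ × Fin M) β ∂iid (ℕ × Fin M) (expMeasure μ) := by
  have := isProbabilityMeasure_expMeasure hμ
  have := lintegral_truncHist_succ (β := β) π hμ I u k
    (fun f hf => lintegral_truncHist_resid π hμ I u k hf) (f := fun p => f p.1) (hf.comp measurable_fst)
  simpa using this

end TruncLaw


/-! ### Equality in law of the original and the tick-driven system. -/

section DeliveryLaw

variable {N M : ℕ} (π : Policy N M) {μ : ℝ} {β : Measure Bool}

/-- All the laws `periodLaw` are images of one fixed law of clocks and errors under a jointly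
measurable map. -/
lemma measurable_lintegral_periodLaw (hμ : 0 < μ) (I : Arrivals N) (u : ℝ) {k : ℕ}
    {f : (Fin (k + 1 + 1) → Obs N M) → ℝ≥0∞} (hf : Measurable f) :
    Measurable fun h => ∫⁻ o, f (extend π I u h o) ∂periodLaw π μ β I u h := by
  have := isProbabilityMeasure_expMeasure hμ
  have h1 : ∀ h : Fin (k + 1) → Obs N M, ∫⁻ o, f (extend π I u h o) ∂periodLaw π μ β I u h =
      ∫⁻ p : (Fin M → ℝ) × (Fin M → Bool), f (extend π I u h (raceEnd (h (Fin.last k)).time.toReal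
        (deadline π I u h) (busy (π.assign k h u)) p.1 p.2))
        ∂(iid (Fin M) (expMeasure μ)).prod (iid (Fin M) β) := fun h => by
    have hx : Measurable fun o => f (extend π I u h o) := hf.comp (Measurable.extend π
      measurable_const measurable_const measurable_const measurable_id)
    rw [periodLaw, raceLaw, lintegral_map hx (measurable_raceEnd' _ _ _)]
  rw [funext h1]
  have hfst : Measurable fun p : (Fin (k + 1) → Obs N M) × ((Fin M → ℝ) × (Fin M → Bool)) => p.1 :=
    measurable_fst
  refine Measurable.lintegral_prod_right' (f := fun p : (Fin (k + 1) → Obs N M) ×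
    ((Fin M → ℝ) × (Fin M → Bool)) => f (extend π I u p.1 (raceEnd (p.1 (Fin.last k)).time.toReal
        (deadline π I u p.1) (busy (π.assign k p.1 u)) p.2.1 p.2.2))) ?_
  refine hf.comp (Measurable.extend π measurable_const measurable_const hfst ?_)
  exact measurable_raceEnd.comp ((((measurable_last_time hfst).ereal_toReal.prodMk
    (measurable_deadline π measurable_const measurable_const hfst)).prodMk
    (measurable_busy.comp (measurable_assign' π hfst measurable_const))).prodMk measurable_snd)

variable [IsProbabilityMeasure β]

/-- The histories of the two systems have the same law. -/
lemma lintegral_truncHist_eq_tickRun [NeZero M] (hμ : 0 < μ) (I : Arrivals N) (u : ℝ) (k : ℕ)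
    {f : (Fin (k + 1) → Obs N M) → ℝ≥0∞} (hf : Measurable f) :
    ∫⁻ X, ∫⁻ E, f (truncHist π (I, X, E, u) k)
        ∂iid (ℕ × Fin M) β ∂iid (ℕ × Fin M) (expMeasure μ) =
      ∫⁻ s, f (tickRun π I u s k).1 ∂streamLaw M μ β := by
  have := isProbabilityMeasure_expMeasure hμ
  have := isProbabilityMeasure_tickLaw (M := M) hμ β
  induction k with
  | zero => simp [truncHist_zero, tickRun, Sample.arrivals]
  | succ k ih =>
    rw [lintegral_truncHist π hμ I u k hf, lintegral_tickRun π hμ I u k hf]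
    exact ih (measurable_lintegral_periodLaw π hμ I u hf)

lemma snoc_consistent {α : Type*} (h : (k : ℕ) → Fin (k + 1) → α)
    (hh : ∀ k j, h (k + 1) (Fin.castSucc j) = h k j) (k j : ℕ) (hj : j < k + 1) :
    h k ⟨j, hj⟩ = h j (Fin.last j) := by
  induction k with
  | zero =>
    obtain rfl : j = 0 := by omega
    rfl
  | succ k ih =>
    rcases Nat.lt_succ_iff_lt_or_eq.1 hj with h1 | rfl
    · rw [← ih h1]; exact hh k ⟨j, h1⟩
    · rfl

lemma truncHist_castSucc (ω : Sample N M) (k : ℕ) (j : Fin (k + 1)) :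
    truncHist π ω (k + 1) (Fin.castSucc j) = truncHist π ω k j := by
  rw [truncHist_succ, endExtend, Fin.snoc_castSucc]

lemma tickRun_castSucc (I : Arrivals N) (u : ℝ) (s : Stream M) (k : ℕ) (j : Fin (k + 1)) :
    (tickRun π I u s (k + 1)).1 (Fin.castSucc j) = (tickRun π I u s k).1 j := by
  simp only [tickRun, extend, Fin.snoc_castSucc]

/-- The delivery times in the system which is driven by a stream of ticks. -/
noncomputable def tickDelivery (I : Arrivals N) (u : ℝ) (s : Stream M) (n : Fin N) (i : ℕ) : EReal :=
  ⨅ k, ((tickRun π I u s k).1 (Fin.last k)).del n i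

/-- The delivery times in a sequence of observations. -/
noncomputable def seqDelivery (x : ℕ → Obs N M) (n : Fin N) (i : ℕ) : EReal := ⨅ k, (x k).del n i

lemma measurable_seqDelivery : Measurable (seqDelivery : (ℕ → Obs N M) → _) :=
  measurable_pi_lambda _ fun n => measurable_pi_lambda _ fun i => Measurable.iInf fun k =>
    (measurable_pi_apply i).comp ((measurable_pi_apply n).comp
      (Obs.measurable_del.comp (measurable_pi_apply k)))

lemma measurable_truncSeq :
    Measurable fun (ω : Sample N M) (k : ℕ) => truncHist π ω k (Fin.last k) :=
  measurable_pi_lambda _ fun k => (measurable_pi_apply (Fin.last k)).comp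
    (measurable_truncHist_resid π k).fst

lemma measurable_tickSeq : Measurable fun (p : (Arrivals N × ℝ) × Stream M) (k : ℕ) =>
    (tickRun π p.1.1 p.1.2 p.2 k).1 (Fin.last k) :=
  measurable_pi_lambda _ fun k => (measurable_pi_apply (Fin.last k)).comp (measurable_tickRun π k).fst

lemma measurable_delivery : Measurable (π.delivery : Sample N M → _) := by
  have : π.delivery = fun ω => seqDelivery fun k => truncHist π ω k (Fin.last k) := by
    funext ω n i; exact delivery_eq_truncHist π ω n i
  rw [this]
  exact measurable_seqDelivery.comp (measurable_truncSeq π)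

lemma measurable_tickDelivery : Measurable fun p : (Arrivals N × ℝ) × Stream M =>
    tickDelivery π p.1.1 p.1.2 p.2 :=
  measurable_seqDelivery.comp (measurable_tickSeq π)

/-- The observations in the two systems have the same law. -/
lemma map_truncSeq [NeZero M] (hμ : 0 < μ) (I : Arrivals N) (u : ℝ) :
    ((iid (ℕ × Fin M) (expMeasure μ)).prod (iid (ℕ × Fin M) β)).map
      (fun p k => truncHist π (I, p.1, p.2, u) k (Fin.last k)) =
    (streamLaw M μ β).map fun s k => (tickRun π I u s k).1 (Fin.last k) := by
  have := isProbabilityMeasure_expMeasure hμ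
  have := isProbabilityMeasure_tickLaw (M := M) hμ β
  have hm1 : Measurable fun (p : (ℕ × Fin M → ℝ) × (ℕ × Fin M → Bool)) (k : ℕ) =>
      truncHist π (I, p.1, p.2, u) k (Fin.last k) :=
    (measurable_truncSeq π).comp (f := fun p : (ℕ × Fin M → ℝ) × (ℕ × Fin M → Bool) =>
      (I, p.1, p.2, u)) (by fun_prop)
  have hm2 : Measurable fun (s : Stream M) (k : ℕ) => (tickRun π I u s k).1 (Fin.last k) :=
    (measurable_tickSeq π).comp (f := fun s : Stream M => ((I, u), s)) (by fun_prop)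
  have := Measure.isProbabilityMeasure_map (μ := streamLaw M μ β) hm2.aemeasurable
  -- Laws on sequence space are determined by their finite-dimensional marginals.
  refine IsProjectiveLimit.unique (P := fun J => ((streamLaw M μ β).map fun s k =>
    (tickRun π I u s k).1 (Fin.last k)).map J.restrict) (fun J => ?_) fun J => rfl
  refine Measure.ext_of_lintegral _ fun f hf => ?_
  have hJ : Measurable (J.restrict : (ℕ → Obs N M) → _) := Finset.measurable_restrict J
  have hfJ : Measurable fun x : ℕ → Obs N M => f (J.restrict x) := hf.comp hJ
  have hfJ1 : Measurable fun p : (ℕ × Fin M → ℝ) × (ℕ × Fin M → Bool) =>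
      f (J.restrict fun k => truncHist π (I, p.1, p.2, u) k (Fin.last k)) := hfJ.comp hm1
  rw [lintegral_map hf hJ, lintegral_map hfJ hm1, lintegral_map hf hJ,
    lintegral_map hfJ hm2, lintegral_prod _ hfJ1.aemeasurable]
  -- The observations with index in `J` are all entries of the history at the last of these epochs.
  set k := J.sup id with hk
  have hlt : ∀ j : J, (j : ℕ) < k + 1 := fun j =>
    Nat.lt_succ_of_le (Finset.le_sup (f := id) j.2)
  have h1 := lintegral_truncHist_eq_tickRun (β := β) π hμ I u k
    (f := fun h => f fun j => h ⟨j, hlt j⟩)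
    (hf.comp (measurable_pi_lambda _ fun j => measurable_pi_apply _))
  have h2 : ∀ ω (j : J), truncHist π ω k ⟨j, hlt j⟩ = truncHist π ω j (Fin.last j) := fun ω j =>
    snoc_consistent (truncHist π ω) (truncHist_castSucc π ω) k j (hlt j)
  have h3 : ∀ s (j : J), (tickRun π I u s k).1 ⟨j, hlt j⟩ = (tickRun π I u s j).1 (Fin.last j) :=
    fun s j => snoc_consistent (fun k => (tickRun π I u s k).1) (tickRun_castSucc π I u s) k j (hlt j)
  simp only [h2, h3] at h1
  exact h1

/-- The delivery times in the two systems have the same law. -/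
lemma map_delivery [NeZero M] (hμ : 0 < μ) (q : unitInterval)
    (ν : Measure (Arrivals N)) [IsProbabilityMeasure ν] (ρ : Measure ℝ) [IsProbabilityMeasure ρ] :
    (sampleLaw N M μ q ν ρ).map (fun ω => (ω.arrivals, π.delivery ω)) =
      ((ν.prod ρ).prod (streamLaw M μ (bernoulliMeasure true false q))).map
        fun p => (p.1.1, tickDelivery π p.1.1 p.1.2 p.2) := by
  have := isProbabilityMeasure_expMeasure hμ
  have := isProbabilityMeasure_tickLaw (M := M) hμ (bernoulliMeasure true false q)
  have hm1 : Measurable fun ω : Sample N M => (ω.arrivals, π.delivery ω) :=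
    measurable_fst.prodMk (measurable_delivery π)
  have hm2 : Measurable fun p : (Arrivals N × ℝ) × Stream M =>
      (p.1.1, tickDelivery π p.1.1 p.1.2 p.2) :=
    measurable_fst.fst.prodMk (measurable_tickDelivery π)
  refine Measure.ext_of_lintegral _ fun f hf => ?_
  rw [lintegral_map hf hm1, lintegral_map hf hm2, sampleLaw]
  have hF := hf.comp hm1
  have hG := hf.comp hm2
  have e1 := lintegral_prod (μ := ν) (ν := (iid (ℕ × Fin M) (expMeasure μ)).prod
    ((iid (ℕ × Fin M) (bernoulliMeasure true false q)).prod ρ)) _ hF.aemeasurable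
  refine e1.trans ?_
  have e2 := lintegral_prod (μ := ν.prod ρ) (ν := streamLaw M μ (bernoulliMeasure true false q)) _
    hG.aemeasurable
  refine Eq.trans ?_ e2.symm
  rw [lintegral_prod (μ := ν) (ν := ρ) _ hG.lintegral_prod_right'.aemeasurable]
  refine lintegral_congr fun I => ?_
  have hFI : Measurable fun y : (ℕ × Fin M → ℝ) × (ℕ × Fin M → Bool) × ℝ =>
      ((f ∘ fun ω : Sample N M => (ω.arrivals, π.delivery ω)) (I, y) : ℝ≥0∞) :=
    hF.comp measurable_prodMk_left
  rw [lintegral_prod _ hFI.aemeasurable]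
  have e3 : ∀ X, ∫⁻ y : (ℕ × Fin M → Bool) × ℝ,
      (f ∘ fun ω : Sample N M => (ω.arrivals, π.delivery ω)) (I, X, y)
        ∂(iid (ℕ × Fin M) (bernoulliMeasure true false q)).prod ρ =
      ∫⁻ u, ∫⁻ E, (f ∘ fun ω : Sample N M => (ω.arrivals, π.delivery ω)) (I, X, E, u)
        ∂iid (ℕ × Fin M) (bernoulliMeasure true false q) ∂ρ := fun X =>
    lintegral_prod_symm _ (hFI.comp measurable_prodMk_left).aemeasurable
  rw [lintegral_congr e3, lintegral_lintegral_swap]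
  · refine lintegral_congr fun u => ?_
    -- With the arrivals and the seed fixed, only transmission times and errors on one side and
    -- ticks on the other are random.
    have hm := map_truncSeq (β := bernoulliMeasure true false q) π hμ I u
    have hs : Measurable fun x : ℕ → Obs N M => f (I, seqDelivery x) :=
      hf.comp (measurable_const.prodMk measurable_seqDelivery)
    have hm1 : Measurable fun (p : (ℕ × Fin M → ℝ) × (ℕ × Fin M → Bool)) (k : ℕ) =>
        truncHist π (I, p.1, p.2, u) k (Fin.last k) :=
      (measurable_truncSeq π).comp (f := fun p : (ℕ × Fin M → ℝ) × (ℕ × Fin M → Bool) =>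
        (I, p.1, p.2, u)) (by fun_prop)
    have hm2 : Measurable fun (s : Stream M) (k : ℕ) => (tickRun π I u s k).1 (Fin.last k) :=
      (measurable_tickSeq π).comp (f := fun s : Stream M => ((I, u), s)) (by fun_prop)
    have h1 := congrArg (fun m => ∫⁻ x, f (I, seqDelivery x) ∂m) hm
    simp only [lintegral_map hs hm1, lintegral_map hs hm2] at h1
    have hc1 : Measurable fun p : (ℕ × Fin M → ℝ) × (ℕ × Fin M → Bool) =>
        f (I, seqDelivery fun k => truncHist π (I, p.1, p.2, u) k (Fin.last k)) := hs.comp hm1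
    rw [lintegral_prod _ hc1.aemeasurable] at h1
    refine Eq.trans ?_ h1
    refine lintegral_congr fun X => lintegral_congr fun E => ?_
    simp only [Function.comp_apply]
    congr 2
    funext n i
    exact delivery_eq_truncHist π _ n i
  · exact (Measurable.lintegral_prod_right' (f := fun p : ((ℕ × Fin M → ℝ) × ℝ) ×
      (ℕ × Fin M → Bool) => (f ∘ fun ω : Sample N M => (ω.arrivals, π.delivery ω))
        (I, p.1.1, p.2, p.1.2)) (hFI.comp (by fun_prop))).aemeasurable

end DeliveryLaw


/-! ## The periods in terms of the tick times -/

section TickTimes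

variable {N M : ℕ}

/-- The time of a tick. -/
noncomputable def tickTime (s : Stream M) (j : ℕ) : ℝ := ∑ i ∈ Finset.range (j + 1), (s i).1

lemma tickTime_succ (s : Stream M) (j : ℕ) : tickTime s (j + 1) = tickTime s j + (s (j + 1)).1 :=
  Finset.sum_range_succ _ _

lemma GoodStream.strictMono_tickTime {s : Stream M} (h : GoodStream s) : StrictMono (tickTime s) :=
  strictMono_nat_of_lt_succ fun j => by
    rw [tickTime_succ]; linarith [h.gap_pos (j + 1)]

lemma GoodStream.tickTime_pos {s : Stream M} (h : GoodStream s) (j : ℕ) : 0 < tickTime s j :=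
  Finset.sum_pos (fun i _ => h.gap_pos i) ⟨0, by simp⟩

/-- The stream `r` consists of the ticks of `s` from the `J`-th tick on, seen from time `t`. -/
structure Matches (s : Stream M) (J : ℕ) (t : ℝ) (r : Stream M) : Prop where
  head : r 0 = (tickTime s J - t, (s J).2)
  tail : ∀ i, r (i + 1) = s (J + i + 1)

lemma Matches.tickTime_zero {s : Stream M} {J : ℕ} {t : ℝ} {r : Stream M} (h : Matches s J t r) :
    t + (r 0).1 = tickTime s J := by
  rw [h.head]; ring

lemma Matches.shift {s : Stream M} {J : ℕ} {t : ℝ} {r : Stream M} (h : Matches s J t r) :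
    Matches s (J + 1) (tickTime s J) fun i => r (i + 1) where
  head := by
    rw [h.tail 0, tickTime_succ]
    ext <;> simp
  tail i := by rw [h.tail (i + 1)]; congr 1; omega

lemma Matches.sum {s : Stream M} {J : ℕ} {t : ℝ} {r : Stream M} (h : Matches s J t r) (i : ℕ) :
    t + ∑ j ∈ Finset.range (i + 1), (r j).1 = tickTime s (J + i) := by
  induction i with
  | zero => simpa using h.tickTime_zero
  | succ i ih =>
    rw [Finset.sum_range_succ, ← add_assoc, ih, h.tail, ← add_assoc, tickTime_succ]

lemma Matches.mark {s : Stream M} {J : ℕ} {t : ℝ} {r : Stream M} (h : Matches s J t r) (i : ℕ) :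
    (r i).2 = (s (J + i)).2 := by
  cases i with
  | zero => rw [h.head]; rfl
  | succ i => rw [h.tail]; rfl

/-- The `c`-th tick is the first tick from the `J`-th on which comes after the deadline `dl` or
belongs to a server in `B`. -/
structure Ends (s : Stream M) (dl : EReal) (B : Finset (Fin M)) (J c : ℕ) : Prop where
  le : J ≤ c
  ends : dl ≤ (tickTime s c : EReal) ∨ (s c).2.1 ∈ B
  before : ∀ i, J ≤ i → i < c → (tickTime s i : EReal) < dl ∧ (s i).2.1 ∉ B

lemma Ends.unique {s : Stream M} {dl : EReal} {B : Finset (Fin M)} {J c c' : ℕ}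
    (h : Ends s dl B J c) (h' : Ends s dl B J c') : c = c' := by
  rcases lt_trichotomy c c' with hlt | rfl | hlt
  · obtain ⟨h1, h2⟩ := h'.before c h.le hlt
    exact absurd h.ends (not_or.2 ⟨not_le.2 h1, h2⟩)
  · rfl
  · obtain ⟨h1, h2⟩ := h.before c' h'.le hlt
    exact absurd h'.ends (not_or.2 ⟨not_le.2 h1, h2⟩)

lemma exists_ends {s : Stream M} {dl : EReal} {B : Finset (Fin M)} {J i : ℕ} (hi : J ≤ i)
    (h : dl ≤ (tickTime s i : EReal) ∨ (s i).2.1 ∈ B) : ∃ c ≤ i, Ends s dl B J c := by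
  classical
  have hex : ∃ c, J ≤ c ∧ (dl ≤ (tickTime s c : EReal) ∨ (s c).2.1 ∈ B) := ⟨i, hi, h⟩
  refine ⟨Nat.find hex, Nat.find_min' hex ⟨hi, h⟩, (Nat.find_spec hex).1, (Nat.find_spec hex).2,
    fun j hj hlt => ?_⟩
  have := Nat.find_min hex hlt
  simp only [not_and, not_or, not_le] at this
  exact this hj

open Classical in
/-- The outcome of a period and the number of the first tick after it, if the `c`-th tick ends the
period or is the first one after the deadline. -/
noncomputable def endOutcome (s : Stream M) (dl : EReal) (c : ℕ) : Outcome M × ℕ :=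
  if dl ≤ (tickTime s c : EReal) then ((dl, none), c)
  else (((tickTime s c : EReal), some (s c).2), c + 1)

/-- Translates races on a remaining stream into tick times of the original stream `s`: what remains
after a race is a tail of `s` seen from the end of the period. Since these tick times involve no
policy, different policies become comparable. -/
lemma tickRace_spec {s : Stream M} {dl : EReal} {B : Finset (Fin M)} {n J : ℕ} {t : ℝ}
    {r : Stream M} (hm : Matches s J t r) (h : (tickRace dl B n t r).1.1.1 ≠ ⊤) :
    ∃ c, Ends s dl B J c ∧ (tickRace dl B n t r).1.1 = (endOutcome s dl c).1 ∧
      J + (tickRace dl B n t r).2 = (endOutcome s dl c).2 ∧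
      Matches s (endOutcome s dl c).2 (endOutcome s dl c).1.1.toReal (tickRace dl B n t r).1.2 := by
  induction n generalizing J t r with
  | zero => exact absurd rfl h
  | succ n ih =>
    rw [tickRace_succ, hm.tickTime_zero] at h ⊢
    have hmark : (r 0).2 = (s J).2 := hm.mark 0
    rw [hmark] at h ⊢
    split_ifs at h ⊢ with h1 h2
    · refine ⟨J, ⟨le_rfl, .inl h1, fun i hi hi' => absurd hi (not_le.2 hi')⟩, ?_⟩
      rw [endOutcome, if_pos h1]
      exact ⟨rfl, rfl, ⟨rfl, fun i => by simp [hm.tail]⟩⟩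
    · refine ⟨J, ⟨le_rfl, .inr h2, fun i hi hi' => absurd hi (not_le.2 hi')⟩, ?_⟩
      rw [endOutcome, if_neg h1]
      exact ⟨rfl, rfl, by simpa using hm.shift⟩
    · obtain ⟨c, hc, e1, e2, e3⟩ := ih hm.shift h
      refine ⟨c, ⟨by have := hc.le; omega, hc.ends, fun i hi hi' => ?_⟩, e1, ?_, e3⟩
      · rcases hi.eq_or_lt with rfl | hlt
        · exact ⟨not_le.1 h1, h2⟩
        · exact hc.before i hlt hi'
      · rw [← e2]; simp only; omega

lemma streamRace_of_ends {s : Stream M} {dl : EReal} {B : Finset (Fin M)} {J c : ℕ} {t : ℝ}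
    {r : Stream M} (hm : Matches s J t r) (hc : Ends s dl B J c) :
    (streamRace t dl B r).1.1 = (endOutcome s dl c).1 ∧
      J + (streamRace t dl B r).2 = (endOutcome s dl c).2 ∧
      Matches s (endOutcome s dl c).2 (endOutcome s dl c).1.1.toReal (streamRace t dl B r).1.2 := by
  have h : (tickRace dl B (c - J + 1) t r).1.1.1 ≠ ⊤ := by
    have hcJ : J + (c - J) = c := Nat.add_sub_cancel' hc.le
    rcases hc.ends with h | h
    · refine tickRace_ne_top_of_le ?_
      rwa [hm.sum, hcJ]
    · refine tickRace_ne_top_of_mark ?_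
      rwa [hm.mark, hcJ]
  rw [streamRace_of_ne_top h]
  obtain ⟨c', hc', h'⟩ := tickRace_spec hm h
  obtain rfl := hc.unique hc'
  exact h'

lemma streamRace_of_not_ends {s : Stream M} {dl : EReal} {B : Finset (Fin M)} {J : ℕ} {t : ℝ}
    {r : Stream M} (hm : Matches s J t r) (hc : ∀ c, ¬ Ends s dl B J c) :
    streamRace t dl B r = (((⊤, none), r), 0) := by
  refine streamRace_of_eq_top fun n => ?_
  by_contra h
  obtain ⟨c, hc', -⟩ := tickRace_spec hm h
  exact hc c hc'

end TickTimes

/-! ## The decision epochs of the system driven by a stream of ticks -/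

section Epochs

variable {N M : ℕ} (π : Policy N M) (I : Arrivals N) (u : ℝ) (s : Stream M)

/-- The observation at the `k`-th decision epoch. -/
noncomputable def epochObs (k : ℕ) : Obs N M := (tickRun π I u s k).1 (Fin.last k)

/-- The number of ticks before the `k`-th decision epoch. -/
noncomputable def epochCount (k : ℕ) : ℕ := (tickRun π I u s k).2.2

/-- The assignment at the `k`-th decision epoch. -/
noncomputable def epochAssign (k : ℕ) : Fin M → Slot N := π.assign k (tickRun π I u s k).1 u

/-- The deadline of the period after the `k`-th decision epoch. -/
noncomputable def epochDeadline (k : ℕ) : EReal := deadline π I u (tickRun π I u s k).1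

/-- The period after the `k`-th decision epoch is ended by the `c`-th tick, or the `c`-th tick is
the first one after that period. -/
def EpochEnds (k c : ℕ) : Prop :=
  (epochObs π I u s k).time ≠ ⊤ ∧
    Ends s (epochDeadline π I u s k) (busy (epochAssign π I u s k)) (epochCount π I u s k) c

variable {π I u s}

lemma busy_eq_empty_of_never {a : Fin M → Slot N} (h : (Obs.never : Obs N M).Feasible a) :
    busy a = ∅ := by
  ext m
  simp [mem_busy, h.eq_none_of_never m]

lemma epochObs_succ (k : ℕ) : epochObs π I u s (k + 1) = nextObs I (epochObs π I u s k)
    (epochAssign π I u s k) (streamRace (epochObs π I u s k).time.toReal (epochDeadline π I u s k)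
      (busy (epochAssign π I u s k)) (tickRun π I u s k).2.1).1.1 := by
  simp only [epochObs, tickRun, extend, Fin.snoc_last]
  rfl

lemma epochObs_eq_never {k : ℕ} (h : (epochObs π I u s k).time = ⊤) :
    epochObs π I u s k = Obs.never := by
  cases k with
  | zero => exact absurd h EReal.zero_ne_top
  | succ k =>
    rw [epochObs_succ] at h ⊢
    rw [nextObs_time] at h
    rw [nextObs, if_pos h]

lemma epochAssign_feasible (k : ℕ) : (epochObs π I u s k).Feasible (epochAssign π I u s k) :=
  π.feasible k _ u

lemma epochObs_succ_of_eq_top {k : ℕ} (h : (epochObs π I u s k).time = ⊤) :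
    epochObs π I u s (k + 1) = Obs.never ∧ epochCount π I u s (k + 1) = epochCount π I u s k := by
  have h1 : busy (π.assign k (tickRun π I u s k).1 u) = ∅ :=
    busy_eq_empty_of_never (by
      rw [← epochObs_eq_never h]; exact epochAssign_feasible k)
  have h2 : deadline π I u (tickRun π I u s k).1 = ⊤ := deadline_eq_top h
  simp only [epochObs, epochCount, tickRun, h1, h2, extend, Fin.snoc_last,
    streamRace_of_eq_top fun n => tickRace_top_empty (M := M) n _ _]
  exact ⟨if_pos rfl, rfl⟩

lemma matches_tickRun {k : ℕ} (h : (epochObs π I u s k).time ≠ ⊤) :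
    Matches s (epochCount π I u s k) (epochObs π I u s k).time.toReal (tickRun π I u s k).2.1 := by
  induction k with
  | zero =>
    refine ⟨?_, fun i => ?_⟩
    · simp [tickRun, epochCount, epochObs, initObs, observe, tickTime]
    · simp [tickRun, epochCount]
  | succ k ih =>
    by_cases h0 : (epochObs π I u s k).time = ⊤
    · rw [(epochObs_succ_of_eq_top h0).1] at h
      exact absurd rfl h
    · have hm := ih h0
      by_cases hc : ∃ c, Ends s (epochDeadline π I u s k) (busy (epochAssign π I u s k))
          (epochCount π I u s k) c
      · obtain ⟨c, hc⟩ := hc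
        obtain ⟨e1, e2, e3⟩ := streamRace_of_ends hm hc
        have ht : (epochObs π I u s (k + 1)).time = (endOutcome s (epochDeadline π I u s k) c).1.1 := by
          rw [← e1, epochObs_succ, nextObs_time]
        rw [ht]
        have hJ : epochCount π I u s (k + 1) = (endOutcome s (epochDeadline π I u s k) c).2 := by
          rw [← e2]; rfl
        rw [hJ]
        exact e3
      · push Not at hc
        have e := streamRace_of_not_ends hm hc
        refine absurd ?_ h
        rw [epochObs_succ, nextObs_time]
        exact congrArg (fun x => x.1.1.1) e

lemma epochObs_succ_of_ends {k c : ℕ} (h : EpochEnds π I u s k c) :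
    epochObs π I u s (k + 1) = nextObs I (epochObs π I u s k) (epochAssign π I u s k)
      (endOutcome s (epochDeadline π I u s k) c).1 ∧
    epochCount π I u s (k + 1) = (endOutcome s (epochDeadline π I u s k) c).2 := by
  obtain ⟨e1, e2, -⟩ := streamRace_of_ends (matches_tickRun h.1) h.2
  rw [← e1, ← e2]
  exact ⟨epochObs_succ k, rfl⟩

lemma epochObs_succ_of_not_ends {k : ℕ} (h : ∀ c, ¬ EpochEnds π I u s k c) :
    epochObs π I u s (k + 1) = Obs.never ∧ epochCount π I u s (k + 1) = epochCount π I u s k := by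
  by_cases h0 : (epochObs π I u s k).time = ⊤
  · exact epochObs_succ_of_eq_top h0
  · have e := streamRace_of_not_ends (matches_tickRun h0) fun c hc => h c ⟨h0, hc⟩
    have e' : streamRace ((tickRun π I u s k).1 (Fin.last k)).time.toReal
      (deadline π I u (tickRun π I u s k).1) (busy (π.assign k (tickRun π I u s k).1 u))
      (tickRun π I u s k).2.1 = (((⊤, none), (tickRun π I u s k).2.1), 0) := e
    simp only [epochObs, epochCount, tickRun, extend, Fin.snoc_last, e']
    exact ⟨if_pos rfl, rfl⟩

end Epochs


/-! ## The assignments at the ticks -/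

section Active

variable {N M : ℕ} (π : Policy N M) (I : Arrivals N) (u : ℝ) (s : Stream M)

/-- The `j`-th tick comes during the period after the `k`-th decision epoch. -/
structure Active (k j : ℕ) : Prop where
  time_ne_top : (epochObs π I u s k).time ≠ ⊤
  count_le : epochCount π I u s k ≤ j
  idle : ∀ i, epochCount π I u s k ≤ i → i < j → (s i).2.1 ∉ busy (epochAssign π I u s k)
  lt_deadline : (tickTime s j : EReal) < epochDeadline π I u s k

open Classical in
/-- The assignment at the time of the `j`-th tick. -/
noncomputable def tickAssign (j : ℕ) : Fin M → Slot N :=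
  -- If the decision epochs accumulate before the tick, no period contains it; nothing is then
  -- transmitted.
  if h : ∃ k, Active π I u s k j then epochAssign π I u s (Nat.find h) else fun _ => none

/-- The `j`-th tick delivers packet `i` of flow `n`. -/
def TickDelivers (j : ℕ) (n : Fin N) (i : ℕ) : Prop :=
  tickAssign π I u s j (s j).2.1 = some (n, i) ∧ (s j).2.2 = false

variable {π I u s}

lemma endOutcome_ne_top {dl : EReal} {c : ℕ} :
    (endOutcome s dl c).1.1 ≠ ⊤ := by
  rw [endOutcome]
  split_ifs with h
  · exact fun h' => by rw [show dl = ⊤ from h'] at h; exact absurd h (by simp)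
  · exact EReal.coe_ne_top _

lemma le_endOutcome_snd {dl : EReal} {c : ℕ} : c ≤ (endOutcome s dl c).2 := by
  rw [endOutcome]; split_ifs
  exacts [le_rfl, Nat.le_succ c]

lemma epochCount_le_succ (k : ℕ) : epochCount π I u s k ≤ epochCount π I u s (k + 1) :=
  Nat.le_add_right _ _

lemma epochCount_mono : Monotone (epochCount π I u s) := monotone_nat_of_le_succ epochCount_le_succ

lemma epochObs_time_ne_bot (k : ℕ) : (epochObs π I u s k).time ≠ ⊥ := tickRun_time_ne_bot π I u s k

lemma epochObs_time_le_deadline (k : ℕ) (h : (epochObs π I u s k).time ≠ ⊤) :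
    (epochObs π I u s k).time ≤ epochDeadline π I u s k := by
  have := coe_toReal_le_deadline π I u (epochObs_time_ne_bot (π := π) (I := I) (u := u) (s := s) k)
  rwa [← epochObs, EReal.coe_toReal h (epochObs_time_ne_bot k)] at this

lemma EpochEnds.time_succ {k c : ℕ} (h : EpochEnds π I u s k c) :
    (epochObs π I u s (k + 1)).time = (endOutcome s (epochDeadline π I u s k) c).1.1 := by
  rw [(epochObs_succ_of_ends h).1, nextObs_time]

lemma exists_epochEnds {k : ℕ} (h : (epochObs π I u s (k + 1)).time ≠ ⊤) :
    ∃ c, EpochEnds π I u s k c := by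
  by_contra hc
  push Not at hc
  rw [(epochObs_succ_of_not_ends hc).1] at h
  exact h rfl

lemma epochObs_time_top_of_le {k k' : ℕ} (hk : k ≤ k') (h : (epochObs π I u s k).time = ⊤) :
    (epochObs π I u s k').time = ⊤ := by
  induction k', hk using Nat.le_induction with
  | base => exact h
  | succ k' _ ih => rw [(epochObs_succ_of_eq_top ih).1]; rfl

lemma epochObs_time_bounds (hs : GoodStream s) {k : ℕ} (h : (epochObs π I u s k).time ≠ ⊤) :
    (∀ i < epochCount π I u s k, (tickTime s i : EReal) ≤ (epochObs π I u s k).time) ∧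
      (epochObs π I u s k).time ≤ tickTime s (epochCount π I u s k) := by
  induction k with
  | zero =>
    refine ⟨fun i hi => absurd hi (Nat.not_lt_zero i), ?_⟩
    exact EReal.coe_nonneg.2 (hs.tickTime_pos _).le
  | succ k ih =>
    obtain ⟨c, hc⟩ := exists_epochEnds h
    obtain ⟨h1, h2⟩ := ih hc.1
    have hle := epochObs_time_le_deadline k hc.1
    rw [hc.time_succ, (epochObs_succ_of_ends hc).2, endOutcome]
    split_ifs with hdl
    · refine ⟨fun i hi => ?_, hdl⟩
      by_cases hik : i < epochCount π I u s k
      · exact (h1 i hik).trans hle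
      · exact (hc.2.before i (not_lt.1 hik) hi).1.le
    · refine ⟨fun i hi => ?_, ?_⟩
      · exact EReal.coe_le_coe_iff.2 (hs.strictMono_tickTime.monotone (Nat.lt_succ_iff.1 hi))
      · exact EReal.coe_le_coe_iff.2 (hs.strictMono_tickTime.monotone (Nat.le_succ c))

/-- A tick during a period either ends the period or has been passed when it ends. Hence a tick
belongs to at most one period. -/
lemma Active.succ (hs : GoodStream s) {k j : ℕ} (h : Active π I u s k j) :
    (epochObs π I u s (k + 1)).time = ⊤ ∨ j < epochCount π I u s (k + 1) := by
  by_cases ht : (epochObs π I u s (k + 1)).time = ⊤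
  · exact .inl ht
  · right
    obtain ⟨c, hc⟩ := exists_epochEnds ht
    rw [(epochObs_succ_of_ends hc).2]
    have hjc : j ≤ c := by
      by_contra! hlt
      rcases hc.2.ends with h1 | h1
      · exact absurd (h1.trans (EReal.coe_le_coe_iff.2 (hs.strictMono_tickTime hlt).le))
          (not_le.2 h.lt_deadline)
      · exact h.idle c hc.2.le hlt h1
    rcases hjc.eq_or_lt with rfl | hlt
    · rw [endOutcome, if_neg (not_le.2 h.lt_deadline)]
      exact Nat.lt_succ_self j
    · exact hlt.trans_le le_endOutcome_snd

lemma Active.unique (hs : GoodStream s) {k k' j : ℕ} (h : Active π I u s k j)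
    (h' : Active π I u s k' j) : k = k' := by
  have key : ∀ {k k'}, Active π I u s k j → Active π I u s k' j → ¬ k < k' := fun h h' hlt => by
    rcases h.succ hs with h1 | h1
    · exact h'.time_ne_top (epochObs_time_top_of_le hlt h1)
    · exact absurd (h1.trans_le (epochCount_mono hlt)) (not_lt.2 h'.count_le)
  rcases lt_trichotomy k k' with hlt | rfl | hlt
  exacts [absurd hlt (key h h'), rfl, absurd hlt (key h' h)]

lemma Active.tickAssign_eq (hs : GoodStream s) {k j : ℕ} (h : Active π I u s k j) :
    tickAssign π I u s j = epochAssign π I u s k := by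
  classical
  have hex : ∃ k, Active π I u s k j := ⟨k, h⟩
  rw [tickAssign, dif_pos hex, (Nat.find_spec hex).unique hs h]

lemma EpochEnds.active_of_lt {k c i : ℕ} (h : EpochEnds π I u s k c)
    (hi : epochCount π I u s k ≤ i) (hic : i < c) : Active π I u s k i :=
  ⟨h.1, hi, fun i' h1 h2 => (h.2.before i' h1 (h2.trans hic)).2, (h.2.before i hi hic).1⟩

lemma EpochEnds.active {k c : ℕ} (h : EpochEnds π I u s k c)
    (hc : ¬ epochDeadline π I u s k ≤ (tickTime s c : EReal)) : Active π I u s k c :=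
  ⟨h.1, h.2.le, fun i' h1 h2 => (h.2.before i' h1 h2).2, not_le.1 hc⟩

lemma Active.not_tickDelivers (hs : GoodStream s) {k j : ℕ} (h : Active π I u s k j)
    (hj : (s j).2.1 ∉ busy (epochAssign π I u s k)) (n : Fin N) (i : ℕ) :
    ¬ TickDelivers π I u s j n i := fun hd => by
  rw [TickDelivers, h.tickAssign_eq hs] at hd
  exact hj (mem_busy.2 (by rw [hd.1]; simp))

/-- Passage from epochs to ticks. The ticks inside a period that do not end it belong to idle
servers and deliver nothing, so each period adds at most the delivery of its final tick. -/
lemma epochObs_del (hs : GoodStream s) (k : ℕ) (n : Fin N) (i : ℕ) :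
    ((epochObs π I u s k).del n i = ⊤ ∨ ∃ j < epochCount π I u s k, TickDelivers π I u s j n i ∧
      (epochObs π I u s k).del n i = tickTime s j) ∧
    ((epochObs π I u s k).time ≠ ⊤ → ∀ j < epochCount π I u s k, TickDelivers π I u s j n i →
      (epochObs π I u s k).del n i ≠ ⊤) := by
  induction k with
  | zero => exact ⟨.inl rfl, fun _ j hj => absurd hj (Nat.not_lt_zero j)⟩
  | succ k ih =>
    by_cases hc : ∃ c, EpochEnds π I u s k c
    · obtain ⟨c, hc⟩ := hc
      have htop := endOutcome_ne_top (s := s) (dl := epochDeadline π I u s k) (c := c)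
      have hle : epochCount π I u s k ≤ epochCount π I u s (k + 1) := epochCount_le_succ k
      rw [(epochObs_succ_of_ends hc).1, nextObs, if_neg htop]
      simp only [observe]
      rw [(epochObs_succ_of_ends hc).2] at hle ⊢
      constructor
      · split_ifs with hm
        · right
          obtain ⟨m, hm1, hm2⟩ := hm
          rw [endOutcome] at hm1 ⊢
          by_cases hdl : epochDeadline π I u s k ≤ tickTime s c
          · rw [if_pos hdl] at hm1; simp at hm1
          · rw [if_neg hdl] at hm1 ⊢
            have hsc : (s c).2 = (m, false) := by simpa using hm1
            refine ⟨c, Nat.lt_succ_self c, ⟨?_, by rw [hsc]⟩, rfl⟩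
            rw [(hc.active hdl).tickAssign_eq hs, hsc, hm2]
        · rcases ih.1 with h | ⟨j, hj, hd, h⟩
          · exact .inl h
          · exact .inr ⟨j, hj.trans_le hle, hd, h⟩
      · intro _ j hj hd
        by_cases hjk : j < epochCount π I u s k
        · split_ifs
          · exact htop
          · exact ih.2 hc.1 j hjk hd
        · rw [not_lt] at hjk
          have hcj : ¬ j < c := fun hlt => (hc.active_of_lt hjk hlt).not_tickDelivers hs
            (hc.2.before j hjk hlt).2 n i hd
          rw [if_pos]
          · exact htop
          · rw [endOutcome] at hj ⊢
            split_ifs at hj ⊢ with hdl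
            · exact absurd hj hcj
            · obtain rfl : j = c := by simp only at hj; omega
              rw [TickDelivers, (hc.active hdl).tickAssign_eq hs] at hd
              refine ⟨(s j).2.1, ?_, hd.1⟩
              rw [← hd.2]
    · push Not at hc
      rw [(epochObs_succ_of_not_ends hc).1]
      exact ⟨.inl rfl, fun h => absurd rfl h⟩

lemma TickDelivers.active {j : ℕ} {n : Fin N} {i : ℕ} (h : TickDelivers π I u s j n i) :
    ∃ k, Active π I u s k j ∧ tickAssign π I u s j = epochAssign π I u s k := by
  classical
  by_cases hex : ∃ k, Active π I u s k j
  · exact ⟨Nat.find hex, Nat.find_spec hex, dif_pos hex⟩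
  · have h1 := h.1
    rw [tickAssign, dif_neg hex] at h1
    simp at h1

lemma TickDelivers.tickDelivery_le (hs : GoodStream s) {j : ℕ} {n : Fin N} {i : ℕ}
    (h : TickDelivers π I u s j n i) : tickDelivery π I u s n i ≤ tickTime s j := by
  obtain ⟨k, hk, he⟩ := h.active
  have hc : EpochEnds π I u s k j := by
    refine ⟨hk.time_ne_top, hk.count_le, .inr ?_, fun i h1 h2 => ⟨?_, hk.idle i h1 h2⟩⟩
    · rw [mem_busy, ← he, h.1]; simp
    · exact (EReal.coe_lt_coe_iff.2 (hs.strictMono_tickTime h2)).trans hk.lt_deadline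
  refine (iInf_le _ (k + 1)).trans (le_of_eq ?_)
  show (epochObs π I u s (k + 1)).del n i = _
  have htop := endOutcome_ne_top (s := s) (dl := epochDeadline π I u s k) (c := j)
  rw [(epochObs_succ_of_ends hc).1, nextObs, if_neg htop]
  simp only [observe]
  rw [endOutcome, if_neg (not_le.2 hk.lt_deadline), if_pos]
  refine ⟨(s j).2.1, ?_, he ▸ h.1⟩
  rw [← h.2]

/-- The packets which have been delivered by time `t`. -/
lemma tickDelivery_le_iff (hs : GoodStream s) {n : Fin N} {i : ℕ} {t : ℝ} :
    tickDelivery π I u s n i ≤ t ↔ ∃ j, tickTime s j ≤ t ∧ TickDelivers π I u s j n i := by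
  classical
  constructor
  · intro h
    have hex : ∃ j, TickDelivers π I u s j n i := by
      by_contra hno
      push Not at hno
      have : tickDelivery π I u s n i = ⊤ := by
        refine iInf_eq_top.2 fun k => ?_
        rcases (epochObs_del hs k n i).1 with h1 | ⟨j, -, hd, -⟩
        exacts [h1, absurd hd (hno j)]
      rw [this] at h
      exact absurd h (by simp)
    refine ⟨Nat.find hex, ?_, Nat.find_spec hex⟩
    rw [← EReal.coe_le_coe_iff]
    refine le_trans (le_iInf fun k => ?_) h
    show _ ≤ (epochObs π I u s k).del n i
    rcases (epochObs_del hs k n i).1 with h1 | ⟨j, -, hd, h1⟩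
    · rw [h1]; exact le_top
    · rw [h1, EReal.coe_le_coe_iff]
      exact hs.strictMono_tickTime.monotone (Nat.find_min' hex hd)
  · rintro ⟨j, hj, hd⟩
    exact (hd.tickDelivery_le hs).trans (EReal.coe_le_coe_iff.2 hj)

open Classical in
lemma epochObs_gen_arr {k : ℕ} (h : (epochObs π I u s k).time ≠ ⊤) (n : Fin N) (i : ℕ) :
    ((epochObs π I u s k).gen n i =
      if (I.2 n i : EReal) ≤ (epochObs π I u s k).time then (I.1 n i : EReal) else ⊤) ∧
    ((epochObs π I u s k).arr n i =
      if (I.2 n i : EReal) ≤ (epochObs π I u s k).time then (I.2 n i : EReal) else ⊤) := by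
  cases k with
  | zero => exact ⟨rfl, rfl⟩
  | succ k =>
    rw [epochObs_succ, nextObs_time] at h
    rw [epochObs_succ, nextObs, if_neg h]
    exact ⟨rfl, rfl⟩

/-- The next arrival is part of the deadline, so no packet arrives between the epoch and a tick that
comes before the deadline. -/
lemma Active.arrived_iff (hs : GoodStream s) {k j : ℕ} (h : Active π I u s k j) (n : Fin N) (i : ℕ) :
    (epochObs π I u s k).Arrived n i ↔ I.2 n i ≤ tickTime s j := by
  have hle : (epochObs π I u s k).time ≤ tickTime s j :=
    (epochObs_time_bounds hs h.time_ne_top).2.trans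
      (EReal.coe_le_coe_iff.2 (hs.strictMono_tickTime.monotone h.count_le))
  rw [Obs.Arrived, (epochObs_gen_arr h.time_ne_top n i).2, ← EReal.coe_le_coe_iff]
  constructor
  · intro h1
    split_ifs at h1 with h2
    · exact h2.trans hle
    · exact absurd rfl h1
  · intro h1
    rw [if_pos]
    · exact EReal.coe_ne_top _
    · by_contra! hlt
      have h2 : nextArrival I (epochObs π I u s k).time ≤ I.2 n i :=
        (iInf_le _ n).trans ((iInf_le _ i).trans (by rw [if_pos hlt]))
      exact absurd (h.lt_deadline.trans_le ((min_le_right _ _).trans (h2.trans h1))) (lt_irrefl _)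

/-- The earlier ticks of the same period belong to idle servers, so nothing is delivered between the
epoch and the tick. -/
lemma Active.delivered_iff (hs : GoodStream s) {k j : ℕ} (h : Active π I u s k j) (n : Fin N)
    (i : ℕ) : (epochObs π I u s k).Delivered n i ↔ ∃ j' < j, TickDelivers π I u s j' n i := by
  obtain ⟨h1, h2⟩ := epochObs_del (π := π) (I := I) (u := u) hs k n i
  constructor
  · intro hd
    rcases h1 with h1 | ⟨j', hj', hd', -⟩
    · exact absurd h1 hd
    · exact ⟨j', hj'.trans_le h.count_le, hd'⟩
  · rintro ⟨j', hj', hd'⟩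
    refine h2 h.time_ne_top j' ?_ hd'
    by_contra! hle
    have ha : Active π I u s k j' := ⟨h.time_ne_top, hle, fun i h3 h4 => h.idle i h3 (h4.trans hj'),
      (EReal.coe_lt_coe_iff.2 (hs.strictMono_tickTime hj')).trans h.lt_deadline⟩
    exact ha.not_tickDelivers hs (h.idle j' hle hj') n i hd'

lemma tickAssign_arrived (hs : GoodStream s) {j : ℕ} {m : Fin M} {n : Fin N} {i : ℕ}
    (h : tickAssign π I u s j m = some (n, i)) : I.2 n i ≤ tickTime s j := by
  classical
  by_cases hex : ∃ k, Active π I u s k j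
  · obtain ⟨k, hk⟩ := hex
    rw [hk.tickAssign_eq hs] at h
    exact (hk.arrived_iff hs n i).1 ((epochAssign_feasible k).1 m n i h).1
  · rw [tickAssign, dif_neg hex] at h
    simp at h

lemma tickAssign_injective {j : ℕ} {m m' : Fin M} {n : Fin N} {i i' : ℕ}
    (h : tickAssign π I u s j m = some (n, i)) (h' : tickAssign π I u s j m' = some (n, i')) :
    m = m' := by
  classical
  by_cases hex : ∃ k, Active π I u s k j
  · rw [tickAssign, dif_pos hex] at h h'
    exact (epochAssign_feasible _).2 m m' n i i' h h'
  · rw [tickAssign, dif_neg hex] at h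
    simp at h

/-! ### The past -/

/-- The streams `s` and `s'` agree up to the time of the `j`-th tick. -/
structure AgreeTo (s s' : Stream M) (j : ℕ) : Prop where
  past : ∀ i < j, s i = s' i
  gap : (s j).1 = (s' j).1

lemma AgreeTo.symm {s s' : Stream M} {j : ℕ} (h : AgreeTo s s' j) : AgreeTo s' s j :=
  ⟨fun i hi => (h.past i hi).symm, h.gap.symm⟩

lemma AgreeTo.of_le {s s' : Stream M} {i j : ℕ} (h : AgreeTo s s' j) (hij : i ≤ j) :
    AgreeTo s s' i := by
  refine ⟨fun k hk => h.past k (hk.trans_le hij), ?_⟩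
  rcases hij.eq_or_lt with rfl | hlt
  exacts [h.gap, by rw [h.past i hlt]]

lemma AgreeTo.tickTime {s s' : Stream M} {j : ℕ} (h : AgreeTo s s' j) :
    tickTime s j = tickTime s' j :=
  Finset.sum_congr rfl fun _ hi => (h.of_le (Nat.lt_succ_iff.1 (Finset.mem_range.1 hi))).gap

/-- An epoch with at most `j` ticks before it can depend on the time of the `j`-th tick, when a
deadline is compared with it, but not on its server or error bit: a period ended by the tick `c`
raises the count to `c + 1`, so then `c < j`. -/
lemma AgreeTo.tickRun_eq {s s' : Stream M} {j : ℕ} (h : AgreeTo s s' j) {k : ℕ}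
    (ht : (epochObs π I u s k).time ≠ ⊤) (hk : epochCount π I u s k ≤ j) :
    (tickRun π I u s k).1 = (tickRun π I u s' k).1 ∧
      epochCount π I u s k = epochCount π I u s' k := by
  induction k with
  | zero => exact ⟨rfl, rfl⟩
  | succ k ih =>
    obtain ⟨c, hc⟩ := exists_epochEnds ht
    obtain ⟨e1, e2⟩ := epochObs_succ_of_ends hc
    rw [e2] at hk
    have hcj : c ≤ j := le_endOutcome_snd.trans hk
    obtain ⟨h1, h2⟩ := ih hc.1 (hc.2.le.trans hcj)
    have hT := (h.of_le hcj).tickTime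
    have ho : epochObs π I u s k = epochObs π I u s' k := congrFun h1 _
    have ha : epochAssign π I u s k = epochAssign π I u s' k := by rw [epochAssign, h1]; rfl
    have hd : epochDeadline π I u s k = epochDeadline π I u s' k := by rw [epochDeadline, h1]; rfl
    have hout : endOutcome s (epochDeadline π I u s k) c = endOutcome s' (epochDeadline π I u s' k) c := by
      rw [endOutcome] at hk
      rw [endOutcome, endOutcome, ← hT, ← hd]
      split_ifs at hk ⊢
      · rfl
      · rw [h.past c hk]
    have hc' : EpochEnds π I u s' k c := by
      refine ⟨ho ▸ hc.1, h2 ▸ hc.2.le, ?_, fun i hi hic => ?_⟩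
      · rw [← hT, ← hd, ← ha]
        by_cases hdl : epochDeadline π I u s k ≤ StatusUpdate.tickTime s c
        · exact .inl hdl
        · right
          rw [endOutcome, if_neg hdl] at hk
          rw [← h.past c hk]
          exact hc.2.ends.resolve_left hdl
      · rw [← ha, ← hd, ← (h.of_le (hic.le.trans hcj)).tickTime, ← h.past i (hic.trans_le hcj)]
        exact hc.2.before i (h2 ▸ hi) hic
    obtain ⟨e1', e2'⟩ := epochObs_succ_of_ends hc'
    refine ⟨?_, by rw [e2, e2', hout]⟩
    have hlast : epochObs π I u s (k + 1) = epochObs π I u s' (k + 1) := by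
      rw [e1, e1', ho, ha, hout]
    funext i
    refine Fin.lastCases hlast (fun i => ?_) i
    rw [tickRun_castSucc, tickRun_castSucc, h1]

lemma AgreeTo.active {s s' : Stream M} {j : ℕ} (h : AgreeTo s s' j) {k : ℕ}
    (hk : Active π I u s k j) :
    Active π I u s' k j ∧ epochAssign π I u s k = epochAssign π I u s' k := by
  obtain ⟨h1, h2⟩ := h.tickRun_eq hk.time_ne_top hk.count_le
  have ho : epochObs π I u s k = epochObs π I u s' k := congrFun h1 _
  have ha : epochAssign π I u s k = epochAssign π I u s' k := by rw [epochAssign, h1]; rfl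
  have hd : epochDeadline π I u s k = epochDeadline π I u s' k := by rw [epochDeadline, h1]; rfl
  refine ⟨⟨ho ▸ hk.time_ne_top, h2 ▸ hk.count_le, fun i hi hij => ?_, ?_⟩, ha⟩
  · rw [← ha, ← h.past i hij]
    exact hk.idle i (h2 ▸ hi) hij
  · rw [← h.tickTime, ← hd]
    exact hk.lt_deadline

/-- The assignment at the time of a tick depends on the past only. -/
lemma AgreeTo.tickAssign {s s' : Stream M} {j : ℕ} (h : AgreeTo s s' j) :
    tickAssign π I u s j = tickAssign π I u s' j := by
  classical
  have hiff : ∀ k, Active π I u s k j ↔ Active π I u s' k j := fun k =>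
    ⟨fun hk => (h.active hk).1, fun hk => (h.symm.active hk).1⟩
  by_cases hex : ∃ k, Active π I u s k j
  · have hex' : ∃ k, Active π I u s' k j := by simpa only [hiff] using hex
    have hfind : Nat.find hex = Nat.find hex' :=
      Nat.find_congr' (fun {k} => hiff k)
    rw [StatusUpdate.tickAssign, dif_pos hex, StatusUpdate.tickAssign, dif_pos hex',
      (h.active (Nat.find_spec hex)).2, hfind]
  · have hex' : ¬ ∃ k, Active π I u s' k j := by simpa only [hiff] using hex
    rw [StatusUpdate.tickAssign, dif_neg hex, StatusUpdate.tickAssign, dif_neg hex']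

end Active


/-! ## The freshest delivered packets -/

section Newest

variable {N M : ℕ}

/-- The generation times of the freshest delivered packets, after a transmission of the packet `x`
has ended. -/
noncomputable def refresh (I : Arrivals N) (v : Fin N → ℝ) : Slot N → Bool → Fin N → ℝ
  | some (n, i), false => Function.update v n (max (v n) (I.1 n i))
  | some _, true => v
  | none, _ => v

lemma le_refresh (I : Arrivals N) (v : Fin N → ℝ) (x : Slot N) (b : Bool) : v ≤ refresh I v x b := by
  rcases x with _ | ⟨n, i⟩
  · exact le_rfl
  · cases b
    · intro n'
      by_cases h : n' = n
      · subst h; simp [refresh]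
      · simp [refresh, h]
    · exact le_rfl

/-- The generation time of the freshest packet of flow `n` which has been delivered by time `t`. -/
noncomputable def newestOf (a₀ : Fin N → ℝ≥0) (I : Arrivals N) (d : Fin N → ℕ → EReal) (n : Fin N)
    (t : ℝ≥0) : ℝ :=
  sSup (insert (-(a₀ n : ℝ)) {x | ∃ i, d n i ≤ ((t : ℝ) : EReal) ∧ x = I.1 n i})

variable (a₀ : Fin N → ℝ≥0) (π : Policy N M) (I : Arrivals N) (u : ℝ) (s : Stream M)

/-- The generation times of the freshest packets which have been delivered before the `j`-th tick. -/
noncomputable def tickNewest : ℕ → Fin N → ℝ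
  | 0 => fun n => -(a₀ n : ℝ)
  | j + 1 => refresh I (tickNewest j) (tickAssign π I u s j (s j).2.1) (s j).2.2

variable {a₀ π I u s}

/-- The recursive maximum is attained as well as an upper bound, so it can be identified both with
the supremum in the definition of the age and with the age that the scheduler observes. -/
lemma isGreatest_tickNewest (j : ℕ) (n : Fin N) :
    IsGreatest (insert (-(a₀ n : ℝ)) {x | ∃ i, (∃ j' < j, TickDelivers π I u s j' n i) ∧ x = I.1 n i})
      (tickNewest a₀ π I u s j n) := by
  induction j with
  | zero =>
    refine ⟨.inl rfl, ?_⟩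
    rintro x (rfl | ⟨i, ⟨j', hj', -⟩, -⟩)
    exacts [le_rfl, absurd hj' (Nat.not_lt_zero j')]
  | succ j ih =>
    have hold : tickNewest a₀ π I u s j n ≤ tickNewest a₀ π I u s (j + 1) n := le_refresh _ _ _ _ n
    constructor
    · have hkeep : tickNewest a₀ π I u s j n ∈ insert (-(a₀ n : ℝ))
          {x | ∃ i, (∃ j' < j + 1, TickDelivers π I u s j' n i) ∧ x = I.1 n i} := by
        rcases ih.1 with h | ⟨i, ⟨j', hj', hd⟩, hx⟩
        exacts [.inl h, .inr ⟨i, ⟨j', hj'.trans (Nat.lt_succ_self j), hd⟩, hx⟩]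
      rw [tickNewest]
      cases hx : tickAssign π I u s j (s j).2.1 with
      | none => exact hkeep
      | some p =>
        obtain ⟨n', i⟩ := p
        cases hb : (s j).2.2 with
        | true => exact hkeep
        | false =>
          by_cases hn : n = n'
          · subst hn
            simp only [refresh, Function.update_self]
            rcases max_choice (tickNewest a₀ π I u s j n) (I.1 n i) with h | h
            · rw [h]; exact hkeep
            · rw [h]; exact .inr ⟨i, ⟨j, Nat.lt_succ_self j, hx, hb⟩, rfl⟩
          · simp only [refresh, Function.update_of_ne hn]
            exact hkeep
    · rintro x (rfl | ⟨i, ⟨j', hj', hd⟩, rfl⟩)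
      · exact (ih.2 (.inl rfl)).trans hold
      · rcases Nat.lt_succ_iff_lt_or_eq.1 hj' with hlt | rfl
        · exact (ih.2 (.inr ⟨i, ⟨j', hlt, hd⟩, rfl⟩)).trans hold
        · rw [tickNewest, hd.1, hd.2]
          simp [refresh]

lemma newestOf_tickDelivery (hs : GoodStream s) {t : ℝ≥0} {j : ℕ}
    (hj : ∀ j', j' < j ↔ tickTime s j' ≤ t) (n : Fin N) :
    newestOf a₀ I (tickDelivery π I u s) n t = tickNewest a₀ π I u s j n := by
  rw [← (isGreatest_tickNewest j n).csSup_eq, newestOf]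
  congr 2
  ext x
  simp only [Set.mem_ofPred_eq, tickDelivery_le_iff hs, hj]

lemma GoodStream.exists_tickCount (hs : GoodStream s) (t : ℝ) :
    ∃ j, ∀ j', j' < j ↔ tickTime s j' ≤ t := by
  classical
  have hex : ∃ j, t < tickTime s j := by
    obtain ⟨n, hn⟩ := hs.exists_sum_ge (t + 1)
    exact ⟨n, lt_of_lt_of_le (by linarith) hn⟩
  refine ⟨Nat.find hex, fun j' => ⟨fun h => not_lt.1 (Nat.find_min hex h), fun h => ?_⟩⟩
  by_contra! hle
  exact absurd (hs.strictMono_tickTime.monotone hle) (not_le.2 (h.trans_lt (Nat.find_spec hex)))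

/-- Packet `i` is a most recently generated packet of flow `n` at time `T`. -/
def Fresh (I : Arrivals N) (T : ℝ) (n : Fin N) (i : ℕ) : Prop :=
  I.2 n i ≤ T ∧ ∀ i', I.2 n i' ≤ T → I.1 n i' ≤ I.1 n i

/-- The most recently generated packets are transmitted, in the order of decreasing ages, where `v`
is the vector of the generation times of the freshest delivered packets. -/
def FreshFirst (I : Arrivals N) (T : ℝ) (v : Fin N → ℝ) (a : Fin M → Slot N) : Prop :=
  -- The first alternative is that flow `n` has nothing newer to deliver.
  ∀ n, (∀ i, I.2 n i ≤ T → I.1 n i ≤ v n) ∨ (∃ m i, a m = some (n, i) ∧ Fresh I T n i) ∨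
    ∀ m, ∃ n' i', a m = some (n', i') ∧ Fresh I T n' i' ∧ v n' ≤ v n

lemma Active.freshest_iff (hs : GoodStream s) {k j : ℕ} (h : Active π I u s k j) (n : Fin N) (i : ℕ) :
    (epochObs π I u s k).Freshest n i ↔ Fresh I (tickTime s j) n i := by
  have hgen : ∀ i', (epochObs π I u s k).Arrived n i' → (epochObs π I u s k).gen n i' = I.1 n i' :=
    fun i' h' => by
      have h1 := (epochObs_gen_arr h.time_ne_top n i').2
      rw [(epochObs_gen_arr h.time_ne_top n i').1]
      rw [Obs.Arrived, h1] at h'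
      split_ifs at h' ⊢
      · rfl
      · exact absurd rfl h'
  rw [Obs.Freshest, Fresh, ← h.arrived_iff hs]
  refine and_congr_right fun hi => forall_congr' fun i' => ?_
  rw [← h.arrived_iff hs]
  refine forall_congr' fun hi' => ?_
  rw [hgen i hi, hgen i' hi', EReal.coe_le_coe_iff]

/-- The scheduler compares ages at the epoch, not at the tick. All ages share the time of the epoch,
and no delivery occurs in between, so the order of the ages is the reverse order of `tickNewest` at
the tick. -/
lemma Active.age_eq (hs : GoodStream s) {k j : ℕ} (h : Active π I u s k j) (n : Fin N) :
    (epochObs π I u s k).age a₀ n =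
      ((epochObs π I u s k).time.toReal - tickNewest a₀ π I u s j n : ℝ) := by
  have hmax : max (((-(a₀ n : ℝ) : ℝ)) : EReal) (⨆ i, ⨆ _ : (epochObs π I u s k).Delivered n i,
      (epochObs π I u s k).gen n i) = (tickNewest a₀ π I u s j n : EReal) := by
    have hg := isGreatest_tickNewest (a₀ := a₀) (π := π) (I := I) (u := u) (s := s) j n
    have hgen : ∀ i, (epochObs π I u s k).Delivered n i → (epochObs π I u s k).gen n i = I.1 n i := by
      intro i hd
      obtain ⟨j', hj', hd'⟩ := (h.delivered_iff hs n i).1 hd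
      have h1 := (h.arrived_iff hs n i).2 ((tickAssign_arrived hs hd'.1).trans
        (hs.strictMono_tickTime hj').le)
      rw [Obs.Arrived, (epochObs_gen_arr h.time_ne_top n i).2] at h1
      rw [(epochObs_gen_arr h.time_ne_top n i).1]
      split_ifs at h1 ⊢
      · rfl
      · exact absurd rfl h1
    refine le_antisymm (max_le (EReal.coe_le_coe_iff.2 (hg.2 (.inl rfl)))
      (iSup_le fun i => iSup_le fun hd => ?_)) ?_
    · rw [hgen i hd, EReal.coe_le_coe_iff]
      exact hg.2 (.inr ⟨i, (h.delivered_iff hs n i).1 hd, rfl⟩)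
    · rcases hg.1 with h1 | ⟨i, hi, h1⟩
      · rw [h1]; exact le_max_left _ _
      · rw [h1]
        have hd := (h.delivered_iff hs n i).2 hi
        rw [← hgen i hd]
        exact (le_iSup₂ (f := fun i (_ : (epochObs π I u s k).Delivered n i) =>
          (epochObs π I u s k).gen n i) i hd).trans (le_max_right _ _)
  rw [Obs.age, hmax, EReal.coe_sub, EReal.coe_toReal h.time_ne_top (epochObs_time_ne_bot k)]

lemma ValidArrivals.exists_fresh (hI : ValidArrivals I) {T : ℝ} {n : Fin N} {i : ℕ}
    (hi : I.2 n i ≤ T) : ∃ i', Fresh I T n i' := by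
  obtain ⟨i', h1, h2⟩ := Set.exists_max_image {i | I.2 n i ≤ T} (I.1 n) (hI.finite_arr n T) ⟨i, hi⟩
  exact ⟨i', h1, h2⟩

/-- A flow that is not pending either has no arrived packet or has a freshest packet that was
delivered; both mean that it is up to date. -/
lemma Active.freshFirst (hs : GoodStream s) (hI : ValidArrivals I) (hπ : π.IsPMAFLGFS a₀) {k j : ℕ}
    (h : Active π I u s k j) :
    FreshFirst I (tickTime s j) (tickNewest a₀ π I u s j) (tickAssign π I u s j) := by
  intro n
  rw [h.tickAssign_eq hs]
  have hmaf : (epochObs π I u s k).MaxAgeFirst a₀ (epochAssign π I u s k) :=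
    hπ.maxAgeFirst k (tickRun π I u s k).1 u
  by_cases hp : (epochObs π I u s k).Pending n
  · rcases hmaf n hp with ⟨m, i, h1, h2⟩ | h1
    · exact .inr (.inl ⟨m, i, h1, (h.freshest_iff hs n i).1 h2⟩)
    · refine .inr (.inr fun m => ?_)
      obtain ⟨n', i', h2, h3, h4⟩ := h1 m
      refine ⟨n', i', h2, (h.freshest_iff hs n' i').1 h3, ?_⟩
      rw [h.age_eq hs, h.age_eq hs, EReal.coe_le_coe_iff] at h4
      linarith
  · refine .inl fun i hi => ?_
    obtain ⟨i', hi'⟩ := hI.exists_fresh hi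
    have hf := (h.freshest_iff hs n i').2 hi'
    have : ∃ i'', (epochObs π I u s k).Freshest n i'' ∧ (epochObs π I u s k).Delivered n i'' := by
      by_contra! hno
      exact hp ⟨⟨i', hf⟩, fun i'' h2 h3 => hno i'' h2 h3⟩
    obtain ⟨i'', h2, h3⟩ := this
    refine (((h.freshest_iff hs n i'').1 h2).2 i hi).trans ?_
    exact (isGreatest_tickNewest j n).2 (.inr ⟨i'', (h.delivered_iff hs n i'').1 h3, rfl⟩)

/-- A policy which acts only when a packet arrives or a transmission ends is active at all ticks. -/
lemma exists_active (hs : GoodStream s) (hI : ValidArrivals I) (hw : ∀ k h u, π.wait k h u = ⊤)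
    (j : ℕ) : ∃ k, Active π I u s k j := by
  classical
  by_contra! hno
  set F : Set (Fin N × ℕ) := {p | I.2 p.1 p.2 ≤ tickTime s j} with hF
  have hFfin : ∀ t : ℝ, {p : Fin N × ℕ | I.2 p.1 p.2 ≤ t}.Finite := fun t => by
    have : {p : Fin N × ℕ | I.2 p.1 p.2 ≤ t} = ⋃ n, (Prod.mk n) '' {i | I.2 n i ≤ t} := by
      ext ⟨n, i⟩; simp
    rw [this]
    exact Set.finite_iUnion fun n => (hI.finite_arr n t).image _
  have hdl : ∀ k, (epochObs π I u s k).time ≠ ⊤ → epochDeadline π I u s k =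
      nextArrival I (epochObs π I u s k).time := fun k h => by
    rw [epochDeadline, deadline, hw, ← epochObs, EReal.add_top_of_ne_bot (epochObs_time_ne_bot k)]
    exact min_eq_right le_top
  -- If no period contained the `j`-th tick, every epoch would lie before it, and each new epoch
  -- would raise the number of used ticks or the number of arrived packets. Both are bounded, the
  -- second because finitely many packets arrive in bounded time.
  have key : ∀ k, (epochObs π I u s k).time ≠ ⊤ ∧ epochCount π I u s k ≤ j ∧
      (epochObs π I u s k).time ≤ tickTime s j ∧
      k ≤ epochCount π I u s k + {p : Fin N × ℕ | (I.2 p.1 p.2 : EReal) ≤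
        (epochObs π I u s k).time}.ncard := fun k => by
    induction k with
    | zero => exact ⟨EReal.zero_ne_top, Nat.zero_le _, EReal.coe_nonneg.2 (hs.tickTime_pos j).le,
        Nat.zero_le _⟩
    | succ k ih =>
      obtain ⟨h1, h2, h3, h4⟩ := ih
      have hends : ∃ i, epochCount π I u s k ≤ i ∧ i ≤ j ∧
          (epochDeadline π I u s k ≤ (tickTime s i : EReal) ∨
            i < j ∧ (s i).2.1 ∈ busy (epochAssign π I u s k)) := by
        by_contra! hcon
        exact hno k ⟨h1, h2, fun i hi hij => ((hcon i hi hij.le).2 hij), (hcon j h2 le_rfl).1⟩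
      obtain ⟨i, hi1, hi2, hi3⟩ := hends
      obtain ⟨c, hci, hc⟩ := exists_ends hi1 (hi3.imp_right And.right)
      have hE : EpochEnds π I u s k c := ⟨h1, hc⟩
      have hcj : c ≤ j := hci.trans hi2
      have htime := hE.time_succ
      have hcount := (epochObs_succ_of_ends hE).2
      have hTc : (tickTime s c : EReal) ≤ tickTime s j :=
        EReal.coe_le_coe_iff.2 (hs.strictMono_tickTime.monotone hcj)
      have hmono : (epochObs π I u s k).time ≤ (epochObs π I u s (k + 1)).time := by
        rw [htime, endOutcome]
        split_ifs
        · exact epochObs_time_le_deadline k h1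
        · exact (epochObs_time_bounds hs h1).2.trans
            (EReal.coe_le_coe_iff.2 (hs.strictMono_tickTime.monotone hc.le))
      have hle : (epochObs π I u s (k + 1)).time ≤ tickTime s j := by
        rw [htime, endOutcome]
        split_ifs with h5
        exacts [h5.trans hTc, hTc]
      have hne : (epochObs π I u s (k + 1)).time ≠ ⊤ := fun h => by
        rw [h] at hle; exact absurd hle (by simp)
      have hfin : {p : Fin N × ℕ | (I.2 p.1 p.2 : EReal) ≤ (epochObs π I u s (k + 1)).time}.Finite :=
        (hFfin (tickTime s j)).subset fun p hp => EReal.coe_le_coe_iff.1 (le_trans hp hle)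
      have hsub : {p : Fin N × ℕ | (I.2 p.1 p.2 : EReal) ≤ (epochObs π I u s k).time} ⊆
          {p : Fin N × ℕ | (I.2 p.1 p.2 : EReal) ≤ (epochObs π I u s (k + 1)).time} :=
        fun p hp => le_trans hp hmono
      refine ⟨hne, ?_, hle, ?_⟩
      · rw [hcount, endOutcome]
        split_ifs with h5
        · exact hcj
        · rcases hcj.eq_or_lt with rfl | hlt
          · exact absurd (hE.active h5) (hno k)
          · exact hlt
      · by_cases h5 : epochDeadline π I u s k ≤ tickTime s c
        · have ht : (epochObs π I u s (k + 1)).time = nextArrival I (epochObs π I u s k).time := by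
            rw [htime, endOutcome, if_pos h5, hdl k h1]
          have hlt : nextArrival I (epochObs π I u s k).time < (tickTime s j + 1 : ℝ) := by
            rw [← ht]
            exact hle.trans_lt (EReal.coe_lt_coe_iff.2 (by linarith))
          simp only [nextArrival, iInf_lt_iff] at hlt
          obtain ⟨n, i, hni⟩ := hlt
          have hni' : (epochObs π I u s k).time < (I.2 n i : EReal) := by
            by_contra h6
            rw [if_neg h6] at hni
            exact absurd hni (by simp [-EReal.coe_add])
          rw [if_pos hni', EReal.coe_lt_coe_iff] at hni
          -- The bound by `tickTime s j + 1` leaves finitely many candidates, so the infimum in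
          -- `nextArrival` is attained by a packet, which has arrived at the new epoch but not at
          -- the old one.
          obtain ⟨p, hp, hmin⟩ := Set.exists_min_image
            {p : Fin N × ℕ | I.2 p.1 p.2 ≤ tickTime s j + 1 ∧
              (epochObs π I u s k).time < (I.2 p.1 p.2 : EReal)} (fun p => I.2 p.1 p.2)
            ((hFfin (tickTime s j + 1)).subset fun p hp => hp.1) ⟨(n, i), hni.le, hni'⟩
          have hpt : (I.2 p.1 p.2 : EReal) ≤ (epochObs π I u s (k + 1)).time := by
            rw [ht]
            refine le_iInf fun n' => le_iInf fun i' => ?_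
            split_ifs with h6
            · rw [EReal.coe_le_coe_iff]
              by_cases h7 : I.2 n' i' ≤ tickTime s j + 1
              · exact hmin (n', i') ⟨h7, h6⟩
              · exact hp.1.trans (not_le.1 h7).le
            · exact le_top
          have hss : {p : Fin N × ℕ | (I.2 p.1 p.2 : EReal) ≤ (epochObs π I u s k).time} ⊂
              {p : Fin N × ℕ | (I.2 p.1 p.2 : EReal) ≤ (epochObs π I u s (k + 1)).time} :=
            ⟨hsub, fun h => absurd (h hpt) (not_le.2 hp.2)⟩
          have := Set.ncard_lt_ncard hss hfin
          have := epochCount_le_succ (π := π) (I := I) (u := u) (s := s) k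
          omega
        · rw [endOutcome, if_neg h5] at hcount
          have := Set.ncard_le_ncard hsub hfin
          have := hc.le
          simp only at hcount
          omega
  obtain ⟨-, h1, h2, h3⟩ := key (j + F.ncard + 1)
  have hsub : {p : Fin N × ℕ | (I.2 p.1 p.2 : EReal) ≤
      (epochObs π I u s (j + F.ncard + 1)).time} ⊆ F :=
    fun p hp => EReal.coe_le_coe_iff.1 (le_trans hp h2)
  have := Set.ncard_le_ncard hsub (hFfin _)
  omega

end Newest


/-! ## Domination of the freshest delivered packets -/

section Domination

variable {N M : ℕ}

/-- Up to a permutation of the flows, `w` is at least `v`. -/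
def Dominated (v w : Fin N → ℝ) : Prop := ∃ σ : Equiv.Perm (Fin N), ∀ n, v n ≤ w (σ n)

lemma Dominated.refl (v : Fin N → ℝ) : Dominated v v := ⟨1, fun _ => le_rfl⟩

lemma Dominated.trans_le {v w w' : Fin N → ℝ} (h : Dominated v w) (hw : w ≤ w') : Dominated v w' := by
  obtain ⟨σ, h⟩ := h
  exact ⟨σ, fun n => (h n).trans (hw _)⟩

/-- The servers can be matched in such a way that domination is preserved whichever server of the
first system ends its transmission, together with its partner in the second system. -/
def Matching (I : Arrivals N) (v w : Fin N → ℝ) (a b : Fin M → Slot N)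
    (τ : Equiv.Perm (Fin M)) : Prop :=
  ∀ m e, Dominated (refresh I v (a m) e) (refresh I w (b (τ m)) e)

/-- The flow `f` refreshed in the first system is assigned to the flow `g` refreshed in the second.
The former preimage of `g` is assigned to `σ f` instead, whose value is at least that of `g`. -/
lemma dominated_refresh_of_fresh {I : Arrivals N} {v w : Fin N → ℝ} {σ : Equiv.Perm (Fin N)}
    (hσ : ∀ n, v n ≤ w (σ n)) {f g : Fin N} {i i' : ℕ} (hgw : w g ≤ w (σ f))
    (hgen : max (v f) (I.1 f i) ≤ max (w g) (I.1 g i')) :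
    Dominated (refresh I v (some (f, i)) false) (refresh I w (some (g, i')) false) := by
  -- This sends `f` to `g` and `σ.symm g` to `σ f`, and agrees with `σ` elsewhere.
  refine ⟨σ * Equiv.swap f (σ.symm g), fun n => ?_⟩
  simp only [refresh, Equiv.Perm.coe_mul, Function.comp_apply]
  by_cases hnf : n = f
  · subst hnf
    simpa using hgen
  · rw [Function.update_of_ne hnf]
    by_cases hng : n = σ.symm g
    · subst hng
      rw [Equiv.swap_apply_right]
      by_cases hfg : σ f = g
      · exact absurd (by rw [← hfg, Equiv.symm_apply_apply]) hnf
      · rw [Function.update_of_ne hfg]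
        have := hσ (σ.symm g)
        rw [Equiv.apply_symm_apply] at this
        exact this.trans hgw
    · rw [Equiv.swap_apply_of_ne_of_ne hnf hng, Function.update_of_ne]
      · exact hσ n
      · rintro h
        exact hng (by rw [← h, Equiv.symm_apply_apply])

/-- Under synchronization the packet of flow `g` with the same number `i` has arrived too and has
the same generation time, so a freshest packet of one flow is at least as fresh as any arrived
packet of any flow. -/
lemma Fresh.gen_le (hI : Synchronized I) {T : ℝ} {f g : Fin N} {i i' : ℕ} (h : Fresh I T g i')
    (hi : I.2 f i ≤ T) : I.1 f i ≤ I.1 g i' := by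
  obtain ⟨S, A, hSA⟩ := hI
  rw [(hSA f i).1, ← (hSA g i).1]
  refine h.2 i ?_
  rwa [(hSA g i).2, ← (hSA f i).2]

/-- A server of the first system that transmits a packet of `f` is paired with the server that
transmits a freshest packet of `σ f`, if there is one. Otherwise `FreshFirst` leaves two cases: `σ
f` is up to date, or every server of the second system carries a freshest packet of a flow that is
no fresher than `σ f`. In both, any partner is good enough. -/
lemma exists_matching {I : Arrivals N} (hI : Synchronized I) {T : ℝ} {v w : Fin N → ℝ}
    (hvw : Dominated v w) {a b : Fin M → Slot N}
    (ha : ∀ m n i, a m = some (n, i) → I.2 n i ≤ T)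
    (ha' : ∀ m m' n i i', a m = some (n, i) → a m' = some (n, i') → m = m')
    (hb : FreshFirst I T w b) : ∃ τ, Matching I v w a b τ := by
  classical
  obtain ⟨σ, hσ⟩ := hvw
  -- The servers of the first system whose partner is prescribed.
  let S : Finset (Fin M) := Finset.univ.filter fun m =>
    ∃ f i m' i', a m = some (f, i) ∧ b m' = some (σ f, i') ∧ Fresh I T (σ f) i'
  have hS : ∀ m ∈ S, ∃ m', ∃ f i i', a m = some (f, i) ∧ b m' = some (σ f, i') ∧ Fresh I T (σ f) i' :=
    fun m hm => by
      obtain ⟨f, i, m', i', h⟩ := (Finset.mem_filter.1 hm).2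
      exact ⟨m', f, i, i', h⟩
  choose! partner hpartner using hS
  have hinj : Set.InjOn partner S := fun m hm m' hm' heq => by
    obtain ⟨f, i, i', h1, h2, -⟩ := hpartner m hm
    obtain ⟨f', j, j', h1', h2', -⟩ := hpartner m' hm'
    rw [heq, h2'] at h2
    have hf : σ f' = σ f := (Prod.mk.inj (Option.some.inj h2)).1
    rw [σ.injective hf] at h1'
    exact ha' m m' f i j h1 h1'
  -- The prescribed partners are distinct, since a flow occupies at most one server of the first
  -- system; the remaining servers are paired arbitrarily.
  obtain ⟨e, he⟩ := Finset.exists_equiv_extend_of_card_eq (t := (Finset.univ : Finset (Fin M)))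
    (by simp) (s := S) (f := partner) (Finset.subset_univ _) hinj
  let τ : Equiv.Perm (Fin M) := e.trans (Equiv.subtypeUnivEquiv fun m => Finset.mem_univ m)
  have hτ : ∀ m ∈ S, τ m = partner m := fun m hm => he m hm
  refine ⟨τ, fun m err => ?_⟩
  have hdom : Dominated v w := ⟨σ, hσ⟩
  cases err with
  | true =>
    have h1 : ∀ (v : Fin N → ℝ) (x : Slot N), refresh I v x true = v := fun v x => by
      cases x <;> rfl
    rw [h1, h1]
    exact hdom
  | false =>
    cases ham : a m with
    | none => exact hdom.trans_le (le_refresh _ _ _ _)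
    | some p =>
      obtain ⟨f, i⟩ := p
      have hfi := ha m f i ham
      by_cases hm : m ∈ S
      · obtain ⟨f', j, i', h1, h2, h3⟩ := hpartner m hm
        rw [ham] at h1
        obtain ⟨rfl, rfl⟩ := Prod.mk.inj (Option.some.inj h1)
        rw [hτ m hm, h2]
        exact dominated_refresh_of_fresh hσ le_rfl (max_le_max (hσ f) (h3.gen_le hI hfi))
      · rcases hb (σ f) with h | ⟨m', i', h1, h2⟩ | h
        · refine Dominated.trans_le ⟨σ, fun n => ?_⟩ (le_refresh _ _ _ _)
          simp only [refresh]
          by_cases hn : n = f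
          · subst hn
            rw [Function.update_self]
            refine max_le (hσ n) ?_
            obtain ⟨S', A', hSA⟩ := hI
            have := h i (by rwa [(hSA (σ n) i).2, ← (hSA n i).2])
            rwa [(hSA (σ n) i).1, ← (hSA n i).1] at this
          · rw [Function.update_of_ne hn]; exact hσ n
        · exact absurd (Finset.mem_filter.2 ⟨Finset.mem_univ _, f, i, m', i', ham, h1, h2⟩) hm
        · obtain ⟨g, i', h1, h2, h3⟩ := h (τ m)
          rw [h1]
          -- If `v f` already exceeds the generation time of a freshest packet, the transmission
          -- brings nothing new to `f` and the old permutation still works.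
          by_cases hle : v f ≤ I.1 g i'
          · exact dominated_refresh_of_fresh hσ h3
              (max_le (hle.trans (le_max_right _ _)) ((h2.gen_le hI hfi).trans (le_max_right _ _)))
          · refine Dominated.trans_le ⟨σ, fun n => ?_⟩ (le_refresh _ _ _ _)
            simp only [refresh]
            by_cases hn : n = f
            · subst hn
              rw [Function.update_self]
              exact max_le (hσ n) ((h2.gen_le hI hfi).trans ((not_le.1 hle).le.trans (hσ n)))
            · rw [Function.update_of_ne hn]; exact hσ n

end Domination


/-! ## Measurability of the assignments at the ticks -/

section TickMeasurability

variable {N M : ℕ}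

lemma measurable_tick (i : ℕ) : Measurable fun p : (Arrivals N × ℝ) × Stream M => p.2 i :=
  (measurable_pi_apply i).comp measurable_snd

lemma measurable_tickTime (j : ℕ) :
    Measurable fun p : (Arrivals N × ℝ) × Stream M => tickTime p.2 j :=
  Finset.measurable_sum _ fun i _ => (measurable_tick i).fst

variable (π : Policy N M)

lemma measurable_epochAssign (k : ℕ) :
    Measurable fun p : (Arrivals N × ℝ) × Stream M => epochAssign π p.1.1 p.1.2 p.2 k :=
  measurable_assign' π (measurable_tickRun π k).fst measurable_fst.snd

lemma measurable_epochDeadline (k : ℕ) :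
    Measurable fun p : (Arrivals N × ℝ) × Stream M => epochDeadline π p.1.1 p.1.2 p.2 k :=
  measurable_deadline π measurable_fst.fst measurable_fst.snd (measurable_tickRun π k).fst

lemma measurable_epochCount (k : ℕ) :
    Measurable fun p : (Arrivals N × ℝ) × Stream M => epochCount π p.1.1 p.1.2 p.2 k :=
  (measurable_tickRun π k).snd.snd

lemma measurableSet_active (k j : ℕ) :
    MeasurableSet {p : (Arrivals N × ℝ) × Stream M | Active π p.1.1 p.1.2 p.2 k j} := by
  have hset : {p : (Arrivals N × ℝ) × Stream M | Active π p.1.1 p.1.2 p.2 k j} =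
      {p | (epochObs π p.1.1 p.1.2 p.2 k).time ≠ ⊤} ∩
      {p | epochCount π p.1.1 p.1.2 p.2 k ≤ j} ∩
      (⋂ i ∈ Finset.range j, {p | epochCount π p.1.1 p.1.2 p.2 k ≤ i →
        (p.2 i).2.1 ∉ busy (epochAssign π p.1.1 p.1.2 p.2 k)}) ∩
      {p | (tickTime p.2 j : EReal) < epochDeadline π p.1.1 p.1.2 p.2 k} := by
    ext p
    simp only [Set.mem_ofPred_eq, Set.mem_inter_iff, Set.mem_iInter, Finset.mem_range]
    constructor
    · rintro ⟨h1, h2, h3, h4⟩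
      exact ⟨⟨⟨h1, h2⟩, fun i hi hi' => h3 i hi' hi⟩, h4⟩
    · rintro ⟨⟨⟨h1, h2⟩, h3⟩, h4⟩
      exact ⟨h1, h2, fun i hi hi' => h3 i hi' hi, h4⟩
  have htime : Measurable fun p : (Arrivals N × ℝ) × Stream M =>
      (epochObs π p.1.1 p.1.2 p.2 k).time := measurable_last_time (measurable_tickRun π k).fst
  rw [hset]
  refine ((MeasurableSet.inter ?_ ?_).inter (Finset.measurableSet_biInter _ fun i _ => ?_)).inter ?_
  · exact (htime (measurableSet_singleton ⊤)).compl
  · exact measurable_epochCount π k (MeasurableSet.of_discrete (s := Set.Iic j))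
  · exact ((measurable_epochCount π k).prodMk ((measurable_tick i).snd.fst.prodMk
      (measurable_epochAssign π k))) (MeasurableSet.of_discrete
        (s := {x : ℕ × Fin M × (Fin M → Slot N) | x.1 ≤ i → x.2.1 ∉ busy x.2.2}))
  · exact measurableSet_lt (measurable_tickTime j).coe_real_ereal (measurable_epochDeadline π k)

lemma measurable_tickAssign (j : ℕ) :
    Measurable fun p : (Arrivals N × ℝ) × Stream M => tickAssign π p.1.1 p.1.2 p.2 j := by
  classical
  refine measurable_to_countable' fun y => ?_
  have hset : (fun p : (Arrivals N × ℝ) × Stream M => tickAssign π p.1.1 p.1.2 p.2 j) ⁻¹' {y} =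
      ((⋂ k, {p | Active π p.1.1 p.1.2 p.2 k j}ᶜ) ∩ {_p | (fun _ => none) = y}) ∪
      ⋃ k, ({p | Active π p.1.1 p.1.2 p.2 k j} ∩
        (⋂ k' ∈ Finset.range k, {p | Active π p.1.1 p.1.2 p.2 k' j}ᶜ)) ∩
        {p | epochAssign π p.1.1 p.1.2 p.2 k = y} := by
    ext p
    simp only [Set.mem_preimage, Set.mem_singleton_iff, Set.mem_union, Set.mem_inter_iff,
      Set.mem_iInter, Set.mem_compl_iff, Set.mem_ofPred_eq, Set.mem_iUnion, Finset.mem_range]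
    by_cases hex : ∃ k, Active π p.1.1 p.1.2 p.2 k j
    · rw [tickAssign, dif_pos hex]
      constructor
      · intro h
        exact .inr ⟨Nat.find hex, ⟨Nat.find_spec hex, fun k' hk' => Nat.find_min hex hk'⟩, h⟩
      · rintro (⟨h, -⟩ | ⟨k, ⟨h1, h2⟩, h3⟩)
        · exact absurd hex (not_exists.2 h)
        · rwa [(Nat.find_eq_iff hex).2 ⟨h1, h2⟩]
    · rw [tickAssign, dif_neg hex]
      rw [not_exists] at hex
      constructor
      · intro h
        exact .inl ⟨hex, h⟩
      · rintro (⟨-, h⟩ | ⟨k, ⟨h1, -⟩, -⟩)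
        · exact h
        · exact absurd h1 (hex k)
  rw [hset]
  refine MeasurableSet.union (MeasurableSet.inter (MeasurableSet.iInter fun k =>
    (measurableSet_active π k j).compl) (MeasurableSet.const _)) (MeasurableSet.iUnion fun k =>
    MeasurableSet.inter (MeasurableSet.inter (measurableSet_active π k j)
    (Finset.measurableSet_biInter _ fun k' _ => (measurableSet_active π k' j).compl)) ?_)
  exact measurable_epochAssign π k (measurableSet_singleton y)

variable {α : Type*} [MeasurableSpace α]

lemma Measurable.refresh {I : α → Arrivals N} {v : α → Fin N → ℝ} {x : α → Slot N} {b : α → Bool}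
    (hI : Measurable I) (hv : Measurable v) (hx : Measurable x) (hb : Measurable b) :
    Measurable fun a => refresh (I a) (v a) (x a) (b a) := by
  classical
  refine measurable_pi_lambda _ fun n => ?_
  have hn : Measurable fun a => v a n := (measurable_pi_apply n).comp hv
  have h : Measurable fun q : α × (Slot N × Bool) => StatusUpdate.refresh (I q.1) (v q.1) q.2.1 q.2.2 n := by
    refine measurable_from_prod_countable_left fun y => ?_
    obtain ⟨_ | ⟨n', i⟩, e⟩ := y
    · exact hn
    · cases e
      · by_cases h : n = n'
        · subst h
          simp only [StatusUpdate.refresh, Function.update_self]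
          exact hn.max ((measurable_pi_apply i).comp ((measurable_pi_apply n).comp hI.fst))
        · simpa only [StatusUpdate.refresh, Function.update_of_ne h] using hn
      · exact hn
  exact h.comp (measurable_id.prodMk (hx.prodMk hb))

lemma measurable_tickNewest (a₀ : Fin N → ℝ≥0) (j : ℕ) :
    Measurable fun p : (Arrivals N × ℝ) × Stream M => tickNewest a₀ π p.1.1 p.1.2 p.2 j := by
  induction j with
  | zero => exact measurable_const
  | succ j ih =>
    refine Measurable.refresh measurable_fst.fst ih ?_ (measurable_tick j).snd.snd
    have : Measurable fun q : (Fin M → Slot N) × Fin M => q.1 q.2 := Measurable.of_discrete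
    exact this.comp ((measurable_tickAssign π j).prodMk (measurable_tick j).snd.fst)

lemma measurableSet_matching {I : α → Arrivals N} {v w : α → Fin N → ℝ} {a b : α → Fin M → Slot N}
    (hI : Measurable I) (hv : Measurable v) (hw : Measurable w) (ha : Measurable a)
    (hb : Measurable b) (τ : Equiv.Perm (Fin M)) :
    MeasurableSet {x | Matching (I x) (v x) (w x) (a x) (b x) τ} := by
  simp only [Matching, Dominated, Set.ofPred_forall, Set.ofPred_exists]
  refine MeasurableSet.iInter fun m => MeasurableSet.iInter fun e => MeasurableSet.iUnion fun σ =>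
    MeasurableSet.iInter fun n => measurableSet_le ?_ ?_
  · exact (measurable_pi_apply n).comp (Measurable.refresh hI hv ((measurable_pi_apply m).comp ha)
      measurable_const)
  · exact (measurable_pi_apply (σ n)).comp (Measurable.refresh hI hw
      ((measurable_pi_apply (τ m)).comp hb) measurable_const)

end TickMeasurability


/-! ## The coupling -/

section Pick

variable {M : ℕ}

open Classical in
/-- A permutation which satisfies `G`, if there is one. -/
noncomputable def pick (G : Equiv.Perm (Fin M) → Prop) : Equiv.Perm (Fin M) :=
  if h : ∃ τ, G τ then h.choose else 1

lemma pick_spec {G : Equiv.Perm (Fin M) → Prop} (h : ∃ τ, G τ) : G (pick G) := by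
  rw [pick, dif_pos h]; exact h.choose_spec

lemma measurable_pick (m : Fin M) :
    Measurable fun G : Equiv.Perm (Fin M) → Prop => pick G m :=
  have : Finite (Equiv.Perm (Fin M) → Prop) := Pi.finite
  measurable_of_finite _

/-- The choice depends on the data only through the truth values of `G` on the finite set of
permutations, so it is measurable once these events are. -/
lemma Measurable.pick {α : Type*} [MeasurableSpace α] {G : α → Equiv.Perm (Fin M) → Prop}
    {m : α → Fin M} (hG : ∀ τ, MeasurableSet {x | G x τ}) (hm : Measurable m) :
    Measurable fun x => pick (G x) (m x) := by
  have h1 : Measurable G := measurable_pi_lambda _ fun τ => measurableSet_setOfPred.1 (hG τ)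
  have h2 : Measurable fun q : (Equiv.Perm (Fin M) → Prop) × Fin M => StatusUpdate.pick q.1 q.2 :=
    measurable_from_prod_countable_left measurable_pick
  exact Measurable.comp (g := fun q : (Equiv.Perm (Fin M) → Prop) × Fin M => StatusUpdate.pick q.1 q.2)
    (f := fun x => (G x, m x)) h2 (h1.prodMk hm)

end Pick

/-! ### Matching the servers tick by tick. -/

section Coupling

variable {N M : ℕ} {a₀ : Fin N → ℝ≥0} {π : Policy N M} {I : Arrivals N} {u : ℝ}

lemma AgreeTo.tickNewest {s s' : Stream M} {j : ℕ} (h : AgreeTo s s' j) :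
    tickNewest a₀ π I u s j = tickNewest a₀ π I u s' j := by
  induction j with
  | zero => rfl
  | succ j ih =>
    have hj := h.of_le (Nat.le_succ j)
    rw [StatusUpdate.tickNewest, StatusUpdate.tickNewest, ih hj, hj.tickAssign,
      h.past j (Nat.lt_succ_self j)]

variable (a₀ : Fin N → ℝ≥0) (π P : Policy N M) (p : Arrivals N × ℝ)

/-- The servers can be matched at the `j`-th tick, where `π` is driven by `s` and `P` by `s'`. -/
def TickMatching (j : ℕ) (s s' : Stream M) (τ : Equiv.Perm (Fin M)) : Prop :=
  Matching p.1 (tickNewest a₀ π p.1 p.2 s j) (tickNewest a₀ P p.1 p.2 s' j)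
    (tickAssign π p.1 p.2 s j) (tickAssign P p.1 p.2 s' j) τ

/-- The tick `x` with the server matched. -/
noncomputable def matchTick (j : ℕ) (s s' : Stream M) (x : Tick M) : Tick M :=
  (x.1, (pick (TickMatching a₀ π P p j s s') x.2.1, x.2.2))

/-- The stream `s` with the servers of the first `j` ticks matched. -/
noncomputable def coupledTo : ℕ → Stream M → Stream M
  | 0, s => s
  | j + 1, s => Function.update (coupledTo j s) j (matchTick a₀ π P p j s (coupledTo j s) (s j))

/-- The stream which drives `P` if `s` drives `π`. -/
noncomputable def coupled (s : Stream M) (j : ℕ) : Tick M :=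
  matchTick a₀ π P p j s (coupledTo a₀ π P p j s) (s j)

variable {a₀ π P p}

lemma coupledTo_of_le {i j : ℕ} (h : j ≤ i) (s : Stream M) : coupledTo a₀ π P p j s i = s i := by
  induction j with
  | zero => rfl
  | succ j ih =>
    rw [coupledTo, Function.update_of_ne (by omega)]
    exact ih (by omega)

lemma coupledTo_of_lt {i j : ℕ} (h : i < j) (s : Stream M) :
    coupledTo a₀ π P p j s i = coupled a₀ π P p s i := by
  induction j with
  | zero => exact absurd h (Nat.not_lt_zero i)
  | succ j ih =>
    rw [coupledTo]
    rcases Nat.lt_succ_iff_lt_or_eq.1 h with h1 | rfl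
    · rw [Function.update_of_ne h1.ne, ih h1]
    · rw [Function.update_self]; rfl

/-- The permutation at the `j`-th tick has to be chosen before the stream of `P` is known at `j`.
`coupledTo` stands in for `coupled` there; it may differ at `j` in the server, which the assignment
at that tick does not depend on. -/
lemma agreeTo_coupledTo (s : Stream M) (j : ℕ) :
    AgreeTo (coupledTo a₀ π P p j s) (coupled a₀ π P p s) j :=
  ⟨fun _ hi => coupledTo_of_lt hi s, by rw [coupledTo_of_le le_rfl]; rfl⟩

lemma TickMatching.congr {j : ℕ} {s s' r r' : Stream M} (h : AgreeTo s r j) (h' : AgreeTo s' r' j) :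
    TickMatching a₀ π P p j s s' = TickMatching a₀ π P p j r r' := by
  funext τ
  rw [TickMatching, TickMatching, h.tickNewest, h'.tickNewest, h.tickAssign, h'.tickAssign]

lemma AgreeTo.coupledTo {s r : Stream M} {j : ℕ} (h : AgreeTo s r j) :
    AgreeTo (coupledTo a₀ π P p j s) (coupledTo a₀ π P p j r) j := by
  induction j with
  | zero => exact h
  | succ j ih =>
    have hj := h.of_le (Nat.le_succ j)
    refine ⟨fun i hi => ?_, ?_⟩
    · rw [StatusUpdate.coupledTo, StatusUpdate.coupledTo]
      rcases Nat.lt_succ_iff_lt_or_eq.1 hi with h1 | rfl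
      · rw [Function.update_of_ne h1.ne, Function.update_of_ne h1.ne]
        exact (ih hj).past i h1
      · rw [Function.update_self, Function.update_self, matchTick, matchTick,
          TickMatching.congr hj (ih hj), h.past i hi]
    · rw [coupledTo_of_le le_rfl, coupledTo_of_le le_rfl]
      exact h.gap

/-- If `P` is a maximum age first policy, then its state dominates that of `π` in the coupling. -/
lemma dominated_tickNewest {s : Stream M} (hs : GoodStream s) (hs' : GoodStream (coupled a₀ π P p s))
    (hI : ValidArrivals p.1) (hsync : Synchronized p.1) (hP : P.IsPMAFLGFS a₀) (j : ℕ) :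
    Dominated (tickNewest a₀ π p.1 p.2 s j)
      (tickNewest a₀ P p.1 p.2 (coupled a₀ π P p s) j) := by
  induction j with
  | zero => exact Dominated.refl _
  | succ j ih =>
    obtain ⟨k, hk⟩ := exists_active (u := p.2) hs' hI hP.wait_eq_top j
    -- The coupling keeps the gaps, so the tick times of `s` and of the coupled stream are the same
    -- by definition. This is why one time `T` serves both policies.
    have hex : ∃ τ, TickMatching a₀ π P p j s (coupled a₀ π P p s) τ :=
      exists_matching hsync ih (T := tickTime s j) (fun m n i h => tickAssign_arrived hs h)
        (fun m m' n i i' h h' => tickAssign_injective h h') (hk.freshFirst hs' hI hP)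
    have heq := TickMatching.congr (a₀ := a₀) (π := π) (P := P) (p := p)
      (⟨fun _ _ => rfl, rfl⟩ : AgreeTo s s j) (agreeTo_coupledTo (a₀ := a₀) (π := π) (P := P) (p := p) s j)
    -- The property of the matching, read at the server and error bit of the actual tick, is the
    -- claim after the update.
    have h := pick_spec hex (s j).2.1 (s j).2.2
    rw [← heq] at h
    exact h

/-! ### The law of the coupled stream -/

lemma measurable_tickMatching {α : Type*} [MeasurableSpace α] {x : α → Arrivals N × ℝ}
    {s s' : α → Stream M} (hx : Measurable x) (hs : Measurable s) (hs' : Measurable s') (j : ℕ)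
    (τ : Equiv.Perm (Fin M)) : MeasurableSet {a | TickMatching a₀ π P (x a) j (s a) (s' a) τ} := by
  have h := hx.prodMk hs
  have h' := hx.prodMk hs'
  exact measurableSet_matching (a := fun a => tickAssign π (x a).1 (x a).2 (s a) j)
    (b := fun a => tickAssign P (x a).1 (x a).2 (s' a) j) hx.fst
    ((measurable_tickNewest π a₀ j).comp h) ((measurable_tickNewest P a₀ j).comp h')
    ((measurable_tickAssign π j).comp h) ((measurable_tickAssign P j).comp h') τ

lemma measurable_matchTick {α : Type*} [MeasurableSpace α] {x : α → Arrivals N × ℝ}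
    {s s' : α → Stream M} {y : α → Tick M} (hx : Measurable x) (hs : Measurable s)
    (hs' : Measurable s') (hy : Measurable y) (j : ℕ) :
    Measurable fun a => matchTick a₀ π P (x a) j (s a) (s' a) (y a) :=
  hy.fst.prodMk ((Measurable.pick (measurable_tickMatching hx hs hs' j) hy.snd.fst).prodMk hy.snd.snd)

lemma measurable_coupledTo (j : ℕ) :
    Measurable fun q : (Arrivals N × ℝ) × Stream M => coupledTo a₀ π P q.1 j q.2 := by
  induction j with
  | zero => exact measurable_snd
  | succ j ih =>
    refine measurable_pi_lambda _ fun i => ?_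
    simp only [coupledTo]
    by_cases h : i = j
    · subst h
      simp only [Function.update_self]
      exact measurable_matchTick measurable_fst measurable_snd ih (measurable_tick i) i
    · simp only [Function.update_of_ne h]
      exact (measurable_pi_apply i).comp ih

lemma measurable_coupled :
    Measurable fun q : (Arrivals N × ℝ) × Stream M => coupled a₀ π P q.1 q.2 :=
  measurable_pi_lambda _ fun j => measurable_matchTick measurable_fst measurable_snd
    (measurable_coupledTo j) (measurable_tick j) j

variable {μ : ℝ} {β : Measure Bool} [IsProbabilityMeasure β]

lemma agreeTo_update {s r : Stream M} {j : ℕ} (h : ∀ i < j, s i = r i) {x y : Tick M}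
    (hxy : x.1 = y.1) : AgreeTo (Function.update s j x) (Function.update r j y) j :=
  ⟨fun i hi => by rw [Function.update_of_ne hi.ne, Function.update_of_ne hi.ne, h i hi],
    by simpa using hxy⟩

/-- The permutation applied at the `j`-th tick is a function of the earlier ticks and of the gap,
not of the server. The uniform law on the servers is invariant under permutations, so each tick
keeps its conditional law and `iid_map_adapted` applies. -/
lemma map_coupled [NeZero M] (hμ : 0 < μ) (p : Arrivals N × ℝ) :
    (streamLaw M μ β).map (coupled a₀ π P p) = streamLaw M μ β := by
  have := isProbabilityMeasure_tickLaw (M := M) hμ β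
  have hupd : ∀ j, Measurable fun q : Stream M × Tick M => Function.update q.1 j q.2 := fun j => by
    refine measurable_pi_lambda _ fun i => ?_
    by_cases h : i = j
    · subst h; simpa using measurable_snd
    · simp only [Function.update_of_ne h]
      exact (measurable_pi_apply i).comp measurable_fst
  -- Putting `x` in place of the `j`-th term makes the `j`-th map depend on the earlier terms alone.
  refine iid_map_adapted (tickLaw M μ β) (measurable_coupled.comp measurable_prodMk_left)
    (fun j s x => matchTick a₀ π P p j (Function.update s j x)
      (coupledTo a₀ π P p j (Function.update s j x)) x) (fun j => ?_) (fun s j => ?_)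
    (fun j s r h => ?_) fun j s t ht => ?_
  · exact measurable_matchTick measurable_const (hupd j)
      ((measurable_coupledTo j).comp (measurable_const.prodMk (hupd j))) measurable_snd j
  · rw [Function.update_eq_self]; rfl
  · funext x
    have h1 := agreeTo_update (x := x) h rfl
    rw [matchTick, matchTick, TickMatching.congr h1 h1.coupledTo]
  · have hψ : Measurable fun x => matchTick a₀ π P p j (Function.update s j x)
        (coupledTo a₀ π P p j (Function.update s j x)) x :=
      measurable_matchTick measurable_const ((hupd j).comp measurable_prodMk_left)
        ((measurable_coupledTo j).comp (measurable_const.prodMk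
          ((hupd j).comp measurable_prodMk_left))) measurable_id j
    have hind : Measurable (t.indicator (1 : Tick M → ℝ≥0∞)) := measurable_one.indicator ht
    have e1 : tickLaw M μ β t = ∫⁻ x, t.indicator 1 x ∂tickLaw M μ β := (lintegral_indicator_one ht).symm
    have e2 : tickLaw M μ β {x | matchTick a₀ π P p j (Function.update s j x)
        (coupledTo a₀ π P p j (Function.update s j x)) x ∈ t} =
        ∫⁻ x, t.indicator 1 (matchTick a₀ π P p j (Function.update s j x)
        (coupledTo a₀ π P p j (Function.update s j x)) x) ∂tickLaw M μ β :=
      (lintegral_indicator_one (hψ ht)).symm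
    rw [e1, e2, lintegral_tickLaw hμ hind]
    refine (lintegral_tickLaw hμ (hind.comp hψ)).trans ?_
    refine lintegral_congr fun g => ?_
    congr 1
    -- The server and error bit of the `j`-th tick of `r` are arbitrary: the permutation reads only
    -- the gap `g` there.
    set r : Stream M := Function.update s j (g, ((0 : Fin M), false)) with hr
    have hcongr : ∀ m b, TickMatching a₀ π P p j (Function.update s j (g, (m, b)))
        (coupledTo a₀ π P p j (Function.update s j (g, (m, b)))) =
        TickMatching a₀ π P p j r (coupledTo a₀ π P p j r) := fun m b => by
      have h1 : AgreeTo (Function.update s j (g, (m, b))) r j := agreeTo_update (fun _ _ => rfl) rfl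
      exact TickMatching.congr h1 h1.coupledTo
    simp only [Function.comp_apply, matchTick, hcongr]
    exact Equiv.sum_comp (pick (TickMatching a₀ π P p j r (coupledTo a₀ π P p j r)))
      fun m => ∫⁻ b, t.indicator 1 (g, (m, b)) ∂β

lemma measurePreserving_coupled [NeZero M] (hμ : 0 < μ) (κ : Measure (Arrivals N × ℝ))
    [IsProbabilityMeasure κ] :
    MeasurePreserving (fun q : (Arrivals N × ℝ) × Stream M => (q.1, coupled a₀ π P q.1 q.2))
      (κ.prod (streamLaw M μ β)) (κ.prod (streamLaw M μ β)) := by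
  have := isProbabilityMeasure_tickLaw (M := M) hμ β
  exact (MeasurePreserving.id κ).skew_product (g := coupled a₀ π P) measurable_coupled
    (ae_of_all _ fun p => map_coupled hμ p)

end Coupling


/-! ## Gluing -/

section Gluing

variable {X E Ω : Type*} [MeasurableSpace X] [MeasurableSpace E] [MeasurableSpace Ω]

/-- If `K` and `H` have the same law, then there is a coupling under which they are equal. -/
lemma exists_kernel_eq [StandardBorelSpace Ω] [Nonempty Ω] [MeasurableEq E]
    (Λ : Measure X) [IsProbabilityMeasure Λ] (m : Measure Ω) [IsProbabilityMeasure m]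
    {K : X → E} {H : Ω → E} (hK : Measurable K) (hH : Measurable H) (h : Λ.map K = m.map H) :
    ∃ η : Kernel X Ω, IsMarkovKernel η ∧ η ∘ₘ Λ = m ∧ ∀ᵐ x ∂Λ, ∀ᵐ ω ∂η x, H ω = K x := by
  -- The kernel draws a sample point from its conditional law under `m`, given that `H` takes the
  -- value `K x`.
  refine ⟨(condDistrib id H m).comap K hK, inferInstance, ?_, ?_⟩
  · have hc := condDistrib_comp_map (μ := m) hH.aemeasurable (Y := id) aemeasurable_id
    rw [Measure.map_id, ← h] at hc
    refine Eq.trans (Measure.ext fun s hs => ?_) hc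
    rw [Measure.bind_apply hs (Kernel.aemeasurable _), Measure.bind_apply hs (Kernel.aemeasurable _),
      lintegral_map (Kernel.measurable_coe _ hs) hK]
    rfl
  · have hm : MeasurableSet {p : E × Ω | H p.2 = p.1} :=
      measurableSet_eq_fun (hH.comp measurable_snd) measurable_fst
    have h1 : ∀ᵐ p ∂(m.map H) ⊗ₘ condDistrib id H m, H p.2 = p.1 := by
      rw [compProd_map_condDistrib aemeasurable_id,
        ae_map_iff (hH.prodMk measurable_id).aemeasurable hm]
      exact ae_of_all _ fun ω => rfl
    have h2 := Measure.ae_ae_of_ae_compProd h1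
    rw [← h] at h2
    exact ae_of_ae_map hK.aemeasurable h2

/-- Random variables with the laws of `H₁` and `H₂` which are related can be realized as `H₁` and
`H₂` on a product of two copies of the space. -/
lemma exists_coupling_of_map_eq [StandardBorelSpace Ω] [Nonempty Ω] [MeasurableEq E]
    (Λ : Measure X) [IsProbabilityMeasure Λ] (m : Measure Ω) [IsProbabilityMeasure m]
    {K₁ K₂ : X → E} {H₁ H₂ : Ω → E} (hK₁ : Measurable K₁) (hK₂ : Measurable K₂)
    (hH₁ : Measurable H₁) (hH₂ : Measurable H₂) (h₁ : Λ.map K₁ = m.map H₁) (h₂ : Λ.map K₂ = m.map H₂)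
    {R : E → E → Prop} (hR : ∀ᵐ x ∂Λ, R (K₁ x) (K₂ x)) :
    ∃ Γ : Measure (X × Ω × Ω), Γ.map (fun y => y.2.1) = m ∧ Γ.map (fun y => y.2.2) = m ∧
      ∀ᵐ y ∂Γ, R (H₁ y.2.1) (H₂ y.2.2) := by
  obtain ⟨η₁, hη₁, e₁, r₁⟩ := exists_kernel_eq Λ m hK₁ hH₁ h₁
  obtain ⟨η₂, hη₂, e₂, r₂⟩ := exists_kernel_eq Λ m hK₂ hH₂ h₂
  -- Given `x`, the two sample points are drawn independently; only the marginals and the identities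
  -- between `H₁`, `H₂` and `K₁`, `K₂` matter.
  have hsnd : (Λ ⊗ₘ (η₁ ×ₖ η₂)).map Prod.snd = (η₁ ×ₖ η₂) ∘ₘ Λ := Measure.snd_compProd _ _
  refine ⟨Λ ⊗ₘ (η₁ ×ₖ η₂), ?_, ?_, ?_⟩
  · rw [show (fun y : X × Ω × Ω => y.2.1) = Prod.fst ∘ Prod.snd from rfl,
      ← Measure.map_map measurable_fst measurable_snd, hsnd, Measure.map_comp _ _ measurable_fst,
      ← Kernel.fst_eq, Kernel.fst_prod, e₁]
  · rw [show (fun y : X × Ω × Ω => y.2.2) = Prod.snd ∘ Prod.snd from rfl,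
      ← Measure.map_map measurable_snd measurable_snd, hsnd, Measure.map_comp _ _ measurable_snd,
      ← Kernel.snd_eq, Kernel.snd_prod, e₂]
  · have hfst : (Λ ⊗ₘ (η₁ ×ₖ η₂)).map Prod.fst = Λ := Measure.fst_compProd _ _
    have a0 : ∀ᵐ y ∂Λ ⊗ₘ (η₁ ×ₖ η₂), R (K₁ y.1) (K₂ y.1) :=
      ae_of_ae_map (f := Prod.fst) (p := fun x => R (K₁ x) (K₂ x)) measurable_fst.aemeasurable (by rw [hfst]; exact hR)
    have a1 : ∀ᵐ y ∂Λ ⊗ₘ (η₁ ×ₖ η₂), H₁ y.2.1 = K₁ y.1 := by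
      refine Measure.ae_compProd_of_ae_ae (measurableSet_eq_fun (by fun_prop) (by fun_prop)) ?_
      filter_upwards [r₁] with x hx
      rw [Kernel.prod_apply]
      exact Measure.quasiMeasurePreserving_fst.ae hx
    have a2 : ∀ᵐ y ∂Λ ⊗ₘ (η₁ ×ₖ η₂), H₂ y.2.2 = K₂ y.1 := by
      refine Measure.ae_compProd_of_ae_ae (measurableSet_eq_fun (by fun_prop) (by fun_prop)) ?_
      filter_upwards [r₂] with x hx
      rw [Kernel.prod_apply]
      exact Measure.quasiMeasurePreserving_snd.ae hx
    filter_upwards [a0, a1, a2] with y h0 h1 h2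
    rwa [h1, h2]

end Gluing

/-! ## Consequences of a coupling -/

section Consequences

variable {Y Ω : Type*} [MeasurableSpace Y] [MeasurableSpace Ω] {Γ : Measure Y} {m : Measure Ω}
  {f g : Y → Ω}

lemma stochLE_of_coupling (hf : Measurable f) (hg : Measurable g) (hΓf : Γ.map f = m)
    (hΓg : Γ.map g = m) {A B : Ω → ℝ≥0 → ℝ} (hA : ∀ t, Measurable fun ω => A ω t)
    (hB : ∀ t, Measurable fun ω => B ω t) (h : ∀ᵐ y ∂Γ, A (f y) ≤ B (g y)) : StochLE m A B := by
  intro n t _ U hU hUm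
  have hAU : MeasurableSet {ω | (fun j => A ω (t j)) ∈ U} :=
    (measurable_pi_lambda _ fun j => hA (t j)) hUm
  have hBU : MeasurableSet {ω | (fun j => B ω (t j)) ∈ U} :=
    (measurable_pi_lambda _ fun j => hB (t j)) hUm
  calc m {ω | (fun j => A ω (t j)) ∈ U} = Γ (f ⁻¹' {ω | (fun j => A ω (t j)) ∈ U}) := by
        rw [← hΓf, Measure.map_apply hf hAU]
    _ ≤ Γ (g ⁻¹' {ω | (fun j => B ω (t j)) ∈ U}) :=
        measure_mono_ae (h.mono fun y hy hyA => hU (fun j => hy (t j)) hyA)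
    _ = m {ω | (fun j => B ω (t j)) ∈ U} := by rw [← hΓg, Measure.map_apply hg hBU]

/-- The positive and negative parts are compared separately on the coupling space, so integrability
plays no role. Almost everywhere measurability suffices, as `f` and `g` push `Γ` forward to `m`. -/
lemma expectation_le_of_coupling (hf : Measurable f) (hg : Measurable g) (hΓf : Γ.map f = m)
    (hΓg : Γ.map g = m) {A B : Ω → ℝ} (hA : AEMeasurable A m) (hB : AEMeasurable B m)
    (h : ∀ᵐ y ∂Γ, A (f y) ≤ B (g y)) : expectation m A ≤ expectation m B := by
  have hmf : ∀ {C : Ω → ℝ≥0∞}, AEMeasurable C m → ∫⁻ ω, C ω ∂m = ∫⁻ y, C (f y) ∂Γ := fun hC => by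
    subst hΓf; exact lintegral_map' hC hf.aemeasurable
  have hmg : ∀ {C : Ω → ℝ≥0∞}, AEMeasurable C m → ∫⁻ ω, C ω ∂m = ∫⁻ y, C (g y) ∂Γ := fun hC => by
    subst hΓg; exact lintegral_map' hC hg.aemeasurable
  refine EReal.sub_le_sub (EReal.coe_ennreal_le_coe_ennreal_iff.2 ?_)
    (EReal.coe_ennreal_le_coe_ennreal_iff.2 ?_)
  · rw [hmf hA.ennreal_ofReal, hmg hB.ennreal_ofReal]
    exact lintegral_mono_ae (h.mono fun y hy => ENNReal.ofReal_le_ofReal hy)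
  · rw [hmf (C := fun ω => ENNReal.ofReal (-A ω)) hA.neg.ennreal_ofReal,
      hmg (C := fun ω => ENNReal.ofReal (-B ω)) hB.neg.ennreal_ofReal]
    exact lintegral_mono_ae (h.mono fun y hy => ENNReal.ofReal_le_ofReal (neg_le_neg hy))

end Consequences

/-! ## The penalty processes -/

section Penalties

variable {N M : ℕ}

lemma measurable_newestOf (a₀ : Fin N → ℝ≥0) (n : Fin N) (t : ℝ≥0) :
    Measurable fun e : Arrivals N × (Fin N → ℕ → EReal) => newestOf a₀ e.1 e.2 n t := by
  classical
  -- An undelivered packet contributes the initial value, which belongs to the set anyway; the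
  -- supremum thus runs over a fixed countable index set.
  have h : (fun e : Arrivals N × (Fin N → ℕ → EReal) => newestOf a₀ e.1 e.2 n t) = fun e =>
      ⨆ i : Option ℕ, i.elim (-(a₀ n : ℝ)) fun i =>
        if e.2 n i ≤ ((t : ℝ) : EReal) then e.1.1 n i else -(a₀ n : ℝ) := by
    funext e
    rw [newestOf, iSup]
    congr 1
    ext x
    simp only [Set.mem_insert_iff, Set.mem_ofPred_eq, Set.mem_range]
    constructor
    · rintro (rfl | ⟨i, hi, rfl⟩)
      · exact ⟨none, rfl⟩
      · exact ⟨some i, if_pos hi⟩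
    · rintro ⟨_ | i, rfl⟩
      · exact .inl rfl
      · by_cases hi : e.2 n i ≤ ((t : ℝ) : EReal)
        · exact .inr ⟨i, hi, if_pos hi⟩
        · exact .inl (if_neg hi)
  rw [h]
  refine Measurable.iSup fun i => ?_
  cases i with
  | none => exact measurable_const
  | some i =>
    refine Measurable.ite (measurableSet_le ?_ measurable_const) ?_ measurable_const
    · exact (measurable_pi_apply i).comp ((measurable_pi_apply n).comp measurable_snd)
    · exact (measurable_pi_apply i).comp ((measurable_pi_apply n).comp measurable_fst.fst)

lemma measurable_penalty (a₀ : Fin N → ℝ≥0) {p : ℝ≥0 → (Fin N → ℝ≥0) → ℝ}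
    (hpm : ∀ t, Measurable (p t)) (π : Policy N M) (t : ℝ≥0) :
    Measurable fun ω => π.penalty a₀ p ω t := by
  refine (hpm t).comp (measurable_pi_lambda _ fun n => Measurable.real_toNNReal ?_)
  exact measurable_const.sub ((measurable_newestOf a₀ n t).comp
    (measurable_fst.prodMk (measurable_delivery π)))

/-- Symmetry absorbs the permutation of the flows, and monotonicity applies because an older
freshest packet means a larger age. -/
lemma penalty_le_of_dominated (a₀ : Fin N → ℝ≥0) {p : ℝ≥0 → (Fin N → ℝ≥0) → ℝ}
    (hp : ∀ t, SymPenalty (p t)) {P π : Policy N M} {ω ω' : Sample N M} {t : ℝ≥0}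
    (h : Dominated (fun n => π.newest a₀ ω' n t) fun n => P.newest a₀ ω n t) :
    P.penalty a₀ p ω t ≤ π.penalty a₀ p ω' t := by
  obtain ⟨σ, hσ⟩ := h
  rw [Policy.penalty, Policy.penalty, ← (hp t).symm σ]
  exact (hp t).mono fun n => Real.toNNReal_le_toNNReal (sub_le_sub_left (hσ n) _)

/-- Without servers there is no uniform law on them and no stream of ticks, but then nothing is ever
delivered and all policies have the same ages. -/
lemma delivery_eq_top (π : Policy N 0) (ω : Sample N 0) (n : Fin N) (i : ℕ) :
    π.delivery ω n i = ⊤ := by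
  refine iInf_eq_top.2 fun k => ?_
  induction k with
  | zero => rfl
  | succ k ih => simpa [Policy.run, Policy.step, observe] using ih

/-- The arrivals and the deliveries of `P` and of `π` can be coupled such that `P` is always at
least as fresh as `π`, up to a permutation of the flows. -/
lemma exists_dominated_coupling [NeZero M] {μ : ℝ} (hμ : 0 < μ) (q : unitInterval)
    (a₀ : Fin N → ℝ≥0) (ν : Measure (Arrivals N)) [IsProbabilityMeasure ν]
    (hν : ∀ᵐ I ∂ν, ValidArrivals I) (hsync : ∀ᵐ I ∂ν, Synchronized I)
    (ρ : Measure ℝ) [IsProbabilityMeasure ρ] {P : Policy N M} (hP : P.IsPMAFLGFS a₀)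
    (π : Policy N M) :
    ∃ Γ : Measure (((Arrivals N × ℝ) × Stream M) × Sample N M × Sample N M),
      Γ.map (fun y => y.2.1) = sampleLaw N M μ q ν ρ ∧
      Γ.map (fun y => y.2.2) = sampleLaw N M μ q ν ρ ∧
      ∀ᵐ y ∂Γ, ∀ t, Dominated (fun n => π.newest a₀ y.2.2 n t) fun n => P.newest a₀ y.2.1 n t := by
  -- Needed for the conditional laws in `exists_coupling_of_map_eq`.
  have : StandardBorelSpace (Sample N M) := by
    have h1 : StandardBorelSpace (ℕ × Fin M → Bool) := inferInstance
    have h2 : StandardBorelSpace (ℕ × Fin M → ℝ) := inferInstance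
    have h3 : StandardBorelSpace (ℕ → ℝ) := inferInstance
    have h4 : StandardBorelSpace (Arrivals N) := inferInstance
    infer_instance
  have := isProbabilityMeasure_expMeasure hμ
  set β := bernoulliMeasure true false q with hβ
  have := isProbabilityMeasure_tickLaw (M := M) hμ β
  have : IsProbabilityMeasure (sampleLaw N M μ q ν ρ) := by rw [sampleLaw]; infer_instance
  have hcoup := measurePreserving_coupled (a₀ := a₀) (π := π) (P := P) (β := β) hμ (ν.prod ρ)
  have hmP : Measurable fun ω : Sample N M => (ω.arrivals, P.delivery ω) :=
    measurable_fst.prodMk (measurable_delivery P)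
  have hmπ : Measurable fun ω : Sample N M => (ω.arrivals, π.delivery ω) :=
    measurable_fst.prodMk (measurable_delivery π)
  have hkP : Measurable fun x : (Arrivals N × ℝ) × Stream M =>
      (x.1.1, tickDelivery P x.1.1 x.1.2 x.2) := measurable_fst.fst.prodMk (measurable_tickDelivery P)
  have hkπ : Measurable fun x : (Arrivals N × ℝ) × Stream M =>
      (x.1.1, tickDelivery π x.1.1 x.1.2 x.2) := measurable_fst.fst.prodMk (measurable_tickDelivery π)
  -- `P` runs on the relabelled stream; since this has the law of a stream, the deliveries of `P`
  -- have the correct law jointly with the arrivals.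
  have hlaw : ((ν.prod ρ).prod (streamLaw M μ β)).map
      ((fun x => (x.1.1, tickDelivery P x.1.1 x.1.2 x.2)) ∘
        fun x => (x.1, coupled a₀ π P x.1 x.2)) =
      (sampleLaw N M μ q ν ρ).map fun ω => (ω.arrivals, P.delivery ω) := by
    rw [← Measure.map_map hkP hcoup.measurable, hcoup.map_eq]
    exact (map_delivery P hμ q ν ρ).symm
  refine exists_coupling_of_map_eq ((ν.prod ρ).prod (streamLaw M μ β)) (sampleLaw N M μ q ν ρ)
    (hkP.comp hcoup.measurable) hkπ hmP hmπ hlaw (map_delivery π hμ q ν ρ).symm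
    (R := fun e e' => ∀ t, Dominated (fun n => newestOf a₀ e'.1 e'.2 n t)
      fun n => newestOf a₀ e.1 e.2 n t) ?_
  have hgood : ∀ᵐ x ∂(ν.prod ρ).prod (streamLaw M μ β), GoodStream x.2 :=
    Measure.quasiMeasurePreserving_snd.ae (ae_goodStream hμ)
  have hgood' : ∀ᵐ x ∂(ν.prod ρ).prod (streamLaw M μ β), GoodStream (coupled a₀ π P x.1 x.2) :=
    hcoup.quasiMeasurePreserving.ae hgood
  have hI : ∀ᵐ x ∂(ν.prod ρ).prod (streamLaw M μ β), ValidArrivals x.1.1 :=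
    Measure.quasiMeasurePreserving_fst.ae (Measure.quasiMeasurePreserving_fst.ae hν)
  have hS : ∀ᵐ x ∂(ν.prod ρ).prod (streamLaw M μ β), Synchronized x.1.1 :=
    Measure.quasiMeasurePreserving_fst.ae (Measure.quasiMeasurePreserving_fst.ae hsync)
  filter_upwards [hgood, hgood', hI, hS] with x hs hs' hI hS t
  obtain ⟨j, hj⟩ := hs.exists_tickCount t
  have h := dominated_tickNewest (π := π) hs hs' hI hS hP j
  have e1 : (fun n => newestOf a₀ x.1.1 (tickDelivery π x.1.1 x.1.2 x.2) n t) =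
      tickNewest a₀ π x.1.1 x.1.2 x.2 j := funext (newestOf_tickDelivery hs hj)
  -- The same `j` counts the ticks up to `t` in the coupled stream, because the coupling keeps the
  -- tick times.
  have e2 : (fun n => newestOf a₀ x.1.1 (tickDelivery P x.1.1 x.1.2 (coupled a₀ π P x.1 x.2)) n t) =
      tickNewest a₀ P x.1.1 x.1.2 (coupled a₀ π P x.1 x.2) j :=
    funext (newestOf_tickDelivery hs' hj)
  rw [← e1, ← e2] at h
  exact h

/-- The penalty processes of `P` and of `π` can be coupled such that the former is below the
latter. -/
lemma exists_penalty_coupling {μ : ℝ} (hμ : 0 < μ) (q : unitInterval)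
    (a₀ : Fin N → ℝ≥0) (ν : Measure (Arrivals N)) [IsProbabilityMeasure ν]
    (hν : ∀ᵐ I ∂ν, ValidArrivals I) (hsync : ∀ᵐ I ∂ν, Synchronized I)
    (ρ : Measure ℝ) [IsProbabilityMeasure ρ] {P : Policy N M} (hP : P.IsPMAFLGFS a₀)
    {p : ℝ≥0 → (Fin N → ℝ≥0) → ℝ} (hp : ∀ t, SymPenalty (p t)) (π : Policy N M) :
    ∃ (Y : Type) (_ : MeasurableSpace Y) (Γ : Measure Y) (f g : Y → Sample N M),
      Measurable f ∧ Measurable g ∧ Γ.map f = sampleLaw N M μ q ν ρ ∧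
      Γ.map g = sampleLaw N M μ q ν ρ ∧ ∀ᵐ y ∂Γ, P.penalty a₀ p (f y) ≤ π.penalty a₀ p (g y) := by
  rcases Nat.eq_zero_or_pos M with rfl | hM
  · refine ⟨Sample N 0, inferInstance, sampleLaw N 0 μ q ν ρ, id, id, measurable_id, measurable_id,
      Measure.map_id, Measure.map_id, ae_of_all _ fun ω t => penalty_le_of_dominated a₀ hp ?_⟩
    simp only [Policy.newest, delivery_eq_top]
    exact Dominated.refl _
  · have : NeZero M := ⟨hM.ne'⟩
    obtain ⟨Γ, h1, h2, h3⟩ := exists_dominated_coupling hμ q a₀ ν hν hsync ρ hP π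
    exact ⟨_, inferInstance, Γ, _, _, measurable_snd.fst, measurable_snd.snd, h1, h2,
      h3.mono fun y hy t => penalty_le_of_dominated a₀ hp (hy t)⟩

end Penalties

end StatusUpdate

theorem corollary1 (N M : ℕ) (μ : ℝ) (hμ : 0 < μ) (q : unitInterval) (hq : q < 1)
    (a₀ : Fin N → ℝ≥0)
    (ν : Measure (Arrivals N)) [IsProbabilityMeasure ν]
    (hν : ∀ᵐ I ∂ν, ValidArrivals I) (hsync : ∀ᵐ I ∂ν, Synchronized I)
    (ρ : Measure ℝ) [IsProbabilityMeasure ρ]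
    (P : Policy N M) (hP : P.IsPMAFLGFS a₀)
    (p : ℝ≥0 → (Fin N → ℝ≥0) → ℝ) (hp : ∀ t, SymPenalty (p t)) (hpm : ∀ t, Measurable (p t)) :
    (∀ π : Policy N M,
      StochLE (sampleLaw N M μ q ν ρ) (P.penalty a₀ p) (π.penalty a₀ p)) ∧
    (∀ φ : (ℝ≥0 → ℝ) → ℝ, Monotone φ →
      ExpectationExists (sampleLaw N M μ q ν ρ) (fun ω => φ (P.penalty a₀ p ω)) →
      IsLeast
        {e : EReal | ∃ π : Policy N M,
          ExpectationExists (sampleLaw N M μ q ν ρ) (fun ω => φ (π.penalty a₀ p ω)) ∧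
          e = expectation (sampleLaw N M μ q ν ρ) (fun ω => φ (π.penalty a₀ p ω))}
        (expectation (sampleLaw N M μ q ν ρ) (fun ω => φ (P.penalty a₀ p ω)))) := by
  refine ⟨fun π => ?_, fun φ hφ hex => ⟨⟨P, hex, rfl⟩, ?_⟩⟩
  · obtain ⟨Y, _, Γ, f, g, hf, hg, hΓf, hΓg, h⟩ :=
      exists_penalty_coupling hμ q a₀ ν hν hsync ρ hP hp π
    exact stochLE_of_coupling hf hg hΓf hΓg (measurable_penalty a₀ hpm P)
      (measurable_penalty a₀ hpm π) h
  · rintro e ⟨π, hπ, rfl⟩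
    obtain ⟨Y, _, Γ, f, g, hf, hg, hΓf, hΓg, h⟩ :=
      exists_penalty_coupling hμ q a₀ ν hν hsync ρ hP hp π
    exact expectation_le_of_coupling hf hg hΓf hΓg hex.1 hπ.1 (h.mono fun y hy => hφ hy)
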